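/- Let $G$ be a connected finite-dimensional Lie group with identity $e$. A smooth map is called flat at a point if all its derivatives of order $\ge 1$ vanish there. Let $P_eG$ be the Fréchet Lie group of smooth paths $\gamma:[0,\pi]\to G$ with $\gamma(0)=e$ that are flat at both end points, let $\Omega G$ be the Fréchet Lie group of smooth loops $\gamma: S^1=\mathbb{R}/2\pi\mathbb{Z}\to G$ with $\gamma(0)=e$ that are flat at $0$, and let $P_eG^{[2]}=P_eG\times_G P_eG$ be the group of pairs of paths with the same end point. For $(\gamma_1,\gamma_2)\in P_eG^{[2]}$ let $\gamma_1\cup\gamma_2\in\Omega G$ be the loop with $(\gamma_1\cup\gamma_2)(t)=\gamma_1(t)$ for $t\in[0,\pi]$ and $(\gamma_1\cup\gamma_2)(t)=\gamma_2(2\pi-t)$ for $t\in[\pi,2\pi]$. For $I\subseteq S^1$ let $\Omega_IG\subseteq\Omega G$ be the subgroup of loops with $\gamma(t)=e$ for all $t\notin I$. Let $1\to \mathrm{U}(1)\to\widetilde{\Omega G}\xrightarrow{\pi}\Omega G\to 1$ be a central extension of Fréchet Lie groups ($\widetilde{\Omega G}$ being a principal $\mathrm{U}(1)$-bundle over $\Omega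 G$) that is disjoint commutative: whenever $I,J\subseteq S^1$ are disjoint, the subgroups $\pi^{-1}(\Omega_IG)$ and $\pi^{-1}(\Omega_JG)$ commute. Let $\widetilde{P_eG^{[2]}}=P_eG^{[2]}\times_{\Omega G}\widetilde{\Omega G}$ be the pullback along $\cup$ and $\widetilde{\Omega_{(0,\pi)}G}$ the restriction of $\widetilde{\Omega G}$ to $\Omega_{(0,\pi)}G$. Both fibre products exist in the category of Fréchet manifolds. Let $i:P_eG\to\widetilde{P_eG^{[2]}}$ be a fusion factorization, i.e. a Lie group homomorphism such that $i(\gamma)$ lies over $\gamma\cup\gamma$ for all $\gamma$. Then: (a) The group of objects $P_eG$, the group of morphisms $\widetilde{P_eG^{[2]}}$, the source and target maps $s(\Phi)=\gamma_2$, $t(\Phi)=\gamma_1$ for $\Phi$ over $\gamma_1\cup\gamma_2$, the identity map $i$, the composition $\Phi\circ\Psi=\Phi\, i(s(\Phi))^{-1}\Psi$ (for $s(\Phi)=t(\Psi)$) and the inversion $\mathrm{inv}(\Phi)=i(s(\Phi))\Phi^{-1}i(t(\Phi))$ form a strict Lie 2-group $\mathcal{G}(\widetilde{\Omega G},i)$: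 a groupoid whose sets of objects and of morphisms are Fréchet Lie groups, for which the fibre product of composable morphisms exists as a Fréchet Lie group, and all of whose structure maps are smooth group homomorphisms. (b) Let $X(\widetilde{\Omega G})$ be the crossed module of Fréchet Lie groups $t:\widetilde{\Omega_{(0,\pi)}G}\to P_eG$, $t(\Phi)=\pi(\Phi)|_{[0,\pi]}$, with the action $\alpha_\gamma(\Phi)=\Lambda\Phi\Lambda^{-1}$, where $\Lambda\in\widetilde{\Omega G}$ is any lift of $\gamma\cup\gamma$, and let $\mathcal{G}(X(\widetilde{\Omega G}))$ be the associated strict Lie 2-group with objects $P_eG$, morphisms $\widetilde{\Omega_{(0,\pi)}G}\rtimes_\alpha P_eG$, $s(\Phi,\gamma)=\gamma$, $t(\Phi,\gamma)=t(\Phi)\gamma$, identity map $\gamma\mapsto(1,\gamma)$, and composition and inversion given by the same formulas as in (a). (That these are indeed a crossed module of Fréchet Lie groups and a strict Lie 2-group is part of the claim.) Then there is a canonical isomorphism of strict Lie 2-groups $\mathcal{G}(\widetilde{\Omega G},i)\cong\mathcal{G}(X(\widetilde{\Omega G}))$: it is the identity on objects and is given on morphisms by $\Phi\mapsto\bigl(\Phi\,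 i(s(\Phi))^{-1},\,s(\Phi)\bigr)$. It is a diffeomorphism on objects and on morphisms and is compatible with all structure maps. -/

import Mathlib

set_option linter.unusedSectionVars false
open scoped Manifold ContDiff Topology

universe u v w w'

namespace LoopTwoGroup

/-- All derivatives of order at least one of the curve `γ`, computed within `s` in the preferred
chart around `γ p`, vanish at `p`. -/
def FlatWithinAt {E : Type*} [NormedAddCommGroup E] [NormedSpace ℝ E] {H : Type*}
    [TopologicalSpace H] (I : ModelWithCorners ℝ E H) {N : Type*} [TopologicalSpace N]
    [ChartedSpace H N] (γ : ℝ → N) (s : Set ℝ) (p : ℝ) : Prop :=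
  ∀ n : ℕ, 1 ≤ n → iteratedDerivWithin n (fun t => extChartAt I (γ p) (γ t)) s p = 0

section flat

variable {E E' : Type*} [NormedAddCommGroup E] [NormedSpace ℝ E] [NormedAddCommGroup E']
  [NormedSpace ℝ E'] {s : Set ℝ} {p : ℝ}

theorem iteratedDerivWithin_comp_eq_zero {g : ℝ → E} {F : E → E'} (hs : UniqueDiffOn ℝ s)
    (hp : p ∈ s) {n : ℕ} (hn : 1 ≤ n) (hg : ContDiffWithinAt ℝ n g s p)
    (hF : ContDiffAt ℝ n F (g p)) (h : ∀ i, 1 ≤ i → iteratedDerivWithin i g s p = 0) :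
    iteratedDerivWithin n (fun t => F (g t)) s p = 0 := by
  obtain ⟨v, hv, hFv⟩ := hF.contDiffOn le_rfl (by simp)
  obtain ⟨v', hv'v, hv'o, hv'p⟩ := mem_nhds_iff.1 hv
  obtain ⟨u, huo, hpu, hgu⟩ := hg.contDiffOn' le_rfl (by simp)
  rw [Set.insert_eq_of_mem hp] at hgu
  have hc : ContinuousWithinAt g s p := hg.continuousWithinAt
  have hpre : g ⁻¹' v' ∈ 𝓝[s] p := hc (hv'o.mem_nhds hv'p)
  obtain ⟨u', hu'o, hpu', hu'⟩ := mem_nhdsWithin.1 hpre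
  have key : iteratedDerivWithin n (F ∘ g) (s ∩ (u ∩ u')) p = 0 := by
    have hb := norm_iteratedFDerivWithin_comp_le (𝕜 := ℝ) (g := F) (f := g)
      (s := s ∩ (u ∩ u')) (t := v') (x := p) (N := n) (n := n) (D := 0)
      (C := ∑ i ∈ Finset.range (n + 1), ‖iteratedFDerivWithin ℝ i F v' (g p)‖)
      (hFv.mono hv'v) (hgu.mono (fun x hx => ⟨hx.1, hx.2.1⟩)) le_rfl hv'o.uniqueDiffOn
      (hs.inter (huo.inter hu'o)) (fun x hx => hu' ⟨hx.2.2, hx.1⟩) ⟨hp, hpu, hpu'⟩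
      (fun i hi => Finset.single_le_sum (f := fun i => ‖iteratedFDerivWithin ℝ i F v' (g p)‖)
        (fun _ _ => norm_nonneg _) (Finset.mem_range.2 (by omega)))
      (fun i hi _ => by
        rw [iteratedFDerivWithin_inter_open (huo.inter hu'o) ⟨hpu, hpu'⟩,
          norm_iteratedFDerivWithin_eq_norm_iteratedDerivWithin, h i hi]
        simp)
    rw [zero_pow (by omega), mul_zero, norm_iteratedFDerivWithin_eq_norm_iteratedDerivWithin]
      at hb
    exact norm_le_zero_iff.1 hb
  have : iteratedDerivWithin n (F ∘ g) s p = iteratedDerivWithin n (F ∘ g) (s ∩ (u ∩ u')) p := by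
    rw [iteratedDerivWithin, iteratedDerivWithin,
      iteratedFDerivWithin_inter_open (huo.inter hu'o) ⟨hpu, hpu'⟩]
  exact this.trans key

variable {H : Type*} [TopologicalSpace H] {I : ModelWithCorners ℝ E H} {N : Type*}
  [TopologicalSpace N] [ChartedSpace H N] {H' : Type*} [TopologicalSpace H']
  {I' : ModelWithCorners ℝ E' H'} {N' : Type*} [TopologicalSpace N'] [ChartedSpace H' N']

theorem FlatWithinAt.comp [I.Boundaryless] {γ : ℝ → N} {f : N → N'} (hs : UniqueDiffOn ℝ s)
    (hp : p ∈ s) (hγ : ContMDiffWithinAt 𝓘(ℝ, ℝ) I ∞ γ s p) (hf : ContMDiffAt I I' ∞ f (γ p))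
    (h : FlatWithinAt I γ s p) : FlatWithinAt I' (fun t => f (γ t)) s p := by
  intro n hn
  have hle : (n : ℕ∞ω) ≤ ∞ := by exact_mod_cast le_top
  have h1 := (contMDiffWithinAt_iff_target.1 hγ).2
  rw [contMDiffWithinAt_iff_contDiffWithinAt] at h1
  have h2 := (contMDiffAt_iff.1 hf).2
  rw [I.range_eq_univ, contDiffWithinAt_univ] at h2
  have h3 := iteratedDerivWithin_comp_eq_zero hs hp hn (h1.of_le hle) (h2.of_le hle) h
  rw [← h3]
  refine Filter.EventuallyEq.iteratedDerivWithin_eq ?_ ?_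
  · have := hγ.continuousWithinAt.preimage_mem_nhdsWithin (extChartAt_source_mem_nhds (I := I) (γ p))
    filter_upwards [this] with t ht
    simp only [Function.comp_apply, (extChartAt I (γ p)).left_inv ht]
  · simp only [Function.comp_apply, extChartAt_to_inv]

theorem FlatWithinAt.prodMk {γ : ℝ → N} {γ' : ℝ → N'} (hs : UniqueDiffOn ℝ s)
    (hp : p ∈ s) (hγ : ContMDiffWithinAt 𝓘(ℝ, ℝ) I ∞ γ s p)
    (hγ' : ContMDiffWithinAt 𝓘(ℝ, ℝ) I' ∞ γ' s p)
    (h : FlatWithinAt I γ s p) (h' : FlatWithinAt I' γ' s p) :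
    FlatWithinAt (I.prod I') (fun t => (γ t, γ' t)) s p := by
  intro n hn
  have hle : (n : ℕ∞ω) ≤ ∞ := by exact_mod_cast le_top
  have h1 := (contMDiffWithinAt_iff_target.1 hγ).2
  rw [contMDiffWithinAt_iff_contDiffWithinAt] at h1
  have h2 := (contMDiffWithinAt_iff_target.1 hγ').2
  rw [contMDiffWithinAt_iff_contDiffWithinAt] at h2
  have a := h n hn
  have b := h' n hn
  simp only [extChartAt_prod, PartialEquiv.prod_coe]
  rw [iteratedDerivWithin] at a b ⊢
  have := iteratedFDerivWithin_prodMk (i := n) (h1.of_le hle) (h2.of_le hle) hs hp le_rfl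
  simp only [Function.comp_def] at this
  rw [this]
  ext1 <;> assumption

theorem FlatWithinAt.congr {γ γ' : ℝ → N} (hp : p ∈ s) (h : FlatWithinAt I γ s p)
    (he : ∀ t ∈ s, γ' t = γ t) : FlatWithinAt I γ' s p := by
  intro n hn
  rw [← h n hn]
  refine iteratedDerivWithin_congr (fun t ht => ?_) hp
  simp only [he t ht, he p hp]

theorem flatWithinAt_iff_univ {γ : ℝ → N} (hs : UniqueDiffOn ℝ s)
    (hp : p ∈ s) (hγ : ContMDiffAt 𝓘(ℝ, ℝ) I ∞ γ p) :
    FlatWithinAt I γ s p ↔ FlatWithinAt I γ Set.univ p := by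
  have h1 := (contMDiffAt_iff_target.1 hγ).2
  rw [contMDiffAt_iff_contDiffAt] at h1
  refine forall_congr' fun n => imp_congr_right fun _ => ?_
  have hle : (n : ℕ∞ω) ≤ ∞ := by exact_mod_cast le_top
  have h2 := iteratedDerivWithin_eq_iteratedDeriv hs (h1.of_le hle) hp
  simp only [Function.comp_def] at h2
  rw [h2, iteratedDerivWithin_univ]

theorem flatWithinAt_const (x : N) : FlatWithinAt I (fun _ => x) s p := by
  intro n hn
  simp [iteratedDerivWithin_const, show n ≠ 0 by omega]

/-- Gluing: smooth and flat along the boundary of `s`, derivative zero off `s`. -/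
theorem contDiffOn_of_flat {s c u : Set ℝ} (hu : IsOpen u) (hs : IsClosed s) (hc : IsClosed c)
    (hsc : s ∪ c = Set.univ) (hsu : UniqueDiffOn ℝ s) (n : ℕ) :
    ∀ g : ℝ → E, ContDiffOn ℝ ∞ g (s ∩ u) →
      (∀ t ∈ s ∩ c ∩ u, ∀ k : ℕ, 1 ≤ k → iteratedDerivWithin k g s t = 0) →
      (∀ t ∈ c ∩ u, HasDerivWithinAt g 0 c t) → ContDiffOn ℝ n g u := by
  induction n with
  | zero =>
    intro g h1 h2 h3
    simp only [Nat.cast_zero, contDiffOn_zero]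
    intro t ht
    have h4 : t ∈ s → ContinuousWithinAt g s t := fun hts =>
      ((h1.continuousOn t ⟨hts, ht⟩).mono_of_mem_nhdsWithin
        (Filter.inter_mem self_mem_nhdsWithin (mem_nhdsWithin_of_mem_nhds (hu.mem_nhds ht))))
    have h4' : ContinuousWithinAt g s t := by
      by_cases hts : t ∈ s
      · exact h4 hts
      · rw [← hs.closure_eq] at hts
        simp only [ContinuousWithinAt, notMem_closure_iff_nhdsWithin_eq_bot.1 hts]
        exact Filter.tendsto_bot
    have h5 : ContinuousWithinAt g c t := by
      by_cases hts : t ∈ c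
      · exact (h3 t ⟨hts, ht⟩).continuousWithinAt
      · rw [← hc.closure_eq] at hts
        simp only [ContinuousWithinAt, notMem_closure_iff_nhdsWithin_eq_bot.1 hts]
        exact Filter.tendsto_bot
    have := h4'.union h5
    rw [hsc] at this
    exact this.mono (Set.subset_univ _)
  | succ n ih =>
    intro g h1 h2 h3
    have hd1 : ∀ t ∈ s ∩ u, HasDerivWithinAt g (derivWithin g s t) s t := by
      intro t ht
      have : DifferentiableWithinAt ℝ g (s ∩ u) t := h1.differentiableOn (by simp) t ht
      exact ((differentiableWithinAt_inter (hu.mem_nhds ht.2)).1 this).hasDerivWithinAt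
    have hd2 : ∀ t ∈ s ∩ c ∩ u, derivWithin g s t = 0 := by
      intro t ht
      have := h2 t ht 1 le_rfl
      rwa [iteratedDerivWithin_one] at this
    have hds : ∀ t ∈ s ∩ u, HasDerivAt g (derivWithin g s t) t := by
      intro t ht
      by_cases htc : t ∈ c
      · have a := hd1 t ht
        have b := h3 t ⟨htc, ht.2⟩
        rw [← hd2 t ⟨⟨ht.1, htc⟩, ht.2⟩] at b
        have := a.union b
        rwa [hsc, hasDerivWithinAt_univ] at this
      · refine (hd1 t ht).hasDerivAt ?_
        refine Filter.mem_of_superset (hc.isOpen_compl.mem_nhds htc) fun x hx => ?_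
        have : x ∈ s ∪ c := hsc ▸ Set.mem_univ x
        exact this.resolve_right hx
    have hdc : ∀ t ∈ c ∩ u, HasDerivAt g 0 t := by
      intro t ht
      by_cases hts : t ∈ s
      · have := hds t ⟨hts, ht.2⟩
        rwa [hd2 t ⟨⟨hts, ht.1⟩, ht.2⟩] at this
      · refine (h3 t ht).hasDerivAt ?_
        refine Filter.mem_of_superset (hs.isOpen_compl.mem_nhds hts) fun x hx => ?_
        have : x ∈ s ∪ c := hsc ▸ Set.mem_univ x
        exact this.resolve_left hx
    have hsuu : UniqueDiffOn ℝ (s ∩ u) := hsu.inter hu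
    have hds' : ∀ t ∈ s ∩ u, deriv g t = derivWithin g s t := fun t ht => (hds t ht).deriv
    rw [Nat.cast_succ, contDiffOn_succ_iff_deriv_of_isOpen hu]
    refine ⟨fun t ht => ?_, by simp, ih (deriv g) ?_ ?_ ?_⟩
    · have : t ∈ s ∪ c := hsc ▸ Set.mem_univ t
      rcases this with h | h
      · exact (hds t ⟨h, ht⟩).differentiableAt.differentiableWithinAt
      · exact (hdc t ⟨h, ht⟩).differentiableAt.differentiableWithinAt
    · have := h1.derivWithin (m := ∞) hsuu (by simp)
      refine this.congr fun t ht => ?_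
      rw [hds' t ht, derivWithin_inter (hu.mem_nhds ht.2)]
    · intro t ht k hk
      have e : iteratedDerivWithin k (deriv g) s t = iteratedDerivWithin k (derivWithin g s) s t := by
        refine Filter.EventuallyEq.iteratedDerivWithin_eq ?_ (hds' t ⟨ht.1.1, ht.2⟩)
        filter_upwards [self_mem_nhdsWithin, mem_nhdsWithin_of_mem_nhds (hu.mem_nhds ht.2)]
          with x hx hx'
        exact hds' x ⟨hx, hx'⟩
      rw [e, ← iteratedDerivWithin_succ']
      exact h2 t ht (k + 1) (by omega)
    · intro t ht
      have : HasDerivWithinAt (fun _ : ℝ => (0 : E)) 0 c t := hasDerivWithinAt_const _ _ _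
      refine this.congr_of_eventuallyEq ?_ (hdc t ht).deriv
      filter_upwards [self_mem_nhdsWithin, mem_nhdsWithin_of_mem_nhds (hu.mem_nhds ht.2)]
          with x hx hx'
      exact (hdc x ⟨hx, hx'⟩).deriv

end flat
/-! ### Flat paths and flat loops -/

section paths

variable {E : Type*} [NormedAddCommGroup E] [NormedSpace ℝ E] {H : Type*} [TopologicalSpace H]
  (I : ModelWithCorners ℝ E H) {N : Type*} [TopologicalSpace N] [ChartedSpace H N]
  {E' : Type*} [NormedAddCommGroup E'] [NormedSpace ℝ E'] {H' : Type*} [TopologicalSpace H']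
  (I' : ModelWithCorners ℝ E' H') {N' : Type*} [TopologicalSpace N'] [ChartedSpace H' N']

/-- The interval `[0, π]`. -/
abbrev Ipi : Type := Set.Icc (0 : ℝ) Real.pi

/-- The extension of a path on `[0, π]` to the real line which is constant outside `[0, π]`. -/
noncomputable def pathExt {X : Type*} (γ : Ipi → X) : ℝ → X := Set.IccExtend Real.pi_pos.le γ

/-- A smooth path `[0, π] → N` that is flat at both end points. -/
structure IsFlatPath (γ : Ipi → N) : Prop where
  smooth : ContMDiffOn 𝓘(ℝ, ℝ) I ∞ (pathExt γ) (Set.Icc 0 Real.pi)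
  flat_zero : FlatWithinAt I (pathExt γ) (Set.Icc 0 Real.pi) 0
  flat_pi : FlatWithinAt I (pathExt γ) (Set.Icc 0 Real.pi) Real.pi

/-- The circle `S¹ = ℝ / 2πℤ`. -/
abbrev S1 : Type := AddCircle (2 * Real.pi)

/-- A smooth loop `S¹ → N` that is flat at `0`. -/
structure IsFlatLoop (γ : S1 → N) : Prop where
  smooth : ContMDiff 𝓘(ℝ, ℝ) I ∞ (fun t : ℝ => γ (t : S1))
  flat_zero : FlatWithinAt I (fun t : ℝ => γ (t : S1)) Set.univ 0

variable {I I'}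

theorem uniqueDiffOn_Ipi : UniqueDiffOn ℝ (Set.Icc (0 : ℝ) Real.pi) :=
  uniqueDiffOn_Icc Real.pi_pos

theorem zero_mem_Ipi : (0 : ℝ) ∈ Set.Icc (0 : ℝ) Real.pi := ⟨le_rfl, Real.pi_pos.le⟩

theorem pi_mem_Ipi : Real.pi ∈ Set.Icc (0 : ℝ) Real.pi := ⟨Real.pi_pos.le, le_rfl⟩

theorem pathExt_of_mem {X : Type*} (γ : Ipi → X) {t : ℝ} (ht : t ∈ Set.Icc (0 : ℝ) Real.pi) :
    pathExt γ t = γ ⟨t, ht⟩ := Set.IccExtend_of_mem _ _ ht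

theorem pathExt_of_le {X : Type*} (γ : Ipi → X) {t : ℝ} (ht : t ≤ 0) :
    pathExt γ t = γ ⟨0, zero_mem_Ipi⟩ := Set.IccExtend_of_le_left _ _ ht

theorem pathExt_of_ge {X : Type*} (γ : Ipi → X) {t : ℝ} (ht : Real.pi ≤ t) :
    pathExt γ t = γ ⟨Real.pi, pi_mem_Ipi⟩ := Set.IccExtend_of_right_le _ _ ht

theorem isFlatPath_const (x : N) : IsFlatPath I (fun _ => x) where
  smooth := contMDiffOn_const
  flat_zero := flatWithinAt_const x
  flat_pi := flatWithinAt_const x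

theorem isFlatLoop_const (x : N) : IsFlatLoop I (fun _ => x) where
  smooth := contMDiff_const
  flat_zero := flatWithinAt_const x

theorem IsFlatPath.comp [I.Boundaryless] {γ : Ipi → N} (h : IsFlatPath I γ) {f : N → N'}
    (hf : ∀ t, ContMDiffAt I I' ∞ f (γ t)) : IsFlatPath I' (fun t => f (γ t)) := by
  have e : pathExt (fun t => f (γ t)) = fun t => f (pathExt γ t) := rfl
  have hf' : ∀ t, ContMDiffAt I I' ∞ f (pathExt γ t) := fun t => hf _
  constructor
  · rw [e]
    exact fun t ht => (hf' t).comp_contMDiffWithinAt t (h.smooth t ht)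
  · rw [e]
    exact h.flat_zero.comp uniqueDiffOn_Ipi zero_mem_Ipi (h.smooth _ zero_mem_Ipi) (hf' 0)
  · rw [e]
    exact h.flat_pi.comp uniqueDiffOn_Ipi pi_mem_Ipi (h.smooth _ pi_mem_Ipi) (hf' _)

theorem IsFlatPath.prodMk {γ : Ipi → N} {γ' : Ipi → N'} (h : IsFlatPath I γ)
    (h' : IsFlatPath I' γ') : IsFlatPath (I.prod I') (fun t => (γ t, γ' t)) where
  smooth := h.smooth.prodMk h'.smooth
  flat_zero := h.flat_zero.prodMk uniqueDiffOn_Ipi zero_mem_Ipi (h.smooth _ zero_mem_Ipi)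
    (h'.smooth _ zero_mem_Ipi) h'.flat_zero
  flat_pi := h.flat_pi.prodMk uniqueDiffOn_Ipi pi_mem_Ipi (h.smooth _ pi_mem_Ipi)
    (h'.smooth _ pi_mem_Ipi) h'.flat_pi

theorem IsFlatLoop.comp [I.Boundaryless] {γ : S1 → N} (h : IsFlatLoop I γ) {f : N → N'}
    (hf : ∀ t, ContMDiffAt I I' ∞ f (γ t)) : IsFlatLoop I' (fun t => f (γ t)) where
  smooth t := (hf t).comp t (h.smooth t)
  flat_zero := h.flat_zero.comp uniqueDiffOn_univ (Set.mem_univ _) (h.smooth 0) (hf _)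

theorem IsFlatLoop.prodMk {γ : S1 → N} {γ' : S1 → N'} (h : IsFlatLoop I γ)
    (h' : IsFlatLoop I' γ') : IsFlatLoop (I.prod I') (fun t => (γ t, γ' t)) where
  smooth := h.smooth.prodMk h'.smooth
  flat_zero := h.flat_zero.prodMk uniqueDiffOn_univ (Set.mem_univ _) (h.smooth 0)
    (h'.smooth 0) h'.flat_zero

theorem IsFlatPath.contMDiff [I.Boundaryless] [IsManifold I ∞ N] {γ : Ipi → N} (h : IsFlatPath I γ) :
    ContMDiff 𝓘(ℝ, ℝ) I ∞ (pathExt γ) := by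
  have hcont : Continuous (pathExt γ) := by
    have h1 : Continuous γ := by
      have := continuousOn_iff_continuous_domRestrict.1 h.smooth.continuousOn
      refine this.congr fun t => ?_
      exact pathExt_of_mem γ t.2
    exact h1.Icc_extend'
  intro t₀
  rw [contMDiffAt_iff_target]
  refine ⟨hcont.continuousAt, ?_⟩
  rw [contMDiffAt_iff_contDiffAt]
  set x := pathExt γ t₀ with hx
  set u : Set ℝ := pathExt γ ⁻¹' (extChartAt I x).source with hu
  have huo : IsOpen u := (isOpen_extChartAt_source x).preimage hcont
  have htu : t₀ ∈ u := mem_extChartAt_source (I := I) x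
  have hchart : ∀ t ∈ u, ContMDiffAt I 𝓘(ℝ, E) ∞ (extChartAt I x) (pathExt γ t) := fun t ht =>
    contMDiffAt_extChartAt' (by rwa [← extChartAt_source I])
  set c : Set ℝ := Set.Iic 0 ∪ Set.Ici Real.pi with hc
  have hloc : ∀ t ∈ c, pathExt γ =ᶠ[𝓝[c] t] fun _ => pathExt γ t := by
    intro t ht
    rcases ht with ht | ht
    · have : Set.Iio Real.pi ∈ 𝓝[c] t :=
        mem_nhdsWithin_of_mem_nhds (Iio_mem_nhds (lt_of_le_of_lt ht Real.pi_pos))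
      filter_upwards [this, self_mem_nhdsWithin] with y hy hy'
      rcases hy' with hy' | hy'
      · rw [pathExt_of_le γ ht, pathExt_of_le γ hy']
      · exact absurd (Set.mem_Iio.1 hy) (not_lt.2 hy')
    · have : Set.Ioi 0 ∈ 𝓝[c] t :=
        mem_nhdsWithin_of_mem_nhds (Ioi_mem_nhds (lt_of_lt_of_le Real.pi_pos ht))
      filter_upwards [this, self_mem_nhdsWithin] with y hy hy'
      rcases hy' with hy' | hy'
      · exact absurd (Set.mem_Ioi.1 hy) (not_lt.2 hy')
      · rw [pathExt_of_ge γ ht, pathExt_of_ge γ hy']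
  have hsm : ∀ t ∈ Set.Icc 0 Real.pi ∩ u,
      ContMDiffWithinAt 𝓘(ℝ, ℝ) 𝓘(ℝ, E) ∞ (extChartAt I x ∘ pathExt γ) (Set.Icc 0 Real.pi) t :=
    fun t ht => (hchart t ht.2).comp_contMDiffWithinAt t (h.smooth t ht.1)
  have hcc : IsClosed c := isClosed_Iic.union isClosed_Ici
  rw [contDiffAt_infty]
  intro n
  refine (contDiffOn_of_flat (s := Set.Icc 0 Real.pi) (c := c) huo isClosed_Icc hcc ?_
    uniqueDiffOn_Ipi n (extChartAt I x ∘ pathExt γ) ?_ ?_ ?_).contDiffAt (huo.mem_nhds htu)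
  · ext t
    simp only [hc, Set.mem_union, Set.mem_Icc, Set.mem_Iic, Set.mem_Ici, Set.mem_univ, iff_true]
    rcases le_total t 0 with h0 | h0
    · exact Or.inr (Or.inl h0)
    · rcases le_total t Real.pi with h1 | h1
      · exact Or.inl ⟨h0, h1⟩
      · exact Or.inr (Or.inr h1)
  · intro t ht
    exact (contMDiffWithinAt_iff_contDiffWithinAt.1 (hsm t ht)).mono Set.inter_subset_left
  · rintro t ⟨⟨ht, htc⟩, htu⟩ k hk
    have hflat : FlatWithinAt I (pathExt γ) (Set.Icc 0 Real.pi) t := by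
      rcases htc with h' | h'
      · have : t = 0 := le_antisymm h' ht.1
        exact this ▸ h.flat_zero
      · have : t = Real.pi := le_antisymm ht.2 h'
        exact this ▸ h.flat_pi
    exact hflat.comp uniqueDiffOn_Ipi ht (h.smooth t ht) (hchart t htu) k hk
  · rintro t ⟨ht, htu⟩
    have h1 : HasDerivWithinAt (fun _ : ℝ => extChartAt I x (pathExt γ t)) 0 c t :=
      hasDerivWithinAt_const _ _ _
    refine h1.congr_of_eventuallyEq ?_ rfl
    filter_upwards [hloc t ht] with y hy
    simp only [Function.comp_apply, hy]

end paths

/-! ### Fréchet spaces, smooth maps between them, and Fréchet manifolds -/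

/-- A Fréchet space: a complete metrizable locally convex real vector space. -/
class FrechetSpace (V : Type v) [AddCommGroup V] [Module ℝ V] [TopologicalSpace V] : Prop extends
    IsTopologicalAddGroup V, ContinuousSMul ℝ V, LocallyConvexSpace ℝ V,
    TopologicalSpace.MetrizableSpace V where
  complete : @CompleteSpace V (IsTopologicalAddGroup.rightUniformSpace V)

/-- `IsCk W k V f U`: the map `f` from the open subset `U` of `V` to `W` is of class `C^k` in the
sense of Michal and Bastiani: it is continuous and, if `k ≥ 1`, all directional derivatives
`df(x, v) = lim_{t → 0} (f(x + t v) - f(x)) / t` exist and `df : U × V → W` is of class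
`C^{k-1}`. -/
def IsCk (W : Type w) [AddCommGroup W] [Module ℝ W] [TopologicalSpace W] :
    ℕ → (V : Type v) → [AddCommGroup V] → [Module ℝ V] → [TopologicalSpace V] →
      (V → W) → Set V → Prop
  | 0, _, _, _, _, f, U => ContinuousOn f U
  | k + 1, V, _, _, _, f, U => ContinuousOn f U ∧ ∃ df : V × V → W,
      (∀ x ∈ U, ∀ v : V,
        Filter.Tendsto (fun t : ℝ => t⁻¹ • (f (x + t • v) - f x)) (𝓝[≠] 0) (𝓝 (df (x, v)))) ∧
      IsCk W k (V × V) df (U ×ˢ Set.univ)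

/-- The subset `U` of `V` is open and `f` is smooth on it. -/
def IsSmoothOn {V : Type v} [AddCommGroup V] [Module ℝ V] [TopologicalSpace V]
    {W : Type w} [AddCommGroup W] [Module ℝ W] [TopologicalSpace W] (f : V → W) (U : Set V) :
    Prop :=
  IsOpen U ∧ ∀ k : ℕ, IsCk W k V f U

/-- An atlas on the set `M`: a collection of bijections from subsets of `M` onto subsets of a
topological vector space. -/
structure Atlas (M : Type u) where
  /-- The model space. -/
  model : Type v
  [addCommGroup : AddCommGroup model]
  [module : Module ℝ model]
  [topology : TopologicalSpace model]
  /-- The charts. -/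
  charts : Set (PartialEquiv M model)

attribute [instance] Atlas.addCommGroup Atlas.module Atlas.topology

namespace Atlas

/-- The topology on `M` defined by an atlas: a set is open if and only if its image in every chart
is open (in the image of the chart). -/
@[reducible] def manifoldTopology {M : Type u} (A : Atlas.{u, v} M) : TopologicalSpace M :=
  ⨆ φ ∈ A.charts,
    TopologicalSpace.coinduced (fun y : φ.target => φ.symm (y : A.model)) inferInstance

/-- The atlas makes `M` a smooth manifold modelled on a Fréchet space: the charts have open
images and cover `M`, the changes of charts are smooth maps between open sets, and `M` is
Hausdorff. -/
structure IsFrechetManifold {M : Type u} (A : Atlas.{u, v} M) : Prop where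
  frechet : FrechetSpace A.model
  cover : ∀ x : M, ∃ φ ∈ A.charts, x ∈ φ.source
  isOpen_target : ∀ φ ∈ A.charts, IsOpen φ.target
  compatible : ∀ φ ∈ A.charts, ∀ ψ ∈ A.charts, IsSmoothOn (φ.symm.trans ψ) (φ.symm.trans ψ).source
  t2 : @T2Space M A.manifoldTopology

/-- `f` is defined and smooth on the open subset `S` of the manifold `M`: in all charts, it is
given by a smooth map on an open set. -/
def SmoothMapOn {M : Type u} {N : Type v} (A : Atlas.{u, w} M) (B : Atlas.{v, w'} N) (f : M → N)
    (S : Set M) : Prop :=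
  ∀ φ ∈ A.charts, ∀ ψ ∈ B.charts, IsSmoothOn (fun y => ψ (f (φ.symm y)))
    {y | y ∈ φ.target ∧ φ.symm y ∈ S ∧ f (φ.symm y) ∈ ψ.source}

/-- `f` is a smooth map of manifolds. -/
def SmoothMap {M : Type u} {N : Type v} (A : Atlas.{u, w} M) (B : Atlas.{v, w'} N) (f : M → N) :
    Prop :=
  SmoothMapOn A B f Set.univ

/-- The product of two manifolds. -/
def prod {M : Type u} {N : Type v} (A : Atlas.{u, w} M) (B : Atlas.{v, w'} N) :
    Atlas.{max u v, max w w'} (M × N) where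
  model := A.model × B.model
  charts := {χ | ∃ φ ∈ A.charts, ∃ ψ ∈ B.charts, χ = φ.prod ψ}

/-- Transport of an atlas along a bijection. -/
def comapEquiv {M : Type u} {N : Type v} (e : M ≃ N) (A : Atlas.{v, w} N) : Atlas.{u, w} M where
  model := A.model
  charts := {χ | ∃ φ ∈ A.charts, χ = e.toPartialEquiv.trans φ}

/-- The atlas of a manifold in the sense of Mathlib with a normed vector space as model. -/
def ofChartedSpace (V : Type v) [NormedAddCommGroup V] [NormedSpace ℝ V] (M : Type u)
    [TopologicalSpace M] [ChartedSpace V M] : Atlas.{u, v} M where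
  model := V
  charts := {χ | ∃ φ ∈ atlas V M, χ = φ.toPartialEquiv}

/-- The group `K` is a Fréchet Lie group with respect to the atlas `A`. -/
structure IsFrechetLieGroup {K : Type u} [Group K] (A : Atlas.{u, v} K) : Prop where
  isFrechetManifold : A.IsFrechetManifold
  smooth_mul : SmoothMap (A.prod A) A (fun p => p.1 * p.2)
  smooth_inv : SmoothMap A A (fun x => x⁻¹)

/-- The atlas `B` is the manifold structure induced on `X` by the map `j` into the manifold `Y`:
`j` is smooth, and a map from a manifold to `X` is smooth as soon as its composite with `j` is.
This universal property determines the manifold structure of `X`. If `j` is the inclusion of a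
set-theoretic fibre product into a product of manifolds, it says that `B` is the fibre product
in the category of Fréchet manifolds. -/
structure IsInduced {X Y : Type u} (B : Atlas.{u, u} X) (A : Atlas.{u, u} Y) (j : X → Y) :
    Prop where
  isFrechetManifold : B.IsFrechetManifold
  smooth : SmoothMap B A j
  universal : ∀ (W : Type u) (C : Atlas.{u, u} W), C.IsFrechetManifold → ∀ h : W → X,
    SmoothMap C A (fun x => j (h x)) → SmoothMap C B h

end Atlas

/-! ### Strict Lie 2-groups and crossed modules -/

/-- The data of a strict Lie 2-group: groups of objects and of morphisms equipped with atlases,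
source, target, identity map, composition and inversion of morphisms.
Only the values `comp x y` with `s x = t y` are meaningful. -/
structure TwoGroupData where
  Ob : Type u
  Mor : Type u
  [groupOb : Group Ob]
  [groupMor : Group Mor]
  obAtlas : Atlas.{u, u} Ob
  morAtlas : Atlas.{u, u} Mor
  s : Mor →* Ob
  t : Mor →* Ob
  i : Ob →* Mor
  comp : Mor → Mor → Mor
  invMor : Mor → Mor

attribute [instance] TwoGroupData.groupOb TwoGroupData.groupMor

namespace TwoGroupData

/-- The group `Γ₁ ×_{Γ₀} Γ₁` of pairs `(x, y)` of composable morphisms, `s x = t y`. -/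
def composable (Γ : TwoGroupData.{u}) : Subgroup (Γ.Mor × Γ.Mor) :=
  (Γ.s.comp (MonoidHom.fst _ _)).eqLocus (Γ.t.comp (MonoidHom.snd _ _))

/-- A strict Lie 2-group: a groupoid whose sets of objects and morphisms are Fréchet Lie groups,
such that the fibre product of composable morphisms exists and all structure maps are smooth group
homomorphisms. -/
structure IsStrictLieTwoGroup (Γ : TwoGroupData.{u}) : Prop where
  lie_ob : Γ.obAtlas.IsFrechetLieGroup
  lie_mor : Γ.morAtlas.IsFrechetLieGroup
  smooth_s : Atlas.SmoothMap Γ.morAtlas Γ.obAtlas Γ.s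
  smooth_t : Atlas.SmoothMap Γ.morAtlas Γ.obAtlas Γ.t
  smooth_i : Atlas.SmoothMap Γ.obAtlas Γ.morAtlas Γ.i
  s_i : ∀ a, Γ.s (Γ.i a) = a
  t_i : ∀ a, Γ.t (Γ.i a) = a
  s_comp : ∀ x y, Γ.s x = Γ.t y → Γ.s (Γ.comp x y) = Γ.s y
  t_comp : ∀ x y, Γ.s x = Γ.t y → Γ.t (Γ.comp x y) = Γ.t x
  comp_i : ∀ x, Γ.comp x (Γ.i (Γ.s x)) = x
  i_comp : ∀ x, Γ.comp (Γ.i (Γ.t x)) x = x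
  comp_assoc : ∀ x y z, Γ.s x = Γ.t y → Γ.s y = Γ.t z →
    Γ.comp (Γ.comp x y) z = Γ.comp x (Γ.comp y z)
  s_invMor : ∀ x, Γ.s (Γ.invMor x) = Γ.t x
  t_invMor : ∀ x, Γ.t (Γ.invMor x) = Γ.s x
  invMor_comp : ∀ x, Γ.comp (Γ.invMor x) x = Γ.i (Γ.s x)
  comp_invMor : ∀ x, Γ.comp x (Γ.invMor x) = Γ.i (Γ.t x)
  comp_mul : ∀ x y x' y', Γ.s x = Γ.t y → Γ.s x' = Γ.t y' →
    Γ.comp (x * x') (y * y') = Γ.comp x y * Γ.comp x' y'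
  invMor_mul : ∀ x y, Γ.invMor (x * y) = Γ.invMor x * Γ.invMor y
  smooth_comp : ∃ B : Atlas.{u, u} Γ.composable, B.IsFrechetLieGroup ∧
    B.IsInduced (Γ.morAtlas.prod Γ.morAtlas) Subtype.val ∧
    Atlas.SmoothMap B Γ.morAtlas (fun p => Γ.comp p.1.1 p.1.2)
  smooth_invMor : Atlas.SmoothMap Γ.morAtlas Γ.morAtlas Γ.invMor

/-- Composition and inversion defined from source, target and identity map by
`x ∘ y = x i(s(x))⁻¹ y` and `inv(x) = i(s(x)) x⁻¹ i(t(x))`. -/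
def ofMinimalData {Γ₀ Γ₁ : Type u} [Group Γ₀] [Group Γ₁] (A₀ : Atlas.{u, u} Γ₀)
    (A₁ : Atlas.{u, u} Γ₁) (s t : Γ₁ →* Γ₀) (i : Γ₀ →* Γ₁) : TwoGroupData.{u} where
  Ob := Γ₀
  Mor := Γ₁
  obAtlas := A₀
  morAtlas := A₁
  s := s
  t := t
  i := i
  comp x y := x * (i (s x))⁻¹ * y
  invMor x := i (s x) * x⁻¹ * i (t x)

/-- A (strict) isomorphism of strict Lie 2-groups: diffeomorphic group isomorphisms on objects and
morphisms that commute with all structure maps. -/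
structure Iso (Γ Γ' : TwoGroupData.{u}) where
  ob : Γ.Ob ≃* Γ'.Ob
  mor : Γ.Mor ≃* Γ'.Mor
  smooth_ob : Atlas.SmoothMap Γ.obAtlas Γ'.obAtlas ob
  smooth_ob_symm : Atlas.SmoothMap Γ'.obAtlas Γ.obAtlas ob.symm
  smooth_mor : Atlas.SmoothMap Γ.morAtlas Γ'.morAtlas mor
  smooth_mor_symm : Atlas.SmoothMap Γ'.morAtlas Γ.morAtlas mor.symm
  map_s : ∀ x, Γ'.s (mor x) = ob (Γ.s x)
  map_t : ∀ x, Γ'.t (mor x) = ob (Γ.t x)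
  map_i : ∀ a, Γ'.i (ob a) = mor (Γ.i a)
  map_comp : ∀ x y, Γ.s x = Γ.t y → mor (Γ.comp x y) = Γ'.comp (mor x) (mor y)
  map_invMor : ∀ x, mor (Γ.invMor x) = Γ'.invMor (mor x)

end TwoGroupData

/-- A precrossed module of groups equipped with atlases: a homomorphism `t : H → K` and an action
of `K` on `H` by automorphisms for which `t` is equivariant. -/
structure PrecrossedModule where
  H : Type u
  K : Type u
  [groupH : Group H]
  [groupK : Group K]
  atlasH : Atlas.{u, u} H
  atlasK : Atlas.{u, u} K
  t : H →* K
  act : K →* MulAut H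
  t_act : ∀ g h, t (act g h) = g * t h * g⁻¹

attribute [instance] PrecrossedModule.groupH PrecrossedModule.groupK

namespace PrecrossedModule

/-- A crossed module of Fréchet Lie groups. -/
structure IsLieCrossedModule (X : PrecrossedModule.{u}) : Prop where
  lie_H : X.atlasH.IsFrechetLieGroup
  lie_K : X.atlasK.IsFrechetLieGroup
  smooth_t : Atlas.SmoothMap X.atlasH X.atlasK X.t
  smooth_act : Atlas.SmoothMap (X.atlasK.prod X.atlasH) X.atlasH (fun p => X.act p.1 p.2)
  peiffer : ∀ h k, X.act (X.t h) k = h * k * h⁻¹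

/-- The target map `(h, g) ↦ t(h) g` on the semidirect product. -/
def target (X : PrecrossedModule.{u}) : X.H ⋊[X.act] X.K →* X.K where
  toFun p := X.t p.left * p.right
  map_one' := by simp
  map_mul' p q := by simp [X.t_act, mul_assoc]

/-- The strict 2-group associated with a crossed module: objects `K`, morphisms `H ⋊ K`, with
`s(h, g) = g`, `t(h, g) = t(h) g` and `i(g) = (1, g)`. -/
def toTwoGroup (X : PrecrossedModule.{u}) : TwoGroupData.{u} :=
  TwoGroupData.ofMinimalData X.atlasK
    (Atlas.comapEquiv SemidirectProduct.equivProd (X.atlasH.prod X.atlasK))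
    SemidirectProduct.rightHom X.target SemidirectProduct.inr

end PrecrossedModule

/-! ### Path groups and loop groups -/

section groups

variable (E : Type u) [NormedAddCommGroup E] [NormedSpace ℝ E]

/-- The vector space of smooth paths in `E` that start at `0` and are flat at both end points. -/
def pathSubmodule : Submodule ℝ (Ipi → E) where
  carrier := {ξ | IsFlatPath 𝓘(ℝ, E) ξ ∧ ξ ⟨0, zero_mem_Ipi⟩ = 0}
  zero_mem' := ⟨isFlatPath_const 0, rfl⟩
  add_mem' {ξ η} hξ hη := ⟨(hξ.1.prodMk hη.1).comp (f := fun p : E × E => p.1 + p.2)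
    fun t => contMDiff_add 𝓘(ℝ, E) ∞ _, by simp [hξ.2, hη.2]⟩
  smul_mem' c ξ hξ := ⟨hξ.1.comp (f := fun x : E => c • x)
    fun t => (contDiff_const_smul c).contMDiff _, by simp [hξ.2]⟩

/-- The vector space of smooth loops in `E` based at `0` and flat at `0`. -/
def loopSubmodule : Submodule ℝ (S1 → E) where
  carrier := {ξ | IsFlatLoop 𝓘(ℝ, E) ξ ∧ ξ 0 = 0}
  zero_mem' := ⟨isFlatLoop_const 0, rfl⟩
  add_mem' {ξ η} hξ hη := ⟨(hξ.1.prodMk hη.1).comp (f := fun p : E × E => p.1 + p.2)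
    fun t => contMDiff_add 𝓘(ℝ, E) ∞ _, by simp [hξ.2, hη.2]⟩
  smul_mem' c ξ hξ := ⟨hξ.1.comp (f := fun x : E => c • x)
    fun t => (contDiff_const_smul c).contMDiff _, by simp [hξ.2]⟩

/-- The model space of the path group, to be equipped with the `C^∞`-topology. -/
def PathModel : Type u := pathSubmodule E

/-- The model space of the loop group, to be equipped with the `C^∞`-topology. -/
def LoopModel : Type u := loopSubmodule E

noncomputable instance : AddCommGroup (PathModel E) :=
  inferInstanceAs (AddCommGroup (pathSubmodule E))

noncomputable instance : Module ℝ (PathModel E) :=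
  inferInstanceAs (Module ℝ (pathSubmodule E))

noncomputable instance : AddCommGroup (LoopModel E) :=
  inferInstanceAs (AddCommGroup (loopSubmodule E))

noncomputable instance : Module ℝ (LoopModel E) :=
  inferInstanceAs (Module ℝ (loopSubmodule E))

variable {E} in
/-- The path underlying an element of the model space. -/
def PathModel.val (ξ : PathModel E) : Ipi → E := Subtype.val (p := (· ∈ pathSubmodule E)) ξ

variable {E} in
/-- The element of the model space given by a path. -/
def PathModel.of (ξ : Ipi → E) (h : ξ ∈ pathSubmodule E) : PathModel E :=
  Subtype.mk (p := (· ∈ pathSubmodule E)) ξ h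

variable {E} in
/-- The loop underlying an element of the model space. -/
def LoopModel.val (ξ : LoopModel E) : S1 → E := Subtype.val (p := (· ∈ loopSubmodule E)) ξ

variable {E} in
/-- The element of the model space given by a loop. -/
def LoopModel.of (ξ : S1 → E) (h : ξ ∈ loopSubmodule E) : LoopModel E :=
  Subtype.mk (p := (· ∈ loopSubmodule E)) ξ h

variable {E} in
theorem PathModel.val_mem (ξ : PathModel E) : ξ.val ∈ pathSubmodule E :=
  Subtype.prop (p := (· ∈ pathSubmodule E)) ξ

variable {E} in
theorem LoopModel.val_mem (ξ : LoopModel E) : ξ.val ∈ loopSubmodule E :=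
  Subtype.prop (p := (· ∈ loopSubmodule E)) ξ

variable {E} in
@[simp] theorem PathModel.val_of (ξ : Ipi → E) (h : ξ ∈ pathSubmodule E) :
    (PathModel.of ξ h).val = ξ := rfl

variable {E} in
@[simp] theorem LoopModel.val_of (ξ : S1 → E) (h : ξ ∈ loopSubmodule E) :
    (LoopModel.of ξ h).val = ξ := rfl

variable {E} in
theorem PathModel.ext' {ξ η : PathModel E} (h : ξ.val = η.val) : ξ = η :=
  Subtype.ext (p := (· ∈ pathSubmodule E)) h

variable {E} in
theorem LoopModel.ext' {ξ η : LoopModel E} (h : ξ.val = η.val) : ξ = η :=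
  Subtype.ext (p := (· ∈ loopSubmodule E)) h

/-- The `C^∞`-topology: uniform convergence of all derivatives on `[0, π]`. -/
noncomputable instance : TopologicalSpace (PathModel E) :=
  ⨅ n : ℕ, TopologicalSpace.induced (fun ξ : PathModel E => UniformFun.ofFun
    fun t : Ipi => iteratedDerivWithin n (pathExt ξ.val) (Set.Icc 0 Real.pi) t) inferInstance

/-- The `C^∞`-topology: uniform convergence of all derivatives. -/
noncomputable instance : TopologicalSpace (LoopModel E) :=
  ⨅ n : ℕ, TopologicalSpace.induced (fun ξ : LoopModel E => UniformFun.ofFun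
    fun t : ℝ => iteratedDeriv n (fun r : ℝ => ξ.val (r : S1)) t) inferInstance

variable (G : Type u) [Group G] [TopologicalSpace G] [ChartedSpace E G]
  [LieGroup 𝓘(ℝ, E) ∞ G]

/-- The group `P_e G` of smooth paths `[0, π] → G` that start at the identity and are flat at both
end points. -/
def pathGroup : Subgroup (Ipi → G) where
  carrier := {γ | IsFlatPath 𝓘(ℝ, E) γ ∧ γ ⟨0, zero_mem_Ipi⟩ = 1}
  one_mem' := ⟨isFlatPath_const 1, rfl⟩
  mul_mem' {γ η} hγ hη := ⟨(hγ.1.prodMk hη.1).comp (f := fun p : G × G => p.1 * p.2)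
    fun t => contMDiff_mul 𝓘(ℝ, E) ∞ _, by simp [hγ.2, hη.2]⟩
  inv_mem' {γ} hγ := ⟨hγ.1.comp (f := fun g : G => g⁻¹)
    fun t => contMDiff_inv 𝓘(ℝ, E) ∞ _, by simp [hγ.2]⟩

/-- The group `Ω G` of smooth loops `S¹ → G` that are based at the identity and flat at `0`. -/
def loopGroup : Subgroup (S1 → G) where
  carrier := {γ | IsFlatLoop 𝓘(ℝ, E) γ ∧ γ 0 = 1}
  one_mem' := ⟨isFlatLoop_const 1, rfl⟩
  mul_mem' {γ η} hγ hη := ⟨(hγ.1.prodMk hη.1).comp (f := fun p : G × G => p.1 * p.2)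
    fun t => contMDiff_mul 𝓘(ℝ, E) ∞ _, by simp [hγ.2, hη.2]⟩
  inv_mem' {γ} hγ := ⟨hγ.1.comp (f := fun g : G => g⁻¹)
    fun t => contMDiff_inv 𝓘(ℝ, E) ∞ _, by simp [hγ.2]⟩

/-- A chart of `G` around the identity element, translated so that it maps `1` to `0`. -/
noncomputable def baseChart : PartialEquiv G E :=
  (extChartAt 𝓘(ℝ, E) (1 : G)).trans
    (Equiv.subRight (extChartAt 𝓘(ℝ, E) (1 : G) 1)).toPartialEquiv

variable {E G}

theorem baseChart_one : baseChart E G 1 = 0 := by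
  simp [baseChart]

theorem one_mem_baseChart_source : (1 : G) ∈ (baseChart E G).source := by
  simp [baseChart]

theorem baseChart_symm_zero : (baseChart E G).symm 0 = 1 := by
  rw [← baseChart_one (E := E) (G := G), (baseChart E G).left_inv one_mem_baseChart_source]

theorem contMDiffAt_baseChart {g : G} (hg : g ∈ (baseChart E G).source) :
    ContMDiffAt 𝓘(ℝ, E) 𝓘(ℝ, E) ∞ (baseChart E G) g := by
  have : IsManifold 𝓘(ℝ, E) ∞ G := LieGroup.toContMDiffMul.toIsManifold
  have h1 : g ∈ (chartAt E (1 : G)).source := by simpa [baseChart] using hg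
  have h2 : ContMDiff 𝓘(ℝ, E) 𝓘(ℝ, E) ∞ (fun x : E => x - extChartAt 𝓘(ℝ, E) (1 : G) 1) :=
    (contDiff_id.sub contDiff_const).contMDiff
  exact (h2 _).comp g (contMDiffAt_extChartAt' h1)

theorem contMDiffAt_baseChart_symm {x : E} (hx : x ∈ (baseChart E G).target) :
    ContMDiffAt 𝓘(ℝ, E) 𝓘(ℝ, E) ∞ (baseChart E G).symm x := by
  have : IsManifold 𝓘(ℝ, E) ∞ G := LieGroup.toContMDiffMul.toIsManifold
  set c := extChartAt 𝓘(ℝ, E) (1 : G) 1 with hc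
  have h1 : x + c ∈ (extChartAt 𝓘(ℝ, E) (1 : G)).target := by
    simpa [baseChart, hc] using hx
  have h2 : ContMDiff 𝓘(ℝ, E) 𝓘(ℝ, E) ∞ (fun x : E => x + c) :=
    (contDiff_id.add contDiff_const).contMDiff
  have h3 : ContMDiffAt 𝓘(ℝ, E) 𝓘(ℝ, E) ∞ (extChartAt 𝓘(ℝ, E) (1 : G)).symm (x + c) :=
    (contMDiffOn_extChartAt_symm (1 : G)).contMDiffAt
      ((isOpen_extChartAt_target (1 : G)).mem_nhds h1)
  exact ContMDiffAt.comp (g := (extChartAt 𝓘(ℝ, E) (1 : G)).symm) (f := fun x : E => x + c) x h3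
    (h2 x)

theorem pathChart_mem {η γ : pathGroup E G}
    (h : ∀ t, (η.1 t)⁻¹ * γ.1 t ∈ (baseChart E G).source) :
    (fun t => baseChart E G ((η.1 t)⁻¹ * γ.1 t)) ∈ pathSubmodule E :=
  ⟨((η⁻¹ * γ).2.1).comp fun t => contMDiffAt_baseChart (h t), by
    simp only [η.2.2, γ.2.2, inv_one, mul_one, baseChart_one]⟩

theorem pathChart_symm_mem {η : pathGroup E G} {ξ : PathModel E}
    (h : ∀ t, ξ.val t ∈ (baseChart E G).target) :
    (fun t => η.1 t * (baseChart E G).symm (ξ.val t)) ∈ pathGroup E G :=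
  (pathGroup E G).mul_mem η.2 (y := fun t => (baseChart E G).symm (ξ.val t))
    ⟨ξ.val_mem.1.comp fun t => contMDiffAt_baseChart_symm (h t), by
      simp only [ξ.val_mem.2, baseChart_symm_zero]⟩

theorem loopChart_mem {η γ : loopGroup E G}
    (h : ∀ t, (η.1 t)⁻¹ * γ.1 t ∈ (baseChart E G).source) :
    (fun t => baseChart E G ((η.1 t)⁻¹ * γ.1 t)) ∈ loopSubmodule E :=
  ⟨((η⁻¹ * γ).2.1).comp fun t => contMDiffAt_baseChart (h t), by
    simp only [η.2.2, γ.2.2, inv_one, mul_one, baseChart_one]⟩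

theorem loopChart_symm_mem {η : loopGroup E G} {ξ : LoopModel E}
    (h : ∀ t, ξ.val t ∈ (baseChart E G).target) :
    (fun t => η.1 t * (baseChart E G).symm (ξ.val t)) ∈ loopGroup E G :=
  (loopGroup E G).mul_mem η.2 (y := fun t => (baseChart E G).symm (ξ.val t))
    ⟨ξ.val_mem.1.comp fun t => contMDiffAt_baseChart_symm (h t), by
      simp only [ξ.val_mem.2, baseChart_symm_zero]⟩

open Classical in
/-- The chart of the path group around `η`: it sends `γ` to the path `t ↦ φ(η(t)⁻¹ γ(t))`, where
`φ` is the chart of `G` around the identity. -/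
noncomputable def pathChart (η : pathGroup E G) : PartialEquiv (pathGroup E G) (PathModel E) where
  toFun γ := if h : ∀ t, (η.1 t)⁻¹ * γ.1 t ∈ (baseChart E G).source then
    PathModel.of _ (pathChart_mem h) else 0
  invFun ξ := if h : ∀ t, ξ.val t ∈ (baseChart E G).target then
    ⟨_, pathChart_symm_mem (η := η) h⟩ else 1
  source := {γ | ∀ t, (η.1 t)⁻¹ * γ.1 t ∈ (baseChart E G).source}
  target := {ξ | ∀ t, ξ.val t ∈ (baseChart E G).target}
  map_source' γ h t := by
    replace h : ∀ t, (η.1 t)⁻¹ * γ.1 t ∈ (baseChart E G).source := h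
    rw [dif_pos h]
    exact (baseChart E G).map_source (h t)
  map_target' ξ h t := by
    replace h : ∀ t, ξ.val t ∈ (baseChart E G).target := h
    rw [dif_pos h]
    simpa using (baseChart E G).map_target (h t)
  left_inv' γ h := by
    replace h : ∀ t, (η.1 t)⁻¹ * γ.1 t ∈ (baseChart E G).source := h
    have h' : ∀ t, (PathModel.of _ (pathChart_mem h)).val t ∈ (baseChart E G).target :=
      fun t => (baseChart E G).map_source (h t)
    rw [dif_pos h, dif_pos h']
    refine Subtype.ext (funext fun t => ?_)
    simp only [PathModel.val_of, (baseChart E G).left_inv (h t), mul_inv_cancel_left]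
  right_inv' ξ h := by
    replace h : ∀ t, ξ.val t ∈ (baseChart E G).target := h
    have h' : ∀ t, (η.1 t)⁻¹ * (η.1 t * (baseChart E G).symm (ξ.val t)) ∈
        (baseChart E G).source := fun t => by
      simpa using (baseChart E G).map_target (h t)
    simp only [dif_pos h]
    rw [dif_pos h']
    refine PathModel.ext' (funext fun t => ?_)
    simp only [PathModel.val_of, inv_mul_cancel_left, (baseChart E G).right_inv (h t)]

open Classical in
/-- The chart of the loop group around `η`: it sends `γ` to the loop `t ↦ φ(η(t)⁻¹ γ(t))`, where
`φ` is the chart of `G` around the identity. -/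
noncomputable def loopChart (η : loopGroup E G) : PartialEquiv (loopGroup E G) (LoopModel E) where
  toFun γ := if h : ∀ t, (η.1 t)⁻¹ * γ.1 t ∈ (baseChart E G).source then
    LoopModel.of _ (loopChart_mem h) else 0
  invFun ξ := if h : ∀ t, ξ.val t ∈ (baseChart E G).target then
    ⟨_, loopChart_symm_mem (η := η) h⟩ else 1
  source := {γ | ∀ t, (η.1 t)⁻¹ * γ.1 t ∈ (baseChart E G).source}
  target := {ξ | ∀ t, ξ.val t ∈ (baseChart E G).target}
  map_source' γ h t := by
    replace h : ∀ t, (η.1 t)⁻¹ * γ.1 t ∈ (baseChart E G).source := h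
    rw [dif_pos h]
    exact (baseChart E G).map_source (h t)
  map_target' ξ h t := by
    replace h : ∀ t, ξ.val t ∈ (baseChart E G).target := h
    rw [dif_pos h]
    simpa using (baseChart E G).map_target (h t)
  left_inv' γ h := by
    replace h : ∀ t, (η.1 t)⁻¹ * γ.1 t ∈ (baseChart E G).source := h
    have h' : ∀ t, (LoopModel.of _ (loopChart_mem h)).val t ∈ (baseChart E G).target :=
      fun t => (baseChart E G).map_source (h t)
    rw [dif_pos h, dif_pos h']
    refine Subtype.ext (funext fun t => ?_)
    simp only [LoopModel.val_of, (baseChart E G).left_inv (h t), mul_inv_cancel_left]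
  right_inv' ξ h := by
    replace h : ∀ t, ξ.val t ∈ (baseChart E G).target := h
    have h' : ∀ t, (η.1 t)⁻¹ * (η.1 t * (baseChart E G).symm (ξ.val t)) ∈
        (baseChart E G).source := fun t => by
      simpa using (baseChart E G).map_target (h t)
    simp only [dif_pos h]
    rw [dif_pos h']
    refine LoopModel.ext' (funext fun t => ?_)
    simp only [LoopModel.val_of, inv_mul_cancel_left, (baseChart E G).right_inv (h t)]

variable (E G)

/-- The standard Fréchet manifold structure of `P_e G`. -/
noncomputable def pathAtlas : Atlas.{u, u} (pathGroup E G) where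
  model := PathModel E
  charts := Set.range pathChart

/-- The standard Fréchet manifold structure of `Ω G`. -/
noncomputable def loopAtlas : Atlas.{u, u} (loopGroup E G) where
  model := LoopModel E
  charts := Set.range loopChart

/-- Evaluation of paths at the end point, `P_e G → G`. -/
noncomputable def evPi : pathGroup E G →* G :=
  (Pi.evalMonoidHom (fun _ : Ipi => G) ⟨Real.pi, pi_mem_Ipi⟩).comp (pathGroup E G).subtype

/-- The group `P_e G^{[2]} = P_e G ×_G P_e G` of pairs of paths with the same end point. -/
noncomputable def pathPairs : Subgroup (pathGroup E G × pathGroup E G) :=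
  ((evPi E G).comp (MonoidHom.fst _ _)).eqLocus ((evPi E G).comp (MonoidHom.snd _ _))

/-- The group `Ω_J G` of loops in `Ω G` that are trivial outside `J ⊆ S¹`. -/
def loopsIn (J : Set S1) : Subgroup (loopGroup E G) where
  carrier := {γ | ∀ t, t ∉ J → γ.1 t = 1}
  one_mem' _ _ := rfl
  mul_mem' {γ η} hγ hη t ht := by simp [hγ t ht, hη t ht]
  inv_mem' {γ} hγ t ht := by simp [hγ t ht]

instance (J : Set S1) : (loopsIn E G J).Normal where
  conj_mem γ hγ η t ht := by
    have : γ.1 t = 1 := hγ t ht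
    simp [this]

/-- The open upper half circle `(0, π) ⊆ S¹`. -/
def upperHalf : Set S1 := (fun t : ℝ => (t : S1)) '' Set.Ioo 0 Real.pi

variable {E G}

instance factTwoPi : Fact (0 < 2 * Real.pi) := ⟨Real.two_pi_pos⟩

/-- The concatenation `γ₁ ∪ γ₂` as a map on the circle: first `γ₁`, then `γ₂` backwards. -/
noncomputable def cupFun {X : Type*} (γ₁ γ₂ : Ipi → X) : S1 → X :=
  AddCircle.liftIco (2 * Real.pi) 0
    (fun t => if t ≤ Real.pi then pathExt γ₁ t else pathExt γ₂ (2 * Real.pi - t))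

theorem cupFun_coe {X : Type*} (γ₁ γ₂ : Ipi → X) {t : ℝ} (h0 : 0 ≤ t) (h1 : t < 2 * Real.pi) :
    cupFun γ₁ γ₂ (t : S1) = if t ≤ Real.pi then pathExt γ₁ t else pathExt γ₂ (2 * Real.pi - t) :=
  AddCircle.liftIco_coe_apply ⟨h0, by simpa using h1⟩

theorem exists_coe_Ico (x : S1) : ∃ t : ℝ, 0 ≤ t ∧ t < 2 * Real.pi ∧ (t : S1) = x := by
  refine ⟨AddCircle.equivIco (2 * Real.pi) 0 x, (AddCircle.equivIco (2 * Real.pi) 0 x).2.1, ?_,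
    AddCircle.coe_equivIco⟩
  simpa using (AddCircle.equivIco (2 * Real.pi) 0 x).2.2

theorem cup_mem {p : pathGroup E G × pathGroup E G} (hp : p ∈ pathPairs E G) :
    cupFun p.1.1 p.2.1 ∈ loopGroup E G := by
  have hman : IsManifold 𝓘(ℝ, E) ∞ G := LieGroup.toContMDiffMul.toIsManifold
  obtain ⟨γ₁, γ₂⟩ := p
  have hend : γ₁.1 ⟨Real.pi, pi_mem_Ipi⟩ = γ₂.1 ⟨Real.pi, pi_mem_Ipi⟩ := hp
  have hπ := Real.pi_pos
  set g := γ₁.1 ⟨Real.pi, pi_mem_Ipi⟩ with hg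
  set b : ℝ → G := fun t => pathExt γ₁.1 t * (g⁻¹ * pathExt γ₂.1 (2 * Real.pi - t)) with hb
  have h1 : ContMDiff 𝓘(ℝ, ℝ) 𝓘(ℝ, E) ∞ (pathExt γ₁.1) := γ₁.2.1.contMDiff
  have h2 : ContMDiff 𝓘(ℝ, ℝ) 𝓘(ℝ, E) ∞ (fun t : ℝ => pathExt γ₂.1 (2 * Real.pi - t)) :=
    γ₂.2.1.contMDiff.comp (contDiff_const.sub contDiff_id).contMDiff
  have hbs : ContMDiff 𝓘(ℝ, ℝ) 𝓘(ℝ, E) ∞ b := h1.mul (contMDiff_const.mul h2)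
  have hbs' : ContMDiff 𝓘(ℝ, ℝ) 𝓘(ℝ, E) ∞ (fun t : ℝ => b (t + 2 * Real.pi)) :=
    hbs.comp (contDiff_id.add contDiff_const).contMDiff
  have hb0 : ∀ t, t ≤ 0 → b t = 1 := by
    intro t ht
    simp only [hb]
    rw [pathExt_of_le _ ht, pathExt_of_ge _ (by linarith), γ₁.2.2, ← hend]
    simp
  have hb1 : ∀ t, 2 * Real.pi ≤ t → b t = 1 := by
    intro t ht
    simp only [hb]
    rw [pathExt_of_ge _ (by linarith), pathExt_of_le _ (by linarith), γ₂.2.2]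
    simp [hg]
  have hL : ∀ t : ℝ, 0 ≤ t → t < 2 * Real.pi → cupFun γ₁.1 γ₂.1 (t : S1) = b t := by
    intro t h0 ht
    rw [cupFun_coe _ _ h0 ht]
    simp only [hb]
    split_ifs with hc
    · rw [pathExt_of_ge γ₂.1 (show Real.pi ≤ 2 * Real.pi - t by linarith), ← hend]
      simp
    · rw [pathExt_of_ge γ₁.1 (show Real.pi ≤ t by linarith), ← hg]
      simp
  have hL' : ∀ t : ℝ, -(2 * Real.pi) < t → t < 2 * Real.pi →
      cupFun γ₁.1 γ₂.1 (t : S1) = b t * b (t + 2 * Real.pi) := by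
    intro t h0 ht
    rcases le_or_gt 0 t with h | h
    · rw [hL t h ht, hb1 (t + 2 * Real.pi) (by linarith), mul_one]
    · rw [hb0 t h.le, one_mul, ← hL (t + 2 * Real.pi) (by linarith) (by linarith)]
      congr 1
      exact (AddCircle.coe_add_period (2 * Real.pi) t).symm
  have hsm0 : ∀ t₀ : ℝ, -(2 * Real.pi) < t₀ → t₀ < 2 * Real.pi →
      ContMDiffAt 𝓘(ℝ, ℝ) 𝓘(ℝ, E) ∞ (fun t : ℝ => cupFun γ₁.1 γ₂.1 (t : S1)) t₀ := by
    intro t₀ h0 h1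
    refine ((hbs.mul hbs') t₀).congr_of_eventuallyEq ?_
    filter_upwards [Ioo_mem_nhds h0 h1] with t ht
    exact hL' t ht.1 ht.2
  have hzero : cupFun γ₁.1 γ₂.1 0 = 1 := by
    have := hL 0 le_rfl (by linarith)
    rw [hb0 0 le_rfl] at this
    simpa using this
  refine ⟨⟨fun t₀ => ?_, ?_⟩, hzero⟩
  · obtain ⟨r, hr0, hr1, hr⟩ := exists_coe_Ico (t₀ : S1)
    have he : (fun t : ℝ => cupFun γ₁.1 γ₂.1 (t : S1)) =
        (fun t : ℝ => cupFun γ₁.1 γ₂.1 (t : S1)) ∘ (fun t : ℝ => t + (r - t₀)) := by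
      funext t
      simp only [Function.comp_apply, AddCircle.coe_add, AddCircle.coe_sub, hr, sub_self, add_zero]
    rw [he]
    refine ContMDiffAt.comp (I' := 𝓘(ℝ, ℝ)) t₀ ?_
      ((contDiff_id.add contDiff_const).contMDiff (f := fun t : ℝ => t + (r - t₀)) t₀)
    have : t₀ + (r - t₀) = r := by ring
    rw [this]
    exact hsm0 r (by linarith) hr1
  · rw [← flatWithinAt_iff_univ uniqueDiffOn_Ipi zero_mem_Ipi (hsm0 0 (by linarith) (by linarith))]
    refine γ₁.2.1.flat_zero.congr zero_mem_Ipi fun t ht => ?_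
    rw [cupFun_coe _ _ ht.1 (by linarith [ht.2]), if_pos ht.2]

variable (E G) in
/-- The homomorphism `∪ : P_e G^{[2]} → Ω G`. -/
noncomputable def cup : pathPairs E G →* loopGroup E G where
  toFun p := ⟨cupFun p.1.1.1 p.1.2.1, cup_mem p.2⟩
  map_one' := by
    refine Subtype.ext (funext fun x => ?_)
    obtain ⟨t, h0, h1, rfl⟩ := exists_coe_Ico x
    simp only [cupFun_coe _ _ h0 h1]
    split_ifs <;> rfl
  map_mul' p q := by
    refine Subtype.ext (funext fun x => ?_)
    obtain ⟨t, h0, h1, rfl⟩ := exists_coe_Ico x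
    simp only [Subgroup.coe_mul, Pi.mul_apply, cupFun_coe _ _ h0 h1]
    split_ifs <;> rfl

variable (E G) in
/-- The diagonal `P_e G → P_e G^{[2]}`, `γ ↦ (γ, γ)`. -/
noncomputable def diagPair : pathGroup E G →* pathPairs E G :=
  ((MonoidHom.id _).prod (MonoidHom.id _)).codRestrict (pathPairs E G) fun _ => rfl

theorem pathExt_restrict (γ : S1 → G) {t : ℝ} (ht : t ∈ Set.Icc 0 Real.pi) :
    pathExt (fun r : Ipi => γ ((r : ℝ) : S1)) t = γ (t : S1) := by
  rw [pathExt_of_mem _ ht]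

theorem restrict_mem (γ : loopsIn E G upperHalf) :
    (fun t : Ipi => γ.1.1 ((t : ℝ) : S1)) ∈ pathGroup E G := by
  have hsm := γ.1.2.1.smooth
  have hπ := Real.pi_pos
  have hout : ∀ t : ℝ, Real.pi ≤ t → t ≤ 2 * Real.pi → γ.1.1 (t : S1) = 1 := by
    intro t h0 h1
    refine γ.2 _ ?_
    rintro ⟨r, hr, hrt⟩
    rcases h1.lt_or_eq with h1 | h1
    · have := (AddCircle.coe_eq_coe_iff_of_mem_Ico (p := 2 * Real.pi) (a := 0)
        ⟨hr.1.le, by linarith [hr.2]⟩ ⟨by linarith, by linarith⟩).1 hrt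
      linarith [hr.2]
    · rw [h1, AddCircle.coe_period, ← AddCircle.coe_zero] at hrt
      have := (AddCircle.coe_eq_coe_iff_of_mem_Ico (p := 2 * Real.pi) (a := 0)
        ⟨hr.1.le, by linarith [hr.2]⟩ ⟨le_rfl, by linarith⟩).1 hrt
      linarith [hr.1]
  refine ⟨⟨hsm.contMDiffOn.congr fun t ht => pathExt_restrict _ ht, ?_, ?_⟩, ?_⟩
  · refine FlatWithinAt.congr (γ := fun t : ℝ => γ.1.1 (t : S1)) zero_mem_Ipi ?_
      fun t ht => pathExt_restrict _ ht
    rw [flatWithinAt_iff_univ uniqueDiffOn_Ipi zero_mem_Ipi (hsm 0)]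
    exact γ.1.2.1.flat_zero
  · refine FlatWithinAt.congr (γ := fun t : ℝ => γ.1.1 (t : S1)) pi_mem_Ipi ?_
      fun t ht => pathExt_restrict _ ht
    have hm : Real.pi ∈ Set.Icc Real.pi (2 * Real.pi) := ⟨le_rfl, by linarith⟩
    rw [flatWithinAt_iff_univ uniqueDiffOn_Ipi pi_mem_Ipi (hsm _),
      ← flatWithinAt_iff_univ (uniqueDiffOn_Icc (by linarith)) hm (hsm _)]
    exact (flatWithinAt_const (1 : G)).congr hm fun t ht => hout t ht.1 ht.2
  · simpa using γ.1.2.2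

variable (E G) in
/-- Restriction of loops to the upper half circle, `Ω_{(0, π)} G → P_e G`. -/
noncomputable def restrictHalf : loopsIn E G upperHalf →* pathGroup E G where
  toFun γ := ⟨_, restrict_mem γ⟩
  map_one' := rfl
  map_mul' _ _ := rfl

end groups

/-! ### Central extensions of the loop group -/

section extensions

variable (E : Type u) [NormedAddCommGroup E] [NormedSpace ℝ E] (G : Type u) [Group G]
  [TopologicalSpace G] [ChartedSpace E G] [LieGroup 𝓘(ℝ, E) ∞ G]

/-- The circle group `U(1)` as a manifold. -/
noncomputable def circleAtlas : Atlas.{0, 0} Circle :=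
  Atlas.ofChartedSpace (EuclideanSpace ℝ (Fin 1)) Circle

/-- A central extension `1 → U(1) → Ω̃G → ΩG → 1` of Fréchet Lie groups: an exact sequence of
Lie group homomorphisms with central kernel for which `Ω̃G` is a principal `U(1)`-bundle over
`ΩG`. In the last condition, `Φ ↦ (π(Φ), u(Φ))` is the local trivialization over `S` and
`(γ, z) ↦ σ(γ) ι(z)` is its inverse. -/
structure CentralExtension where
  carrier : Type u
  [group : Group carrier]
  atlas : Atlas.{u, u} carrier
  isFrechetLieGroup : atlas.IsFrechetLieGroup
  ι : Circle →* carrier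
  π : carrier →* loopGroup E G
  smooth_ι : Atlas.SmoothMap circleAtlas atlas ι
  smooth_π : Atlas.SmoothMap atlas (loopAtlas E G) π
  injective_ι : Function.Injective ι
  surjective_π : Function.Surjective π
  exact : ι.range = π.ker
  central : ∀ z Φ, ι z * Φ = Φ * ι z
  locally_trivial : ∀ γ : loopGroup E G, ∃ (S : Set (loopGroup E G)) (σ : loopGroup E G → carrier)
    (u : carrier → Circle), γ ∈ S ∧
      Atlas.SmoothMapOn (loopAtlas E G) atlas σ S ∧
      Atlas.SmoothMapOn atlas circleAtlas u (π ⁻¹' S) ∧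
      (∀ η ∈ S, π (σ η) = η) ∧ ∀ Φ, π Φ ∈ S → Φ = σ (π Φ) * ι (u Φ)

attribute [instance] CentralExtension.group

namespace CentralExtension

variable {E G} (X : CentralExtension E G)

/-- Elements over loops supported in disjoint subsets of the circle commute. -/
def DisjointCommutative : Prop :=
  ∀ J K : Set S1, Disjoint J K → ∀ Φ Ψ : X.carrier, X.π Φ ∈ loopsIn E G J →
    X.π Ψ ∈ loopsIn E G K → Φ * Ψ = Ψ * Φ

/-- The restriction of the extension to `P_e G^{[2]}`, that is, the fibre product of
`∪ : P_e G^{[2]} → ΩG` and `π : Ω̃G → ΩG`. -/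
noncomputable def overPairs : Subgroup (pathPairs E G × X.carrier) :=
  ((cup E G).comp (MonoidHom.fst _ _)).eqLocus (X.π.comp (MonoidHom.snd _ _))

/-- The source map `Φ ↦ γ₂` for `Φ` over `γ₁ ∪ γ₂`. -/
noncomputable def source : X.overPairs →* pathGroup E G :=
  (MonoidHom.snd _ _).comp ((pathPairs E G).subtype.comp ((MonoidHom.fst _ _).comp
    X.overPairs.subtype))

/-- The target map `Φ ↦ γ₁` for `Φ` over `γ₁ ∪ γ₂`. -/
noncomputable def target : X.overPairs →* pathGroup E G :=
  (MonoidHom.fst _ _).comp ((pathPairs E G).subtype.comp ((MonoidHom.fst _ _).comp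
    X.overPairs.subtype))

/-- The projection of the restricted extension to `Ω̃G`. -/
noncomputable def toExtension : X.overPairs →* X.carrier :=
  (MonoidHom.snd _ _).comp X.overPairs.subtype

/-- `B` is the manifold structure of the fibre product `P_e G ×_G P_e G ×_{ΩG} Ω̃G`. -/
def IsPairsStructure (B : Atlas.{u, u} X.overPairs) : Prop :=
  B.IsInduced (((pathAtlas E G).prod (pathAtlas E G)).prod X.atlas)
    (fun p => (p.1.1.1, p.1.2))

/-- A fusion factorization: a Lie group homomorphism from `P_e G` to the restriction of the
extension to `P_e G^{[2]}` that lifts the diagonal `γ ↦ γ ∪ γ`. A map to the fibre product over a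
smooth map to `P_e G^{[2]}` is smooth if and only if its component in `Ω̃G` is. -/
structure FusionFactorization where
  toHom : pathGroup E G →* X.overPairs
  lifts : ∀ γ, (toHom γ).1.1 = diagPair E G γ
  smooth : Atlas.SmoothMap (pathAtlas E G) X.atlas (fun γ => X.toExtension (toHom γ))

/-- The 2-group data with objects `P_e G` and morphisms the restriction of the extension to
`P_e G^{[2]}` (with manifold structure `B`), whose identity map is a fusion factorization. -/
noncomputable def fusionTwoGroup (i : X.FusionFactorization) (B : Atlas.{u, u} X.overPairs) :
    TwoGroupData.{u} :=
  TwoGroupData.ofMinimalData (pathAtlas E G) B X.source X.target i.toHom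

/-- The restriction of the extension to `Ω_{(0, π)} G`, as a subgroup of `Ω̃G`. -/
def overHalf : Subgroup X.carrier := (loopsIn E G upperHalf).comap X.π

instance : X.overHalf.Normal := inferInstanceAs ((loopsIn E G upperHalf).comap X.π).Normal

/-- `B` is the manifold structure of the restriction of the extension to `Ω_{(0, π)} G`. -/
def IsHalfStructure (B : Atlas.{u, u} X.overHalf) : Prop :=
  B.IsInduced X.atlas Subtype.val

/-- The conjugation action of `Ω̃G`, which descends to an action of `ΩG`. -/
noncomputable def loopAction : loopGroup E G →* MulAut X.overHalf :=
  X.π.liftOfSurjective X.surjective_π ⟨MulAut.conjNormal, by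
    intro Φ hΦ
    rw [← X.exact] at hΦ
    obtain ⟨z, rfl⟩ := hΦ
    ext Ψ
    simp [X.central]⟩

theorem loopAction_apply (Λ : X.carrier) (Φ : X.overHalf) :
    (X.loopAction (X.π Λ) Φ : X.carrier) = Λ * Φ * Λ⁻¹ := by
  rw [loopAction, MonoidHom.liftOfRightInverse_comp_apply]
  simp

/-- The canonical action of `P_e G`: conjugation by any lift of `γ ∪ γ`. -/
noncomputable def canonicalAction : pathGroup E G →* MulAut X.overHalf :=
  X.loopAction.comp ((cup E G).comp (diagPair E G))

theorem canonicalAction_apply {γ : pathGroup E G} {Λ : X.carrier}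
    (h : X.π Λ = cup E G (diagPair E G γ)) (Φ : X.overHalf) :
    (X.canonicalAction γ Φ : X.carrier) = Λ * Φ * Λ⁻¹ := by
  rw [← X.loopAction_apply, h]
  rfl

/-- The homomorphism `t : Φ ↦ π(Φ)|_{[0, π]}` to `P_e G`. -/
noncomputable def halfTarget : X.overHalf →* pathGroup E G :=
  (restrictHalf E G).comp (X.π.subgroupComap (loopsIn E G upperHalf))

/-- The precrossed module `t : Ω̃_{(0, π)}G → P_e G` with the canonical action, where
`Ω̃_{(0, π)}G` carries the manifold structure `B`. -/
noncomputable def crossedModule (B : Atlas.{u, u} X.overHalf) : PrecrossedModule.{u} where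
  H := X.overHalf
  K := pathGroup E G
  atlasH := B
  atlasK := pathAtlas E G
  t := X.halfTarget
  act := X.canonicalAction
  t_act γ Φ := by
    obtain ⟨Λ, hΛ⟩ := X.surjective_π (cup E G (diagPair E G γ))
    refine Subtype.ext (funext fun t => ?_)
    have h1 : ((X.π Λ).1 ((t : ℝ) : S1)) = γ.1 t := by
      rw [hΛ]
      have := cupFun_coe γ.1 γ.1 t.2.1 (show (t : ℝ) < 2 * Real.pi by
        linarith [t.2.2, Real.pi_pos])
      rw [if_pos t.2.2, pathExt_of_mem _ t.2] at this
      exact this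
    have h2 : (X.halfTarget (X.canonicalAction γ Φ)).1 t =
        (X.π (X.canonicalAction γ Φ : X.carrier)).1 ((t : ℝ) : S1) := rfl
    have h3 : (X.halfTarget Φ).1 t = (X.π Φ).1 ((t : ℝ) : S1) := rfl
    rw [h2, X.canonicalAction_apply hΛ]
    simp [h1, h3]

end CentralExtension

end extensions

end LoopTwoGroup

open LoopTwoGroup

open scoped BoundedContinuousFunction

namespace LoopTwoGroup

/-! ### Michal–Bastiani calculus -/

section calculus

variable {V : Type v} [AddCommGroup V] [Module ℝ V] [TopologicalSpace V]
  {W : Type w} [AddCommGroup W] [Module ℝ W] [TopologicalSpace W]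
  {Z : Type w'} [AddCommGroup Z] [Module ℝ Z] [TopologicalSpace Z]

/-! The algebra is short. With composition `x * (i (s x))⁻¹ * y` the groupoid identities are formal
consequences of `s ∘ i = t ∘ i = id`. That composition and inversion are homomorphisms amounts to
the kernels of `s` and `t` commuting. An element with trivial source lies over a loop `γ ∪ 1`,
supported in the open upper half circle; one with trivial target lies over `1 ∪ γ`, supported in the
complement. So disjoint commutativity is exactly what is needed (`DisjointCommutative.mul_comm`),
and it gives the Peiffer identity as well.

The fusion factorization splits the source map: `Φ ↦ (Φ i(s(Φ))⁻¹, s(Φ))` is a bijection onto the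
product of the restricted extension and `P_e G`, with inverse `(Ψ, γ) ↦ Ψ i(γ)` (`pairsEquiv`).
Since `i(γ)` lifts `γ ∪ γ`, conjugation by it is the crossed module action, and the bijection is an
isomorphism onto the semidirect product (`toHalf_mul`).

The same splitting supplies the fibre products. The product structure transported along `pairsEquiv`
is the manifold structure of the pulled-back extension (`isPairsStructure_comapEquiv`), and
composable pairs are a product by the same device (`isInduced_composable`). Universal properties
then yield smoothness of all structure maps; smoothness of `∪` is never needed, because that of `i`
is part of its definition.

The analysis comes down to two facts. First, `P_e G` is a Fréchet Lie group
(`isFrechetLieGroup_pathAtlas`): in charts, multiplication and inversion are superposition operators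
`ξ ↦ F(t, ξ(t))`, smooth in the Michal–Bastiani sense (`IsPathField.isCk`). The proof rests on `(F ∘
c)' = TF(c, c')`, which trades a time derivative for passing to the tangent map, so every estimate
is an induction from uniform statements on a compact interval. Second, the restriction of the
extension to the upper half circle is a manifold with the required universal property
(`isHalfStructure_halfAtlas`): in charts built from local trivializations it is a closed linear
subspace, and its target map is a continuous linear restriction map. -/

theorem IsCk.continuousOn {k : ℕ} {f : V → W} {U : Set V} (h : IsCk W k V f U) :
    ContinuousOn f U := by
  cases k with
  | zero => exact h
  | succ k => exact h.1

theorem IsCk.mono {k : ℕ} : ∀ {V : Type v} [AddCommGroup V] [Module ℝ V] [TopologicalSpace V]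
    {f : V → W} {U U' : Set V}, IsCk W k V f U → U' ⊆ U → IsCk W k V f U' := by
  induction k with
  | zero => exact fun h hU => ContinuousOn.mono h hU
  | succ k ih =>
    rintro V _ _ _ f U U' ⟨hc, df, hd, hdf⟩ hU
    exact ⟨hc.mono hU, df, fun x hx => hd x (hU hx), ih hdf (Set.prod_mono hU subset_rfl)⟩

theorem IsCk.of_succ {k : ℕ} : ∀ {V : Type v} [AddCommGroup V] [Module ℝ V] [TopologicalSpace V]
    {f : V → W} {U : Set V}, IsCk W (k + 1) V f U → IsCk W k V f U := by
  induction k with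
  | zero => exact fun h => h.1
  | succ k ih =>
    rintro V _ _ _ f U ⟨hc, df, hd, hdf⟩
    exact ⟨hc, df, hd, ih hdf⟩

theorem tendsto_add_smul [IsTopologicalAddGroup V] [ContinuousSMul ℝ V] (x v : V) :
    Filter.Tendsto (fun t : ℝ => x + t • v) (𝓝[≠] 0) (𝓝 x) := by
  have : Continuous fun t : ℝ => x + t • v := by fun_prop
  have h := this.tendsto 0
  simp only [zero_smul, add_zero] at h
  exact h.mono_left nhdsWithin_le_nhds

theorem IsCk.congr [IsTopologicalAddGroup V] [ContinuousSMul ℝ V] {k : ℕ} {f g : V → W}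
    {U : Set V} (hU : IsOpen U) (h : IsCk W k V f U) (he : ∀ x ∈ U, g x = f x) :
    IsCk W k V g U := by
  cases k with
  | zero => exact ContinuousOn.congr h he
  | succ k =>
    obtain ⟨hc, df, hd, hdf⟩ := h
    refine ⟨hc.congr he, df, fun x hx v => (hd x hx v).congr' ?_, hdf⟩
    filter_upwards [tendsto_add_smul x v (hU.mem_nhds hx)] with t ht
    rw [he x hx, he _ ht]

/-- Directional derivatives are limits, hence unique in a Hausdorff space. Local derivatives
therefore agree on overlaps, and at `(x, v)` the one chosen for `x` may be used. -/
theorem IsCk.of_locally [T2Space W] {k : ℕ} : ∀ {V : Type v} [AddCommGroup V] [Module ℝ V]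
    [TopologicalSpace V] [IsTopologicalAddGroup V] [ContinuousSMul ℝ V] {f : V → W} {U : Set V},
    (∀ x ∈ U, ∃ U', IsOpen U' ∧ x ∈ U' ∧ U' ⊆ U ∧ IsCk W k V f U') → IsCk W k V f U := by
  induction k with
  | zero =>
    intro V _ _ _ _ _ f U h x hx
    obtain ⟨U', ho, hx', -, hc⟩ := h x hx
    exact (ContinuousOn.continuousAt hc (ho.mem_nhds hx')).continuousWithinAt
  | succ k ih =>
    intro V _ _ _ _ _ f U h
    refine ⟨fun x hx => ?_, ?_⟩
    · obtain ⟨U', ho, hx', -, hc⟩ := h x hx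
      exact (hc.1.continuousAt (ho.mem_nhds hx')).continuousWithinAt
    choose! U' ho hxU' hU' hck using h
    choose! hc df hd hdf using hck
    have key : ∀ x ∈ U, ∀ y ∈ U, x ∈ U' y → ∀ v, df x (x, v) = df y (x, v) :=
      fun x hx y hy hxy v => tendsto_nhds_unique (hd x hx x (hxU' x hx) v) (hd y hy x hxy v)
    refine ⟨fun p => df p.1 p, fun x hx v => hd x hx x (hxU' x hx) v, ih ?_⟩
    rintro ⟨x, v⟩ ⟨hx, -⟩
    exact ⟨U' x ×ˢ Set.univ, (ho x hx).prod isOpen_univ, ⟨hxU' x hx, trivial⟩,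
      Set.prod_mono (hU' x hx) subset_rfl, (hdf x hx).congr ((ho x hx).prod isOpen_univ)
      fun p hp => key p.1 (hU' x hx hp.1) x hx hp.1 p.2⟩

/-- A linear inner map carries difference quotients to difference quotients, so no mean value
argument and no local convexity is involved. The general chain rule uses this for the projection `V
× V → V`. -/
theorem IsCk.comp_clm {k : ℕ} : ∀ {V : Type v} [AddCommGroup V] [Module ℝ V]
    [TopologicalSpace V] {Z : Type w'} [AddCommGroup Z] [Module ℝ Z] [TopologicalSpace Z]
    {f : V → W} {U : Set V} (_ : IsCk W k V f U) (L : Z →L[ℝ] V),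
    IsCk W k Z (fun z => f (L z)) (L ⁻¹' U) := by
  induction k with
  | zero =>
    intro V _ _ _ Z _ _ _ f U h L
    exact ContinuousOn.comp h L.continuous.continuousOn fun _ hz => hz
  | succ k ih =>
    rintro V _ _ _ Z _ _ _ f U ⟨hc, df, hd, hdf⟩ L
    refine ⟨hc.comp L.continuous.continuousOn fun _ hz => hz, fun p => df (L p.1, L p.2),
      fun x hx v => ?_, ?_⟩
    · simpa using hd (L x) hx (L v)
    · exact (ih hdf (L.prodMap L)).mono fun p hp => ⟨hp.1, trivial⟩

theorem IsCk.prodMk {k : ℕ} : ∀ {V : Type v} [AddCommGroup V] [Module ℝ V]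
    [TopologicalSpace V] {f : V → W} {g : V → Z} {U : Set V}, IsCk W k V f U → IsCk Z k V g U →
    IsCk (W × Z) k V (fun x => (f x, g x)) U := by
  induction k with
  | zero => exact fun h h' => ContinuousOn.prodMk h h'
  | succ k ih =>
    rintro V _ _ _ f g U ⟨hc, df, hd, hdf⟩ ⟨hc', dg, hd', hdg⟩
    exact ⟨hc.prodMk hc', fun p => (df p, dg p),
      fun x hx v => (hd x hx v).prodMk_nhds (hd' x hx v), ih hdf hdg⟩

theorem isCk_const (c : W) (k : ℕ) : ∀ (V : Type v) [AddCommGroup V] [Module ℝ V]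
    [TopologicalSpace V] (U : Set V), IsCk W k V (fun _ => c) U := by
  induction k generalizing c with
  | zero => exact fun V _ _ _ U => continuousOn_const
  | succ k ih =>
    intro V _ _ _ U
    exact ⟨continuousOn_const, fun _ => 0, fun x _ v => by simp [tendsto_const_nhds], ih 0 _ _⟩

/-- A closed convex set that contains the derivative of a curve contains its difference. -/
theorem sub_mem_of_hasDeriv [IsTopologicalAddGroup Z] [ContinuousSMul ℝ Z] [LocallyConvexSpace ℝ Z]
    {C : Set Z} (hC : Convex ℝ C) (hCc : IsClosed C) {b b' : ℝ → Z}
    (hb : ∀ r ∈ Set.Icc (0 : ℝ) 1,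
      Filter.Tendsto (fun t : ℝ => t⁻¹ • (b (r + t) - b r)) (𝓝[≠] 0) (𝓝 (b' r)))
    (hb' : ∀ r ∈ Set.Icc (0 : ℝ) 1, b' r ∈ C) : b 1 - b 0 ∈ C := by
  by_contra hmem
  -- A functional separating the difference from `C` would contradict the scalar mean value theorem
  -- for `l ∘ b`.
  obtain ⟨l, c, hl, hc⟩ := geometric_hahn_banach_closed_point hC hCc hmem
  have hd : ∀ r ∈ Set.Icc (0 : ℝ) 1, HasDerivAt (fun r => l (b r)) (l (b' r)) r := by
    intro r hr
    rw [hasDerivAt_iff_tendsto_slope_zero]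
    have := (l.continuous.tendsto _).comp (hb r hr)
    simpa [Function.comp_def] using this
  obtain ⟨r, hr, he⟩ := exists_hasDerivAt_eq_slope (fun r => l (b r)) (fun r => l (b' r))
    zero_lt_one (fun r hr => (hd r hr).continuousAt.continuousWithinAt)
    (fun r hr => hd r ⟨hr.1.le, hr.2.le⟩)
  have h1 := hl _ (hb' r ⟨hr.1.le, hr.2.le⟩)
  rw [map_sub] at hc
  simp only [sub_zero, div_one] at he
  linarith

theorem exists_closed_convex_nhds [IsTopologicalAddGroup Z] [ContinuousSMul ℝ Z]
    [LocallyConvexSpace ℝ Z] {z : Z} {N : Set Z} (hN : N ∈ 𝓝 z) :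
    ∃ C ∈ 𝓝 z, Convex ℝ C ∧ IsClosed C ∧ C ⊆ N := by
  obtain ⟨N', hN', hc, hsub⟩ := exists_mem_nhds_isClosed_subset hN
  obtain ⟨C, ⟨hC, hconv⟩, hCs⟩ := (LocallyConvexSpace.convex_basis (𝕜 := ℝ) z).mem_iff.1 hN'
  exact ⟨closure C, Filter.mem_of_superset hC subset_closure, hconv.closure, isClosed_closure,
    (closure_minimal hCs hc).trans hsub⟩

/-- The core of the chain rule: difference quotients still converge when the direction `c s` moves.
For fixed `s` the curve `r ↦ s⁻¹ g(y + r s c(s))` on `[0, 1]` has derivative `dg(y + r s c(s),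
c(s))`; for small `s` all these values lie in a given closed convex neighbourhood of `dg(y, z)`,
hence so does the total difference. -/
theorem tendsto_slope_of_tendsto [IsTopologicalAddGroup W] [ContinuousSMul ℝ W]
    [IsTopologicalAddGroup Z] [ContinuousSMul ℝ Z] [LocallyConvexSpace ℝ Z]
    {g : W → Z} {dg : W × W → Z} {U : Set W} (hU : IsOpen U)
    (hd : ∀ x ∈ U, ∀ v, Filter.Tendsto (fun t : ℝ => t⁻¹ • (g (x + t • v) - g x)) (𝓝[≠] 0)
      (𝓝 (dg (x, v))))
    (hdc : ContinuousOn dg (U ×ˢ Set.univ)) {y : W} (hy : y ∈ U) {c : ℝ → W} {z : W}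
    (hc : Filter.Tendsto c (𝓝[≠] 0) (𝓝 z)) :
    Filter.Tendsto (fun s : ℝ => s⁻¹ • (g (y + s • c s) - g y)) (𝓝[≠] 0) (𝓝 (dg (y, z))) := by
  intro N hN
  obtain ⟨C, hCn, hconv, hcl, hCN⟩ := exists_closed_convex_nhds hN
  have h1 : ∀ r ∈ Set.Icc (0 : ℝ) 1, ∀ᶠ q : (ℝ × W) × ℝ in 𝓝 (((0 : ℝ), z), r),
      y + q.2 • q.1.1 • q.1.2 ∈ U ∧ dg (y + q.2 • q.1.1 • q.1.2, q.1.2) ∈ C := by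
    intro r _
    have hcont : Continuous fun q : (ℝ × W) × ℝ => (y + q.2 • q.1.1 • q.1.2, q.1.2) := by fun_prop
    have h0 : (fun q : (ℝ × W) × ℝ => (y + q.2 • q.1.1 • q.1.2, q.1.2)) (((0 : ℝ), z), r)
        = (y, z) := by simp
    have hdat : ContinuousAt dg (y, z) :=
      hdc.continuousAt ((hU.prod isOpen_univ).mem_nhds ⟨hy, trivial⟩)
    have ht : Filter.Tendsto (fun q : (ℝ × W) × ℝ => (y + q.2 • q.1.1 • q.1.2, q.1.2))
        (𝓝 (((0 : ℝ), z), r)) (𝓝 (y, z)) := h0 ▸ hcont.tendsto (((0 : ℝ), z), r)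
    exact (ht.eventually ((hU.prod isOpen_univ).eventually_mem ⟨hy, trivial⟩)).mono (fun q h => h.1)
      |>.and (ht.eventually (hdat hCn))
  -- Compactness of `[0, 1]` makes the neighbourhood of `(0, z)` independent of `r`.
  have h2 := isCompact_Icc.eventually_forall_of_forall_eventually
    (P := fun (q : ℝ × W) (r : ℝ) => y + r • q.1 • q.2 ∈ U ∧ dg (y + r • q.1 • q.2, q.2) ∈ C) h1
  have h3 : Filter.Tendsto (fun s : ℝ => (s, c s)) (𝓝[≠] 0) (𝓝 ((0 : ℝ), z)) :=
    (tendsto_nhdsWithin_of_tendsto_nhds Filter.tendsto_id).prodMk_nhds hc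
  rw [Filter.mem_map]
  filter_upwards [h3.eventually h2, self_mem_nhdsWithin] with s hs hs0
  refine hCN ?_
  have hs0 : s ≠ 0 := hs0
  have := sub_mem_of_hasDeriv hconv hcl (b := fun r => s⁻¹ • g (y + r • s • c s))
    (b' := fun r => dg (y + r • s • c s, c s)) (fun r hr => ?_) (fun r hr => (hs r hr).2)
  · simpa [smul_sub] using this
  · have h4 := hd _ (hs r hr).1 (c s)
    -- Moving `r` by `t` moves the argument by `(t * s) • c s`; the factor `s⁻¹` in front of `g`
    -- absorbs the rescaling.
    have h5 : Filter.Tendsto (fun t : ℝ => t * s) (𝓝[≠] 0) (𝓝[≠] 0) := by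
      refine tendsto_nhdsWithin_iff.2 ⟨?_, ?_⟩
      · have : Continuous fun t : ℝ => t * s := by fun_prop
        simpa using (this.tendsto 0).mono_left nhdsWithin_le_nhds
      · filter_upwards [self_mem_nhdsWithin] with t ht
        exact mul_ne_zero ht hs0
    refine (h4.comp h5).congr fun t => ?_
    simp only [Function.comp_apply, mul_inv, smul_sub, smul_smul, add_mul, add_smul, add_assoc]

/-- Write `f(x + tv) = f(x) + t c(t)`, where `c(t)` is the difference quotient of `f` and tends to
`df(x, v)`; the previous lemma then applies. The derivative `dg(f x, df(x, v))` is again a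
composite, of one class lower, so the induction has to range over all spaces. -/
theorem IsCk.comp {k : ℕ} [IsTopologicalAddGroup Z] [ContinuousSMul ℝ Z] [LocallyConvexSpace ℝ Z] :
    ∀ {V : Type v} [AddCommGroup V] [Module ℝ V] [TopologicalSpace V] [IsTopologicalAddGroup V]
    [ContinuousSMul ℝ V] {W : Type w} [AddCommGroup W] [Module ℝ W] [TopologicalSpace W]
    [IsTopologicalAddGroup W] [ContinuousSMul ℝ W] {g : W → Z} {f : V → W} {U : Set V}
    {U' : Set W}, IsCk Z k W g U' → IsOpen U' → IsCk W k V f U → IsOpen U →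
    Set.MapsTo f U U' → IsCk Z k V (fun x => g (f x)) U := by
  induction k with
  | zero =>
    intro V _ _ _ _ _ W _ _ _ _ _ g f U U' hg _ hf _ hm
    exact ContinuousOn.comp hg hf hm
  | succ k ih =>
    intro V _ _ _ _ _ W _ _ _ _ _ g f U U' hg hU' hf hU hm
    have hf' := hf.of_succ
    obtain ⟨hgc, dg, hgd, hdg⟩ := hg
    obtain ⟨hfc, df, hfd, hdf⟩ := hf
    refine ⟨hgc.comp hfc hm, fun p => dg (f p.1, df p), fun x hx v => ?_, ?_⟩
    · have := tendsto_slope_of_tendsto hU' hgd hdg.continuousOn (hm hx) (hfd x hx v)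
      refine this.congr' ?_
      filter_upwards [self_mem_nhdsWithin] with t ht
      rw [smul_smul, mul_inv_cancel₀ (show t ≠ 0 from ht), one_smul, add_sub_cancel]
    · refine ih (U' := U' ×ˢ Set.univ) hdg (hU'.prod isOpen_univ) (IsCk.prodMk ?_ hdf)
        (hU.prod isOpen_univ) fun p hp => ⟨hm hp.1, trivial⟩
      exact (hf'.comp_clm (ContinuousLinearMap.fst ℝ V V)).mono fun p hp => hp.1

/-- Difference quotients of `L ∘ f` lie in the range of `L`. As it is closed, their limits do too,
so the derivative lifts to `W`. -/
theorem IsCk.of_isClosedEmbedding (L : W →L[ℝ] Z) (hL : Topology.IsClosedEmbedding L) {k : ℕ} :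
    ∀ {V : Type v} [AddCommGroup V] [Module ℝ V] [TopologicalSpace V] [IsTopologicalAddGroup V]
    [ContinuousSMul ℝ V] {f : V → W} {U : Set V}, IsOpen U →
    IsCk Z k V (fun x => L (f x)) U → IsCk W k V f U := by
  classical
  induction k with
  | zero => exact fun _ h => hL.isInducing.continuousOn_iff.2 h
  | succ k ih =>
    rintro V _ _ _ _ _ f U hU ⟨hc, df, hd, hdf⟩
    have hmem : ∀ x ∈ U, ∀ v, ∃ y, L y = df (x, v) := by
      intro x hx v
      refine hL.isClosed_range.mem_of_tendsto (hd x hx v) (Filter.Eventually.of_forall fun t => ?_)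
      exact ⟨t⁻¹ • (f (x + t • v) - f x), by simp⟩
    choose! df' hdf' using hmem
    refine ⟨hL.isInducing.continuousOn_iff.2 hc, fun p => df' p.1 p.2, fun x hx v => ?_,
      ih (hU.prod isOpen_univ) (hdf.congr (hU.prod isOpen_univ) fun p hp => hdf' p.1 hp.1 p.2)⟩
    rw [hL.isInducing.tendsto_nhds_iff, hdf' x hx v]
    simpa [Function.comp_def] using hd x hx v

/-! Smooth maps -/

theorem IsSmoothOn.congr [IsTopologicalAddGroup V] [ContinuousSMul ℝ V] {f g : V → W} {U : Set V}
    (h : IsSmoothOn f U) (he : ∀ x ∈ U, g x = f x) : IsSmoothOn g U :=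
  ⟨h.1, fun k => (h.2 k).congr h.1 he⟩

theorem IsSmoothOn.mono {f : V → W} {U U' : Set V} (h : IsSmoothOn f U) (hU' : IsOpen U')
    (hs : U' ⊆ U) : IsSmoothOn f U' :=
  ⟨hU', fun k => (h.2 k).mono hs⟩

theorem IsSmoothOn.of_iff {f : V → W} {U U' : Set V} (h : IsSmoothOn f U)
    (e : ∀ x, x ∈ U ↔ x ∈ U') : IsSmoothOn f U' :=
  Set.ext e ▸ h

theorem IsSmoothOn.continuousOn {f : V → W} {U : Set V} (h : IsSmoothOn f U) : ContinuousOn f U :=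
  (h.2 0).continuousOn

theorem IsSmoothOn.of_locally [IsTopologicalAddGroup V] [ContinuousSMul ℝ V] [T2Space W]
    {f : V → W} {U : Set V} (h : ∀ x ∈ U, ∃ U', x ∈ U' ∧ U' ⊆ U ∧ IsSmoothOn f U') :
    IsSmoothOn f U := by
  refine ⟨isOpen_iff_mem_nhds.2 fun x hx => ?_, fun k => IsCk.of_locally fun x hx => ?_⟩
  · obtain ⟨U', hx', hs, hU'⟩ := h x hx
    exact Filter.mem_of_superset (hU'.1.mem_nhds hx') hs
  · obtain ⟨U', hx', hs, hU'⟩ := h x hx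
    exact ⟨U', hU'.1, hx', hs, hU'.2 k⟩

theorem IsSmoothOn.prodMk {f : V → W} {g : V → Z} {U U' : Set V} (hf : IsSmoothOn f U)
    (hg : IsSmoothOn g U') : IsSmoothOn (fun x => (f x, g x)) (U ∩ U') :=
  ⟨hf.1.inter hg.1, fun k => ((hf.2 k).mono Set.inter_subset_left).prodMk
    ((hg.2 k).mono Set.inter_subset_right)⟩

theorem IsSmoothOn.comp [IsTopologicalAddGroup V] [ContinuousSMul ℝ V] [IsTopologicalAddGroup W]
    [ContinuousSMul ℝ W] [IsTopologicalAddGroup Z] [ContinuousSMul ℝ Z] [LocallyConvexSpace ℝ Z]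
    {g : W → Z} {f : V → W} {U : Set V} {U' : Set W} (hg : IsSmoothOn g U')
    (hf : IsSmoothOn f U) : IsSmoothOn (fun x => g (f x)) (U ∩ f ⁻¹' U') :=
  have ho : IsOpen (U ∩ f ⁻¹' U') := hf.continuousOn.isOpen_inter_preimage hf.1 hg.1
  ⟨ho, fun k => (hg.2 k).comp hg.1 ((hf.2 k).mono Set.inter_subset_left) ho fun _ hx => hx.2⟩

theorem isSmoothOn_const (c : W) {U : Set V} (hU : IsOpen U) : IsSmoothOn (fun _ => c) U :=
  ⟨hU, fun k => isCk_const c k V U⟩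

theorem IsSmoothOn.comp_clm (L : Z →L[ℝ] V) {f : V → W} {U : Set V} (hf : IsSmoothOn f U) :
    IsSmoothOn (fun z => f (L z)) (L ⁻¹' U) :=
  ⟨hf.1.preimage L.continuous, fun k => (hf.2 k).comp_clm L⟩

theorem IsSmoothOn.of_isClosedEmbedding [IsTopologicalAddGroup V] [ContinuousSMul ℝ V]
    (L : W →L[ℝ] Z) (hL : Topology.IsClosedEmbedding L) {f : V → W} {U : Set V}
    (h : IsSmoothOn (fun x => L (f x)) U) : IsSmoothOn f U :=
  ⟨h.1, fun k => IsCk.of_isClosedEmbedding L hL h.1 (h.2 k)⟩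

/-! Fréchet spaces -/

instance (priority := 100) frechetSpace_of_normed (V : Type v) [NormedAddCommGroup V]
    [NormedSpace ℝ V] [CompleteSpace V] : FrechetSpace V where
  complete := by
    rw [IsUniformAddGroup.rightUniformSpace_eq]
    infer_instance

instance FrechetSpace.prod [FrechetSpace V] [FrechetSpace W] : FrechetSpace (V × W) where
  complete := by
    let := IsTopologicalAddGroup.rightUniformSpace V
    let := IsTopologicalAddGroup.rightUniformSpace W
    have : IsUniformAddGroup V := isUniformAddGroup_of_addCommGroup
    have : IsUniformAddGroup W := isUniformAddGroup_of_addCommGroup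
    have : CompleteSpace V := FrechetSpace.complete
    have : CompleteSpace W := FrechetSpace.complete
    rw [IsUniformAddGroup.rightUniformSpace_eq]
    infer_instance

theorem FrechetSpace.of_isClosedEmbedding [FrechetSpace W] (L : V →ₗ[ℝ] W)
    (hL : Topology.IsClosedEmbedding L) : FrechetSpace V := by
  have hind : ‹TopologicalSpace V› = TopologicalSpace.induced L inferInstance :=
    hL.isInducing.eq_induced
  have h1 : IsTopologicalAddGroup V := hL.isInducing.topologicalAddGroup L
  have h2 : ContinuousSMul ℝ V := hind ▸ continuousSMul_induced L.toMulActionHom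
  have h3 : LocallyConvexSpace ℝ V := hind ▸ LocallyConvexSpace.induced L
  have h4 : TopologicalSpace.MetrizableSpace V := hL.isEmbedding.metrizableSpace
  refine ⟨?_⟩
  let := IsTopologicalAddGroup.rightUniformSpace V
  let := IsTopologicalAddGroup.rightUniformSpace W
  have : IsUniformAddGroup V := isUniformAddGroup_of_addCommGroup
  have : IsUniformAddGroup W := isUniformAddGroup_of_addCommGroup
  have : CompleteSpace W := FrechetSpace.complete
  have hu : IsUniformInducing L := AddMonoidHom.isUniformInducing_of_isInducing hL.isInducing
  exact (completeSpace_iff_isComplete_range hu).2 hL.isClosed_range.isComplete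

end calculus

/-! ### Smooth maps between Fréchet manifolds -/

namespace Atlas

universe a b c a' b' c'

variable {M : Type a} {N : Type b} {P : Type c} {A : Atlas.{a, a'} M} {B : Atlas.{b, b'} N}
  {C : Atlas.{c, c'} P}

/-- A topological vector space as a manifold. -/
def ofModel (V : Type v) [AddCommGroup V] [Module ℝ V] [TopologicalSpace V] : Atlas.{v, v} V where
  model := V
  charts := {PartialEquiv.refl V}

instance instFrechetOfModel (V : Type v) [AddCommGroup V] [Module ℝ V] [TopologicalSpace V]
    [h : FrechetSpace V] : FrechetSpace (ofModel V).model := h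

theorem smoothMapOn_ofModel_left {V : Type v} [AddCommGroup V] [Module ℝ V] [TopologicalSpace V]
    {f : V → N} {S : Set V} : SmoothMapOn (ofModel V) B f S ↔
      ∀ ψ ∈ B.charts, IsSmoothOn (fun y => ψ (f y)) {y | y ∈ S ∧ f y ∈ ψ.source} := by
  constructor
  · intro h ψ hψ
    exact (h (PartialEquiv.refl V) rfl ψ hψ).of_iff fun y => ⟨fun h => h.2, fun h => ⟨trivial, h⟩⟩
  · rintro h φ rfl ψ hψ
    exact (h ψ hψ).of_iff fun y => ⟨fun h => ⟨trivial, h⟩, fun h => h.2⟩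

/-- The charts of `A` cover `M`. -/
def Covers (A : Atlas.{a, a'} M) : Prop := ∀ x : M, ∃ φ ∈ A.charts, x ∈ φ.source

theorem SmoothMapOn.congr [FrechetSpace A.model] {f g : M → N} {S : Set M}
    (h : SmoothMapOn A B f S) (he : ∀ x ∈ S, g x = f x) : SmoothMapOn A B g S := by
  intro φ hφ ψ hψ
  have hs : {y | y ∈ φ.target ∧ φ.symm y ∈ S ∧ g (φ.symm y) ∈ ψ.source} =
      {y | y ∈ φ.target ∧ φ.symm y ∈ S ∧ f (φ.symm y) ∈ ψ.source} := by
    ext y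
    refine and_congr_right fun _ => and_congr_right fun h => ?_
    rw [he _ h]
  rw [hs]
  exact (h φ hφ ψ hψ).congr fun y hy => by rw [he _ hy.2.1]

/-- The domain of a smooth map is open in charts. -/
theorem SmoothMapOn.isOpen {f : M → N} {S : Set M} (h : SmoothMapOn A B f S) (hB : B.Covers)
    {φ : PartialEquiv M A.model} (hφ : φ ∈ A.charts) :
    IsOpen {y | y ∈ φ.target ∧ φ.symm y ∈ S} := by
  refine isOpen_iff_mem_nhds.2 fun y hy => ?_
  obtain ⟨ψ, hψ, hy'⟩ := hB (f (φ.symm y))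
  exact Filter.mem_of_superset ((h φ hφ ψ hψ).1.mem_nhds ⟨hy.1, hy.2, hy'⟩)
    fun z hz => ⟨hz.1, hz.2.1⟩

/-- Near each point the composite is read through a chart of the middle manifold around the image
point. The charts of `B` must cover, but their compatibility plays no role. -/
theorem SmoothMapOn.comp [FrechetSpace A.model] [FrechetSpace B.model] [FrechetSpace C.model]
    (hB : B.Covers) {g : N → P} {f : M → N} {S : Set M} {T : Set N} (hg : SmoothMapOn B C g T)
    (hf : SmoothMapOn A B f S) : SmoothMapOn A C (fun x => g (f x)) (S ∩ f ⁻¹' T) := by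
  intro φ hφ ψ hψ
  refine IsSmoothOn.of_locally fun y hy => ?_
  obtain ⟨χ, hχ, hyχ⟩ := hB (f (φ.symm y))
  have h1 := (hg χ hχ ψ hψ).comp (hf φ hφ χ hχ)
  have h2 : ∀ z, f (φ.symm z) ∈ χ.source → (z ∈ (fun y => χ (f (φ.symm y))) ⁻¹'
      {y | y ∈ χ.target ∧ χ.symm y ∈ T ∧ g (χ.symm y) ∈ ψ.source} ↔
        f (φ.symm z) ∈ T ∧ g (f (φ.symm z)) ∈ ψ.source) := by
    intro z hz
    simp [hz]
  refine ⟨_, ?_, ?_, h1.congr ?_⟩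
  · exact ⟨⟨hy.1, hy.2.1.1, hyχ⟩, (h2 y hyχ).2 ⟨hy.2.1.2, hy.2.2⟩⟩
  · intro z hz
    have := (h2 z hz.1.2.2).1 hz.2
    exact ⟨hz.1.1, ⟨hz.1.2.1, this.1⟩, this.2⟩
  · intro z hz
    simp only [χ.left_inv hz.1.2.2]

theorem SmoothMap.comp [FrechetSpace A.model] [FrechetSpace B.model] [FrechetSpace C.model]
    (hB : B.Covers) {g : N → P} {f : M → N} (hg : SmoothMap B C g)
    (hf : SmoothMap A B f) : SmoothMap A C (fun x => g (f x)) := by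
  have := SmoothMapOn.comp hB hg hf
  rwa [Set.preimage_univ, Set.inter_univ] at this

theorem SmoothMapOn.prodMk {f : M → N} {g : M → P} {S S' : Set M} (hf : SmoothMapOn A B f S)
    (hg : SmoothMapOn A C g S') : SmoothMapOn A (B.prod C) (fun x => (f x, g x)) (S ∩ S') := by
  rintro φ hφ _ ⟨ψ, hψ, χ, hχ, rfl⟩
  exact IsSmoothOn.of_iff ((hf φ hφ ψ hψ).prodMk (hg φ hφ χ hχ)) fun y =>
    ⟨fun h => ⟨h.1.1, ⟨h.1.2.1, h.2.2.1⟩, h.1.2.2, h.2.2.2⟩,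
      fun h => ⟨⟨h.1, h.2.1.1, h.2.2.1⟩, h.1, h.2.1.2, h.2.2.2⟩⟩

theorem SmoothMap.prodMk {f : M → N} {g : M → P} (hf : SmoothMap A B f)
    (hg : SmoothMap A C g) : SmoothMap A (B.prod C) (fun x => (f x, g x)) := by
  have := SmoothMapOn.prodMk hf hg
  rwa [Set.inter_univ] at this

theorem IsFrechetManifold.covers (hA : A.IsFrechetManifold) : A.Covers := hA.cover

/-- Smoothness of the identity is the compatibility of charts; below, new manifolds are recognized
through this reformulation. -/
theorem IsFrechetManifold.smooth_id (hA : A.IsFrechetManifold) : SmoothMap A A (fun x => x) := by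
  intro φ hφ ψ hψ
  exact (hA.compatible φ hφ ψ hψ).of_iff fun y => ⟨fun h => ⟨h.1, trivial, h.2⟩, fun h => ⟨h.1, h.2.2⟩⟩

theorem smoothMap_const (hA : A.IsFrechetManifold) (_hB : B.IsFrechetManifold) (b : N) :
    SmoothMap A B (fun _ => b) := by
  have := hA.frechet
  intro φ hφ ψ hψ
  refine isSmoothOn_const (ψ b) ?_
  by_cases hb : b ∈ ψ.source
  · simpa [hb] using hA.isOpen_target φ hφ
  · simp [hb]

theorem SmoothMap.continuous {f : M → N} (hf : SmoothMap A B f)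
    (hB : B.IsFrechetManifold) : @Continuous M N A.manifoldTopology B.manifoldTopology f := by
  let := A.manifoldTopology
  let := B.manifoldTopology
  refine continuous_def.2 fun V hV => ?_
  have hV' : ∀ ψ ∈ B.charts, IsOpen {y | y ∈ ψ.target ∧ ψ.symm y ∈ V} := by
    intro ψ hψ
    have h1 := isOpen_iSup_iff.1 (isOpen_iSup_iff.1 hV ψ) hψ
    rw [isOpen_coinduced] at h1
    have h2 := (hB.isOpen_target ψ hψ).isOpenMap_subtype_val _ h1
    convert h2 using 1
    ext y
    simp [and_comm]
  change IsOpen[⨆ φ ∈ A.charts, _] _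
  refine isOpen_iSup_iff.2 fun φ => isOpen_iSup_iff.2 fun hφ => isOpen_coinduced.2 ?_
  suffices h : IsOpen {y | y ∈ φ.target ∧ f (φ.symm y) ∈ V} by
    convert h.preimage continuous_subtype_val using 1
    ext y
    simp
  refine isOpen_iff_mem_nhds.2 fun y hy => ?_
  obtain ⟨ψ, hψ, hyψ⟩ := hB.cover (f (φ.symm y))
  have h1 := hf φ hφ ψ hψ
  have h2 := h1.continuousOn.isOpen_inter_preimage h1.1 (hV' ψ hψ)
  refine Filter.mem_of_superset (h2.mem_nhds ⟨⟨hy.1, trivial, hyψ⟩, ?_⟩) ?_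
  · simp only [Set.mem_preimage, Set.mem_ofPred_eq, ψ.left_inv hyψ]
    exact ⟨ψ.map_source hyψ, hy.2⟩
  · rintro z ⟨⟨h3, -, h4⟩, h5⟩
    simp only [Set.mem_preimage, Set.mem_ofPred_eq, ψ.left_inv h4] at h5
    exact ⟨h3, h5.2⟩

/-- Continuity of maps from a manifold to a topological space can be checked in charts. -/
theorem continuous_of_charts {X : Type*} [TopologicalSpace X] {f : M → X}
    (h : ∀ φ ∈ A.charts, ContinuousOn (fun y => f (φ.symm y)) φ.target) :
    @Continuous M X A.manifoldTopology _ f := by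
  refine continuous_iSup_dom.2 fun φ => continuous_iSup_dom.2 fun hφ => continuous_coinduced_dom.2 ?_
  exact continuousOn_iff_continuous_domRestrict.1 (h φ hφ)

instance instFrechetProd [h : FrechetSpace A.model] [h' : FrechetSpace B.model] :
    FrechetSpace (A.prod B).model := FrechetSpace.prod (V := A.model) (W := B.model)

theorem Covers.prod (hA : A.Covers) (hB : B.Covers) : (A.prod B).Covers := by
  rintro ⟨x, y⟩
  obtain ⟨φ, hφ, hx⟩ := hA x
  obtain ⟨ψ, hψ, hy⟩ := hB y
  exact ⟨φ.prod ψ, ⟨φ, hφ, ψ, hψ, rfl⟩, hx, hy⟩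

theorem smooth_fst' (hA : SmoothMap A A (fun x => x))
    (hB : ∀ ψ ∈ B.charts, IsOpen ψ.target) : SmoothMap (A.prod B) A Prod.fst := by
  rintro _ ⟨φ, hφ, ψ, hψ, rfl⟩ χ hχ
  have h1 := (hA φ hφ χ hχ).comp_clm (ContinuousLinearMap.fst ℝ A.model B.model)
  have ho : IsOpen {y : A.model × B.model |
      y ∈ (φ.prod ψ).target ∧ (φ.prod ψ).symm y ∈ Set.univ ∧ ((φ.prod ψ).symm y).1 ∈ χ.source} := by
    have := h1.1.inter ((hB ψ hψ).preimage continuous_snd)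
    convert this using 1
    ext y
    simp
    tauto
  exact h1.mono ho fun y hy => ⟨hy.1.1, trivial, hy.2.2⟩

theorem smooth_snd' (hB : SmoothMap B B (fun x => x))
    (hA : ∀ ψ ∈ A.charts, IsOpen ψ.target) : SmoothMap (A.prod B) B Prod.snd := by
  rintro _ ⟨φ, hφ, ψ, hψ, rfl⟩ χ hχ
  have h1 := (hB ψ hψ χ hχ).comp_clm (ContinuousLinearMap.snd ℝ A.model B.model)
  have ho : IsOpen {y : A.model × B.model |
      y ∈ (φ.prod ψ).target ∧ (φ.prod ψ).symm y ∈ Set.univ ∧ ((φ.prod ψ).symm y).2 ∈ χ.source} := by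
    have := h1.1.inter ((hA φ hφ).preimage continuous_fst)
    convert this using 1
    ext y
    simp
    tauto
  exact h1.mono ho fun y hy => ⟨hy.1.2, trivial, hy.2.2⟩

theorem IsFrechetManifold.smooth_fst (hA : A.IsFrechetManifold) (hB : B.IsFrechetManifold) :
    SmoothMap (A.prod B) A Prod.fst := smooth_fst' hA.smooth_id hB.isOpen_target

theorem IsFrechetManifold.smooth_snd (hA : A.IsFrechetManifold) (hB : B.IsFrechetManifold) :
    SmoothMap (A.prod B) B Prod.snd := smooth_snd' hB.smooth_id hA.isOpen_target

/-- A criterion for an atlas to define a Fréchet manifold. -/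
theorem IsFrechetManifold.of_smooth_id (hF : FrechetSpace A.model) (hc : A.Covers)
    (hid : SmoothMap A A (fun x => x)) (ht : ∀ φ ∈ A.charts, IsOpen φ.target)
    (ht2 : @T2Space M A.manifoldTopology) : A.IsFrechetManifold where
  frechet := hF
  cover := hc
  isOpen_target := ht
  compatible φ hφ ψ hψ := by
    exact (hid φ hφ ψ hψ).of_iff fun y => ⟨fun h => ⟨h.1, h.2.2⟩, fun h => ⟨h.1, trivial, h.2⟩⟩
  t2 := ht2

/-- Smoothness includes openness of the domains in charts; a chart target is a union of such domains
once the charts cover. -/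
theorem smooth_id_isOpen_target (hid : SmoothMap A A (fun x => x)) (hc : A.Covers) :
    ∀ φ ∈ A.charts, IsOpen φ.target := by
  intro φ hφ
  have := SmoothMapOn.isOpen hid hc hφ
  simpa using this

theorem IsFrechetManifold.prod (hA : A.IsFrechetManifold) (hB : B.IsFrechetManifold) :
    (A.prod B).IsFrechetManifold := by
  have := hA.frechet
  have := hB.frechet
  have hid : SmoothMap (A.prod B) (A.prod B) (fun x => x) :=
    (hA.smooth_fst hB).prodMk (hA.smooth_snd hB)
  have hc : (A.prod B).Covers := hA.covers.prod hB.covers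
  refine .of_smooth_id inferInstance hc hid (smooth_id_isOpen_target hid hc) ?_
  let := A.manifoldTopology
  let := B.manifoldTopology
  let := (A.prod B).manifoldTopology
  have := hA.t2
  have := hB.t2
  refine ⟨fun x y hxy => ?_⟩
  by_cases h : x.1 = y.1
  · exact separated_by_continuous ((hA.smooth_snd hB).continuous hB) fun h' => hxy (Prod.ext h h')
  · exact separated_by_continuous ((hA.smooth_fst hB).continuous hA) h

/-- A manifold with an injective smooth map to a Hausdorff manifold is Hausdorff. -/
theorem SmoothMap.t2 {f : M → N} (hf : SmoothMap A B f) (hinj : Function.Injective f)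
    (hB : B.IsFrechetManifold) : @T2Space M A.manifoldTopology := by
  let := A.manifoldTopology
  let := B.manifoldTopology
  have := hB.t2
  exact ⟨fun x y hxy => separated_by_continuous (hf.continuous hB) (hinj.ne hxy)⟩

/-! Transport along bijections -/

instance instFrechetComapEquiv (e : P ≃ M) [h : FrechetSpace A.model] :
    FrechetSpace (A.comapEquiv e).model := h

theorem smoothMap_comapEquiv_right (e : P ≃ M) {f : N → P} :
    SmoothMap B (A.comapEquiv e) f ↔ SmoothMap B A (fun x => e (f x)) := by
  constructor
  · intro h φ hφ ψ hψ
    exact IsSmoothOn.of_iff (h φ hφ (e.toPartialEquiv.trans ψ) ⟨ψ, hψ, rfl⟩)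
      fun y => ⟨fun h => ⟨h.1, h.2.1, h.2.2.2⟩, fun h => ⟨h.1, h.2.1, trivial, h.2.2⟩⟩
  · rintro h φ hφ _ ⟨ψ, hψ, rfl⟩
    exact IsSmoothOn.of_iff (h φ hφ ψ hψ)
      fun y => ⟨fun h => ⟨h.1, h.2.1, trivial, h.2.2⟩, fun h => ⟨h.1, h.2.1, h.2.2.2⟩⟩

theorem smoothMap_comapEquiv_left (e : P ≃ M) {f : P → N} :
    SmoothMap (A.comapEquiv e) B f ↔ SmoothMap A B (fun x => f (e.symm x)) := by
  constructor
  · intro h φ hφ ψ hψ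
    exact IsSmoothOn.of_iff (h (e.toPartialEquiv.trans φ) ⟨φ, hφ, rfl⟩ ψ hψ)
      fun y => ⟨fun h => ⟨h.1.1, h.2⟩, fun h => ⟨⟨h.1, trivial⟩, h.2⟩⟩
  · rintro h _ ⟨φ, hφ, rfl⟩ ψ hψ
    exact IsSmoothOn.of_iff (h φ hφ ψ hψ)
      fun y => ⟨fun h => ⟨⟨h.1, trivial⟩, h.2⟩, fun h => ⟨h.1.1, h.2⟩⟩

theorem IsFrechetManifold.comapEquiv (e : P ≃ M) (hA : A.IsFrechetManifold) :
    (A.comapEquiv e).IsFrechetManifold := by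
  have := hA.frechet
  have he : SmoothMap (A.comapEquiv e) A e := by
    rw [smoothMap_comapEquiv_left]
    simpa using hA.smooth_id
  have hid : SmoothMap (A.comapEquiv e) (A.comapEquiv e) (fun x => x) :=
    (smoothMap_comapEquiv_right e).2 he
  have hc : (A.comapEquiv e).Covers := by
    intro x
    obtain ⟨φ, hφ, hx⟩ := hA.cover (e x)
    exact ⟨_, ⟨φ, hφ, rfl⟩, trivial, hx⟩
  exact .of_smooth_id inferInstance hc hid (smooth_id_isOpen_target hid hc) (he.t2 e.injective hA)

end Atlas

/-! ### Fréchet Lie groups -/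

namespace Atlas

theorem IsFrechetLieGroup.prod {K : Type u} {H : Type v} [Group K] [Group H] {A : Atlas.{u, w} K}
    {B : Atlas.{v, w'} H} (hA : A.IsFrechetLieGroup) (hB : B.IsFrechetLieGroup) :
    (A.prod B).IsFrechetLieGroup := by
  have h1 := hA.isFrechetManifold
  have h2 := hB.isFrechetManifold
  have h3 := h1.prod h2
  have := h1.frechet
  have := h2.frechet
  refine ⟨h3, ?_, ?_⟩
  · have p1 := h3.smooth_fst h3
    have p2 := h3.smooth_snd h3
    exact SmoothMap.prodMk
      (hA.smooth_mul.comp (h1.prod h1).covers (((h1.smooth_fst h2).comp h3.covers p1).prodMk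
        ((h1.smooth_fst h2).comp h3.covers p2)))
      (hB.smooth_mul.comp (h2.prod h2).covers (((h1.smooth_snd h2).comp h3.covers p1).prodMk
        ((h1.smooth_snd h2).comp h3.covers p2)))
  · exact SmoothMap.prodMk (hA.smooth_inv.comp h1.covers (h1.smooth_fst h2))
      (hB.smooth_inv.comp h2.covers (h1.smooth_snd h2))

theorem IsFrechetLieGroup.mul {K : Type u} {M : Type v} [Group K] {A : Atlas.{u, w} K}
    {B : Atlas.{v, w'} M} (hA : A.IsFrechetLieGroup) (hB : FrechetSpace B.model) {f g : M → K}
    (hf : SmoothMap B A f) (hg : SmoothMap B A g) : SmoothMap B A (fun x => f x * g x) := by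
  have := hA.isFrechetManifold.frechet
  exact hA.smooth_mul.comp (hA.isFrechetManifold.prod hA.isFrechetManifold).covers (hf.prodMk hg)

theorem IsFrechetLieGroup.inv {K : Type u} {M : Type v} [Group K] {A : Atlas.{u, w} K}
    {B : Atlas.{v, w'} M} (hA : A.IsFrechetLieGroup) (hB : FrechetSpace B.model) {f : M → K}
    (hf : SmoothMap B A f) : SmoothMap B A (fun x => (f x)⁻¹) := by
  have := hA.isFrechetManifold.frechet
  exact hA.smooth_inv.comp hA.isFrechetManifold.covers hf

/-- A group with the manifold structure induced by a homomorphism to a Lie group is a Lie group. -/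
theorem IsInduced.isFrechetLieGroup {K H : Type u} [Group K] [Group H] {B : Atlas.{u, u} K}
    {A : Atlas.{u, u} H} {j : K → H} (h : B.IsInduced A j) (hA : A.IsFrechetLieGroup)
    (hj : ∀ x y, j (x * y) = j x * j y) (hj' : ∀ x, j x⁻¹ = (j x)⁻¹) :
    B.IsFrechetLieGroup := by
  have hm := h.isFrechetManifold
  have := hm.frechet
  have := hA.isFrechetManifold.frechet
  refine ⟨hm, h.universal _ _ (hm.prod hm) _ ?_, h.universal _ _ hm _ ?_⟩
  · simp only [hj]
    exact hA.mul inferInstance (h.smooth.comp hm.covers (hm.smooth_fst hm))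
      (h.smooth.comp hm.covers (hm.smooth_snd hm))
  · simp only [hj']
    exact hA.inv inferInstance h.smooth

end Atlas

/-! ### Strict Lie 2-groups from split source maps -/

section ofMinimalData

variable {Γ₀ Γ₁ H : Type u} [Group Γ₀] [Group Γ₁] {A₀ : Atlas.{u, u} Γ₀} {A₁ : Atlas.{u, u} Γ₁}
  {s t : Γ₁ →* Γ₀} {i : Γ₀ →* Γ₁} {D : Atlas.{u, u} H}

/-- The group of pairs `(x, y)` with `s x = t y`. -/
abbrev pullbackGroup (s t : Γ₁ →* Γ₀) : Subgroup (Γ₁ × Γ₁) :=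
  (s.comp (MonoidHom.fst _ _)).eqLocus (t.comp (MonoidHom.snd _ _))

/-- If morphisms are diffeomorphic to `H × Γ₀`, the source map being the projection, then
composable pairs of morphisms are in bijection with `H × Γ₁`. -/
def composableEquiv (p : Γ₁ → H) (m : H × Γ₀ → Γ₁) (hpm : ∀ x, p (m x) = x.1)
    (hsm : ∀ x, s (m x) = x.2) (hmp : ∀ x, m (p x, s x) = x) :
    pullbackGroup s t ≃ H × Γ₁ where
  toFun x := (p x.1.1, x.1.2)
  invFun y := ⟨(m (y.1, t y.2), y.2), hsm (y.1, t y.2)⟩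
  left_inv := by
    rintro ⟨⟨x, y⟩, h⟩
    have h : s x = t y := h
    refine Subtype.ext (Prod.ext ?_ rfl)
    change m (p x, t y) = x
    rw [← h, hmp]
  right_inv y := Prod.ext (hpm _) rfl

/-- The splitting `Γ₁ ≅ H × Γ₀` identifies the fibre product with `H × Γ₁`, so no submersion
argument is needed. In these coordinates the inclusion is `(h, y) ↦ (m(h, t y), y)` and a map into
the fibre product is `(p x, y)`, both visibly smooth. -/
theorem isInduced_composable (h₀ : A₀.IsFrechetManifold) (h₁ : A₁.IsFrechetManifold)
    (hD : D.IsFrechetManifold) (ht : Atlas.SmoothMap A₁ A₀ t) {p : Γ₁ → H} {m : H × Γ₀ → Γ₁}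
    (hpm : ∀ x, p (m x) = x.1) (hsm : ∀ x, s (m x) = x.2) (hmp : ∀ x, m (p x, s x) = x)
    (hp : Atlas.SmoothMap A₁ D p) (hm : Atlas.SmoothMap (D.prod A₀) A₁ m) :
    ((D.prod A₁).comapEquiv (composableEquiv (t := t) p m hpm hsm hmp)).IsInduced (A₁.prod A₁) Subtype.val := by
  have := h₀.frechet
  have := h₁.frechet
  have := hD.frechet
  refine ⟨(hD.prod h₁).comapEquiv _, ?_, ?_⟩
  · rw [Atlas.smoothMap_comapEquiv_left]
    exact (hm.comp (hD.prod h₀).covers ((hD.smooth_fst h₁).prodMk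
      (ht.comp h₁.covers (hD.smooth_snd h₁)))).prodMk (hD.smooth_snd h₁)
  · intro W C hC h hh
    have := hC.frechet
    rw [Atlas.smoothMap_comapEquiv_right]
    exact (hp.comp h₁.covers ((h₁.smooth_fst h₁).comp (h₁.prod h₁).covers hh)).prodMk
      ((h₁.smooth_snd h₁).comp (h₁.prod h₁).covers hh)

/-- The groupoid identities follow from `hsi` and `hti` alone. The commutation of the kernels,
`hst`, enters only in `comp_mul` and `invMor_mul`; the splitting `(p, m)` enters only in the
manifold structure on composable pairs. -/
theorem isStrictLieTwoGroup_ofMinimalData (h₀ : A₀.IsFrechetLieGroup) (h₁ : A₁.IsFrechetLieGroup)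
    (hD : D.IsFrechetManifold) (hs : Atlas.SmoothMap A₁ A₀ s) (ht : Atlas.SmoothMap A₁ A₀ t)
    (hi : Atlas.SmoothMap A₀ A₁ i) (hsi : ∀ a, s (i a) = a) (hti : ∀ a, t (i a) = a)
    (hst : ∀ x y, s x = 1 → t y = 1 → x * y = y * x) {p : Γ₁ → H} {m : H × Γ₀ → Γ₁}
    (hpm : ∀ x, p (m x) = x.1) (hsm : ∀ x, s (m x) = x.2) (hmp : ∀ x, m (p x, s x) = x)
    (hp : Atlas.SmoothMap A₁ D p) (hm : Atlas.SmoothMap (D.prod A₀) A₁ m) :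
    (TwoGroupData.ofMinimalData A₀ A₁ s t i).IsStrictLieTwoGroup where
  lie_ob := h₀
  lie_mor := h₁
  smooth_s := hs
  smooth_t := ht
  smooth_i := hi
  s_i := hsi
  t_i := hti
  s_comp (x y : Γ₁) h := by
    change s (x * (i (s x))⁻¹ * y) = s y
    simp [hsi]
  t_comp (x y : Γ₁) h := by
    change t (x * (i (s x))⁻¹ * y) = t x
    have h : s x = t y := h
    simp [hti, h]
  comp_i (x : Γ₁) := by
    change x * (i (s x))⁻¹ * i (s x) = x
    simp
  i_comp (x : Γ₁) := by
    change i (t x) * (i (s (i (t x))))⁻¹ * x = x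
    simp [hsi]
  comp_assoc (x y z : Γ₁) h h' := by
    change (x * (i (s x))⁻¹ * y) * (i (s (x * (i (s x))⁻¹ * y)))⁻¹ * z =
      x * (i (s x))⁻¹ * (y * (i (s y))⁻¹ * z)
    simp [hsi, mul_assoc]
  s_invMor (x : Γ₁) := by
    change s (i (s x) * x⁻¹ * i (t x)) = t x
    simp [hsi]
  t_invMor (x : Γ₁) := by
    change t (i (s x) * x⁻¹ * i (t x)) = s x
    simp [hti]
  invMor_comp (x : Γ₁) := by
    change (i (s x) * x⁻¹ * i (t x)) * (i (s (i (s x) * x⁻¹ * i (t x))))⁻¹ * x = i (s x)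
    simp [hsi]
  comp_invMor (x : Γ₁) := by
    change x * (i (s x))⁻¹ * (i (s x) * x⁻¹ * i (t x)) = i (t x)
    simp [mul_assoc]
  comp_mul (x y x' y' : Γ₁) h h' := by
    change (x * x') * (i (s (x * x')))⁻¹ * (y * y') =
      (x * (i (s x))⁻¹ * y) * (x' * (i (s x'))⁻¹ * y')
    have h : s x = t y := h
    -- These are the two middle factors to be exchanged; the second has trivial target because `s x
    -- = t y`.
    have := hst (x' * (i (s x'))⁻¹) ((i (s x))⁻¹ * y) (by simp [hsi]) (by simp [hti, h])
    calc (x * x') * (i (s (x * x')))⁻¹ * (y * y')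
        = x * ((x' * (i (s x'))⁻¹) * ((i (s x))⁻¹ * y)) * y' := by simp [mul_assoc]
      _ = _ := by rw [this]; simp [mul_assoc]
  invMor_mul (x y : Γ₁) := by
    change i (s (x * y)) * (x * y)⁻¹ * i (t (x * y)) =
      (i (s x) * x⁻¹ * i (t x)) * (i (s y) * y⁻¹ * i (t y))
    have := hst (i (s y) * y⁻¹) (x⁻¹ * i (t x)) (by simp [hsi]) (by simp [hti])
    calc i (s (x * y)) * (x * y)⁻¹ * i (t (x * y))
        = i (s x) * ((i (s y) * y⁻¹) * (x⁻¹ * i (t x))) * i (t y) := by simp [mul_assoc]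
      _ = _ := by rw [this]; simp [mul_assoc]
  smooth_comp := by
    have hc := isInduced_composable h₀.isFrechetManifold h₁.isFrechetManifold hD ht hpm
      hsm hmp hp hm
    have hcm := hc.isFrechetManifold
    have h1 := h₁.isFrechetManifold
    have := h1.frechet
    have := hcm.frechet
    have := h₀.isFrechetManifold.frechet
    have p1 := (h1.smooth_fst h1).comp (h1.prod h1).covers hc.smooth
    have p2 := (h1.smooth_snd h1).comp (h1.prod h1).covers hc.smooth
    exact ⟨_, hc.isFrechetLieGroup (h₁.prod h₁) (fun _ _ => rfl) (fun _ => rfl), hc,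
      h₁.mul inferInstance (h₁.mul inferInstance p1 (h₁.inv inferInstance
        (hi.comp h₀.isFrechetManifold.covers (hs.comp h1.covers p1)))) p2⟩
  smooth_invMor := by
    have h0 := h₀.isFrechetManifold
    have h1 := h₁.isFrechetManifold
    have := h1.frechet
    have := h0.frechet
    have : Atlas.SmoothMap A₁ A₁ fun x => i (s x) * x⁻¹ * i (t x) :=
      h₁.mul inferInstance (h₁.mul inferInstance (hi.comp h0.covers hs) h₁.smooth_inv)
        (hi.comp h0.covers ht)
    exact this

end ofMinimalData

/-! ### The strict Lie 2-group of a crossed module -/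

namespace PrecrossedModule

variable {X : PrecrossedModule.{u}}

/-- The product manifold structure on the semidirect product. -/
abbrev morAtlas (X : PrecrossedModule.{u}) : Atlas.{u, u} (X.H ⋊[X.act] X.K) :=
  Atlas.comapEquiv SemidirectProduct.equivProd (X.atlasH.prod X.atlasK)

namespace IsLieCrossedModule

theorem smooth_left (hX : X.IsLieCrossedModule) :
    Atlas.SmoothMap X.morAtlas X.atlasH SemidirectProduct.left :=
  (Atlas.smoothMap_comapEquiv_left _).2
    (hX.lie_H.isFrechetManifold.smooth_fst hX.lie_K.isFrechetManifold)

theorem smooth_right (hX : X.IsLieCrossedModule) :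
    Atlas.SmoothMap X.morAtlas X.atlasK SemidirectProduct.right :=
  (Atlas.smoothMap_comapEquiv_left _).2
    (hX.lie_H.isFrechetManifold.smooth_snd hX.lie_K.isFrechetManifold)

theorem isFrechetManifold_morAtlas (hX : X.IsLieCrossedModule) : X.morAtlas.IsFrechetManifold :=
  (hX.lie_H.isFrechetManifold.prod hX.lie_K.isFrechetManifold).comapEquiv _

theorem isFrechetLieGroup_morAtlas (hX : X.IsLieCrossedModule) :
    X.morAtlas.IsFrechetLieGroup := by
  have hm := hX.isFrechetManifold_morAtlas
  have hH := hX.lie_H.isFrechetManifold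
  have hK := hX.lie_K.isFrechetManifold
  have := hm.frechet
  have := hH.frechet
  have := hK.frechet
  have l := hX.smooth_left
  have r := hX.smooth_right
  refine ⟨hm, (Atlas.smoothMap_comapEquiv_right _).2 ?_, (Atlas.smoothMap_comapEquiv_right _).2 ?_⟩
  · have l1 := l.comp hm.covers (hm.smooth_fst hm)
    have l2 := l.comp hm.covers (hm.smooth_snd hm)
    have r1 := r.comp hm.covers (hm.smooth_fst hm)
    have r2 := r.comp hm.covers (hm.smooth_snd hm)
    exact (hX.lie_H.mul inferInstance l1 (hX.smooth_act.comp (hK.prod hH).covers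
      (r1.prodMk l2))).prodMk (hX.lie_K.mul inferInstance r1 r2)
  · have r1 := hX.lie_K.inv inferInstance r
    exact (hX.smooth_act.comp (hK.prod hH).covers
      (r1.prodMk (hX.lie_H.inv inferInstance l))).prodMk r1

theorem isStrictLieTwoGroup (hX : X.IsLieCrossedModule) : X.toTwoGroup.IsStrictLieTwoGroup := by
  have hm := hX.isFrechetManifold_morAtlas
  have hH := hX.lie_H.isFrechetManifold
  have hK := hX.lie_K.isFrechetManifold
  have := hm.frechet
  have := hH.frechet
  have := hK.frechet
  refine isStrictLieTwoGroup_ofMinimalData (H := X.H) (D := X.atlasH) (p := SemidirectProduct.left)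
    (m := SemidirectProduct.equivProd.symm) hX.lie_K hX.isFrechetLieGroup_morAtlas hH
    hX.smooth_right ?_ ?_ (fun _ => rfl) (fun a => ?_) ?_ (fun _ => rfl) (fun _ => rfl)
    (fun _ => rfl) hX.smooth_left ?_
  · exact hX.lie_K.mul inferInstance (hX.smooth_t.comp hH.covers hX.smooth_left) hX.smooth_right
  · exact (Atlas.smoothMap_comapEquiv_right _).2 (Atlas.SmoothMap.prodMk
      (Atlas.smoothMap_const hK hH 1) hK.smooth_id)
  · simp [PrecrossedModule.target]
  · rintro ⟨h, g⟩ ⟨h', g'⟩ e e'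
    have e : g = 1 := e
    have e' : X.t h' * g' = 1 := e'
    have e'' : g' = (X.t h')⁻¹ := eq_inv_of_mul_eq_one_right e'
    subst e e''
    -- An element of the kernel of the target is `(h', t(h')⁻¹)`. The Peiffer identity for the
    -- inverse of `h'` computes how its second component acts on `h`.
    have := hX.peiffer h'⁻¹ h
    ext
    · rw [map_inv, map_inv] at this
      change h * X.act 1 h' = h' * X.act (X.t h')⁻¹ h
      rw [map_inv, this]
      simp [mul_assoc]
    · simp
  · exact (Atlas.smoothMap_comapEquiv_right _).2 (hH.prod hK).smooth_id

end IsLieCrossedModule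

end PrecrossedModule

/-! ### Fréchet spaces of curves -/

/-- Used to recognize the uniform limits of the successive derivatives as the derivatives of a
single smooth limit curve. -/
theorem contDiff_of_iteratedDerivs {E : Type*} [NormedAddCommGroup E] [NormedSpace ℝ E]
    {g : ℕ → ℝ → E} (h : ∀ n t, HasDerivAt (g n) (g (n + 1) t) t) :
    ContDiff ℝ ∞ (g 0) ∧ ∀ n, iteratedDeriv n (g 0) = g n := by
  have h1 : ∀ n, iteratedDeriv n (g 0) = g n := by
    intro n
    induction n with
    | zero => exact iteratedDeriv_zero
    | succ n ih =>
      rw [iteratedDeriv_succ, ih]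
      exact funext fun t => (h n t).deriv
  refine ⟨contDiff_of_differentiable_iteratedDeriv fun n _ => ?_, h1⟩
  rw [h1]
  exact fun t => (h n t).differentiableAt

instance frechetSpace_pi {E : Type*} [NormedAddCommGroup E] [NormedSpace ℝ E] [CompleteSpace E] :
    FrechetSpace (ℕ → E) where
  toMetrizableSpace := UniformSpace.metrizableSpace
  complete := by
    rw [IsUniformAddGroup.rightUniformSpace_eq]
    infer_instance

/-- A space of smooth curves with bounded derivatives that carries the topology of uniform
convergence of all derivatives and is closed under smooth limits is a Fréchet space. -/
theorem FrechetSpace.of_curves {E : Type*} [NormedAddCommGroup E] [NormedSpace ℝ E]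
    [CompleteSpace E] {V : Type v} [AddCommGroup V] [Module ℝ V] [TopologicalSpace V]
    (c : V →ₗ[ℝ] (ℝ → E)) (hc : Function.Injective c) (hs : ∀ ξ, ContDiff ℝ ∞ (c ξ))
    (hb : ∀ n ξ, ∃ C, ∀ t, ‖iteratedDeriv n (c ξ) t‖ ≤ C)
    (ht : ∀ (l : Filter V) η, l ≤ 𝓝 η ↔
      ∀ n, TendstoUniformly (fun ξ => iteratedDeriv n (c ξ)) (iteratedDeriv n (c η)) l)
    (hcl : ∀ (ξ : ℕ → V) (f : ℝ → E), ContDiff ℝ ∞ f →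
      (∀ n t, Filter.Tendsto (fun k => iteratedDeriv n (c (ξ k)) t) Filter.atTop
        (𝓝 (iteratedDeriv n f t))) → ∃ η, c η = f) :
    FrechetSpace V := by
  have hs' : ∀ (n : ℕ) ξ, ContDiffAt ℝ n (c ξ) = fun _ => True := fun n ξ => funext fun t =>
    eq_true ((hs ξ).contDiffAt.of_le (by exact_mod_cast le_top))
  have hsn : ∀ (n : ℕ) ξ t, ContDiffAt ℝ n (c ξ) t := fun n ξ t => by rw [hs']; trivial
  have hcont : ∀ n ξ, Continuous (iteratedDeriv n (c ξ)) := fun n ξ =>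
    (hs ξ).continuous_iteratedDeriv n (by exact_mod_cast le_top)
  -- Recording all derivatives embeds `V` into a countable product of Banach spaces, which is
  -- Fréchet. What remains is that the embedding is topological with closed range.
  let J : V →ₗ[ℝ] (ℕ → (ℝ →ᵇ E)) :=
    { toFun := fun ξ n => BoundedContinuousFunction.ofNormedAddCommGroup (iteratedDeriv n (c ξ))
        (hcont n ξ) (hb n ξ).choose (hb n ξ).choose_spec
      map_add' := fun ξ η => by
        funext n
        ext t
        simp only [map_add, Pi.add_apply, BoundedContinuousFunction.coe_add,
          BoundedContinuousFunction.coe_ofNormedAddCommGroup]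
        exact iteratedDeriv_add (hsn n ξ t) (hsn n η t)
      map_smul' := fun a ξ => by
        funext n
        ext t
        simp only [map_smul, Pi.smul_apply, BoundedContinuousFunction.coe_smul, RingHom.id_apply,
          BoundedContinuousFunction.coe_ofNormedAddCommGroup]
        exact iteratedDeriv_const_smul_field a (c ξ) }
  have hJ : ∀ ξ n t, J ξ n t = iteratedDeriv n (c ξ) t := fun _ _ _ => rfl
  have hind : Topology.IsInducing J := by
    refine Topology.isInducing_iff_nhds.2 fun η => ?_
    have key : ∀ l : Filter V, l ≤ 𝓝 η ↔ l ≤ Filter.comap J (𝓝 (J η)) := by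
      intro l
      rw [ht, ← Filter.tendsto_iff_comap, tendsto_pi_nhds]
      exact forall_congr' fun n => (BoundedContinuousFunction.tendsto_iff_tendstoUniformly
        (F := fun ξ => J ξ n) (f := J η n)).symm
    exact le_antisymm ((key _).1 le_rfl) ((key _).2 le_rfl)
  have hinj : Function.Injective J := by
    intro ξ η h
    refine hc (funext fun t => ?_)
    have := hJ ξ 0 t
    rw [h, hJ] at this
    simpa using this.symm
  refine FrechetSpace.of_isClosedEmbedding J ⟨⟨hind, hinj⟩, ?_⟩
  -- The product is metrizable, so sequences suffice. Uniform convergence of derivatives gives `(p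
  -- n)' = p (n + 1)` in the limit, and `hcl` brings the limit curve back into `V`.
  refine IsSeqClosed.isClosed fun {x p} hx hp => ?_
  choose ξ hξ using hx
  have hp' : ∀ n, TendstoUniformly (fun k => iteratedDeriv n (c (ξ k))) (p n) Filter.atTop := by
    intro n
    have := BoundedContinuousFunction.tendsto_iff_tendstoUniformly.1 (tendsto_pi_nhds.1 hp n)
    simp only [← hξ] at this
    exact this
  have hd : ∀ n t, HasDerivAt (p n) (p (n + 1) t) t := by
    intro n t
    refine hasDerivAt_of_tendstoUniformly (hp' (n + 1)) (Filter.Eventually.of_forall fun k y => ?_)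
      (fun y => (hp' n).tendsto_at y) t
    rw [iteratedDeriv_succ]
    exact ((hs (ξ k)).differentiable_iteratedDeriv n (by exact_mod_cast WithTop.coe_lt_top _)
      y).hasDerivAt
  obtain ⟨hp0, hpn⟩ := contDiff_of_iteratedDerivs hd
  obtain ⟨η, hη⟩ := hcl ξ (p 0) hp0 fun n t => by
    rw [hpn]
    exact (hp' n).tendsto_at t
  refine ⟨η, ?_⟩
  funext n
  ext t
  rw [hJ, hη, hpn]

/-- The derivatives vanish on the open set and are continuous. The closure is what matters: it gives
flatness at the end points of `[0, π]`. -/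
theorem iteratedDeriv_eq_zero_of_eq_const {E : Type*} [NormedAddCommGroup E] [NormedSpace ℝ E]
    {f : ℝ → E} (hf : ContDiff ℝ ∞ f) {n : ℕ} (hn : 1 ≤ n) {U : Set ℝ} (hU : IsOpen U) {x : E}
    (h : ∀ t ∈ U, f t = x) {t : ℝ} (ht : t ∈ closure U) : iteratedDeriv n f t = 0 := by
  have hc : IsClosed {t | iteratedDeriv n f t = 0} :=
    isClosed_singleton.preimage (hf.continuous_iteratedDeriv n (by exact_mod_cast le_top))
  refine closure_minimal (fun s hs => ?_) hc ht
  have he : f =ᶠ[𝓝 s] fun _ => x := Filter.mem_of_superset (hU.mem_nhds hs) h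
  have := he.iteratedDeriv_eq n
  rw [iteratedDeriv_const] at this
  simpa [show n ≠ 0 by omega] using this

/-! ### The model spaces of paths and loops. -/

section models

variable {E : Type u} [NormedAddCommGroup E] [NormedSpace ℝ E]

theorem PathModel.contDiff (ξ : PathModel E) : ContDiff ℝ ∞ (pathExt ξ.val) :=
  contMDiff_iff_contDiff.1 ξ.val_mem.1.contMDiff

theorem PathModel.pathExt_of_nonpos (ξ : PathModel E) {t : ℝ} (ht : t ≤ 0) :
    pathExt ξ.val t = 0 := by
  rw [pathExt_of_le _ ht, ξ.val_mem.2]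

theorem LoopModel.contDiff (ξ : LoopModel E) : ContDiff ℝ ∞ (fun t : ℝ => ξ.val (t : S1)) :=
  contMDiff_iff_contDiff.1 ξ.val_mem.1.smooth

/-- The projection `ℝ → [0, π]`. -/
noncomputable abbrev projPi : ℝ → Ipi := Set.projIcc 0 Real.pi Real.pi_pos.le

/-- Outside `[0, π]` the extended path is constant, so its higher derivatives vanish there, up to
and including the end points. Consequently bounds and uniform convergence on `[0, π]` extend to all
of `ℝ`. -/
theorem PathModel.iteratedDeriv_projPi (ξ : PathModel E) (n : ℕ) (t : ℝ) :
    iteratedDeriv n (pathExt ξ.val) t = iteratedDeriv n (pathExt ξ.val) (projPi t) := by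
  rcases Nat.eq_zero_or_pos n with rfl | hn
  · simp [pathExt, Set.IccExtend]
  have h0 : ∀ s ≤ 0, iteratedDeriv n (pathExt ξ.val) s = 0 := fun s hs =>
    iteratedDeriv_eq_zero_of_eq_const ξ.contDiff hn isOpen_Iio
      (fun t ht => pathExt_of_le ξ.val (le_of_lt ht)) (by rwa [closure_Iio])
  have h1 : ∀ s, Real.pi ≤ s → iteratedDeriv n (pathExt ξ.val) s = 0 := fun s hs =>
    iteratedDeriv_eq_zero_of_eq_const ξ.contDiff hn isOpen_Ioi
      (fun t ht => pathExt_of_ge ξ.val (le_of_lt ht)) (by rwa [closure_Ioi])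
  rcases le_total t 0 with h | h
  · rw [h0 t h, projPi, Set.projIcc_of_le_left _ h, h0 _ le_rfl]
  rcases le_total t Real.pi with h' | h'
  · rw [projPi, Set.projIcc_of_mem _ ⟨h, h'⟩]
  · rw [h1 t h', projPi, Set.projIcc_of_right_le _ h', h1 _ le_rfl]

theorem PathModel.iteratedDerivWithin_eq (ξ : PathModel E) (n : ℕ) {t : ℝ}
    (ht : t ∈ Set.Icc 0 Real.pi) :
    iteratedDerivWithin n (pathExt ξ.val) (Set.Icc 0 Real.pi) t =
      iteratedDeriv n (pathExt ξ.val) t :=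
  iteratedDerivWithin_eq_iteratedDeriv uniqueDiffOn_Ipi
    (ξ.contDiff.contDiffAt.of_le (by exact_mod_cast le_top)) ht

/-- Flatness makes the extension to `ℝ` smooth, so one-sided derivatives can be replaced by ordinary
ones; all later estimates use this form. -/
theorem PathModel.tendsto_iff {α : Type*} {l : Filter α} {ξ : α → PathModel E} {η : PathModel E} :
    Filter.Tendsto ξ l (𝓝 η) ↔ ∀ n, TendstoUniformlyOn
      (fun a => iteratedDeriv n (pathExt (ξ a).val)) (iteratedDeriv n (pathExt η.val)) l
      (Set.Icc 0 Real.pi) := by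
  rw [nhds_iInf, Filter.tendsto_iInf]
  refine forall_congr' fun n => ?_
  rw [nhds_induced, Filter.tendsto_comap_iff, UniformFun.tendsto_iff_tendstoUniformly,
    tendstoUniformlyOn_iff_tendstoUniformly_comp_coe]
  have h : ∀ ζ : PathModel E, (fun t : Ipi => iteratedDerivWithin n (pathExt ζ.val)
      (Set.Icc 0 Real.pi) t) = iteratedDeriv n (pathExt ζ.val) ∘ (fun t : Ipi => (t : ℝ)) :=
    fun ζ => funext fun t => ζ.iteratedDerivWithin_eq n t.2
  simp only [Function.comp_def, UniformFun.toFun_ofFun, h]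

theorem LoopModel.tendsto_iff {α : Type*} {l : Filter α} {ξ : α → LoopModel E} {η : LoopModel E} :
    Filter.Tendsto ξ l (𝓝 η) ↔ ∀ n, TendstoUniformly
      (fun a => iteratedDeriv n (fun t : ℝ => (ξ a).val (t : S1)))
      (iteratedDeriv n (fun t : ℝ => η.val (t : S1))) l := by
  rw [nhds_iInf, Filter.tendsto_iInf]
  refine forall_congr' fun n => ?_
  rw [nhds_induced, Filter.tendsto_comap_iff, UniformFun.tendsto_iff_tendstoUniformly]
  simp only [Function.comp_def, UniformFun.toFun_ofFun]

/-- Curves that are constant outside `[0, π]` define elements of the model space. -/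
theorem mem_pathSubmodule_of_curve {f : ℝ → E} (hf : ContDiff ℝ ∞ f) (h0 : ∀ t ≤ 0, f t = 0)
    (h1 : ∀ t, Real.pi ≤ t → f t = f Real.pi) : (fun t : Ipi => f t) ∈ pathSubmodule E := by
  have hext : ∀ t ∈ Set.Icc 0 Real.pi, pathExt (fun t : Ipi => f t) t = f t :=
    fun t ht => pathExt_of_mem _ ht
  have hflat : ∀ p ∈ Set.Icc 0 Real.pi, (∀ n, 1 ≤ n → iteratedDeriv n f p = 0) →
      FlatWithinAt 𝓘(ℝ, E) (pathExt fun t : Ipi => f t) (Set.Icc 0 Real.pi) p := by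
    intro p hp h
    refine FlatWithinAt.congr (γ := f) hp (fun n hn => ?_) hext
    simp only [extChartAt_model_space_eq_id, PartialEquiv.refl_coe, id]
    rw [iteratedDerivWithin_eq_iteratedDeriv uniqueDiffOn_Ipi
      (hf.contDiffAt.of_le (by exact_mod_cast le_top)) hp, h n hn]
  refine ⟨⟨hf.contMDiff.contMDiffOn.congr hext, hflat 0 zero_mem_Ipi fun n hn => ?_,
    hflat Real.pi pi_mem_Ipi fun n hn => ?_⟩, h0 0 le_rfl⟩
  · exact iteratedDeriv_eq_zero_of_eq_const hf hn isOpen_Iio (fun t ht => h0 t (le_of_lt ht))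
      (by simp)
  · exact iteratedDeriv_eq_zero_of_eq_const hf hn isOpen_Ioi (fun t ht => h1 t (le_of_lt ht))
      (by simp)

/-- The element of the model space defined by a curve that is constant outside `[0, π]`. -/
theorem exists_pathModel_of_curve {f : ℝ → E} (hf : ContDiff ℝ ∞ f) (h0 : ∀ t ≤ 0, f t = 0)
    (h1 : ∀ t, Real.pi ≤ t → f t = f Real.pi) : ∃ ξ : PathModel E, pathExt ξ.val = f := by
  refine ⟨PathModel.of _ (mem_pathSubmodule_of_curve hf h0 h1), funext fun t => ?_⟩
  rw [PathModel.val_of]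
  rcases le_total t 0 with h | h
  · rw [pathExt_of_le _ h, h0 0 le_rfl, h0 t h]
  rcases le_total t Real.pi with h' | h'
  · exact pathExt_of_mem _ ⟨h, h'⟩
  · rw [pathExt_of_ge _ h', h1 t h']

theorem pathExt_injective {X : Type*} : Function.Injective (pathExt : (Ipi → X) → ℝ → X) := by
  intro γ γ' h
  funext t
  have := congrFun h t
  rwa [pathExt_of_mem _ t.2, pathExt_of_mem _ t.2] at this

theorem bounded_of_factor {X : Type*} [TopologicalSpace X] [CompactSpace X] {f : ℝ → E}
    (hf : Continuous f) (p : ℝ → X) (q : X → ℝ) (hq : Continuous q) (h : ∀ t, f t = f (q (p t))) :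
    ∃ C, ∀ t, ‖f t‖ ≤ C := by
  obtain ⟨C, hC⟩ := (isCompact_range (hf.comp hq)).isBounded.exists_norm_le
  exact ⟨C, fun t => h t ▸ hC _ ⟨p t, rfl⟩⟩

instance frechetSpace_pathModel [CompleteSpace E] : FrechetSpace (PathModel E) := by
  refine FrechetSpace.of_curves (V := PathModel E) (E := E)
    { toFun := fun ξ => pathExt ξ.val, map_add' := fun _ _ => rfl, map_smul' := fun _ _ => rfl }
    (fun ξ η h => PathModel.ext' (pathExt_injective h)) (fun ξ => ξ.contDiff)
    (fun n ξ => ?_) (fun l η => ?_) (fun ξ f hf h => ?_)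
  · exact bounded_of_factor (ξ.contDiff.continuous_iteratedDeriv n (by exact_mod_cast le_top))
      projPi Subtype.val continuous_subtype_val fun t => ξ.iteratedDeriv_projPi n t
  · have := PathModel.tendsto_iff (l := l) (ξ := id) (η := η)
    rw [Filter.tendsto_id'] at this
    rw [this]
    refine forall_congr' fun n => ⟨fun h => ?_, fun h => h.tendstoUniformlyOn⟩
    intro u hu
    filter_upwards [h u hu] with ζ hζ t
    have := hζ _ (projPi t).2
    rwa [id_eq, ← ζ.iteratedDeriv_projPi, ← η.iteratedDeriv_projPi] at this
  · have h0 : ∀ t, Filter.Tendsto (fun k => pathExt (ξ k).val t) Filter.atTop (𝓝 (f t)) := by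
      intro t
      have := h 0 t
      simp only [iteratedDeriv_zero] at this
      exact this
    refine exists_pathModel_of_curve hf (fun t ht => ?_) fun t ht => ?_
    · refine tendsto_nhds_unique (h0 t) ?_
      simp [PathModel.pathExt_of_nonpos _ ht]
    · refine tendsto_nhds_unique (h0 t) ((h0 Real.pi).congr fun k => ?_)
      rw [pathExt_of_ge _ le_rfl, pathExt_of_ge _ ht]

theorem iteratedDeriv_periodic {f : ℝ → E} {c : ℝ} (hf : Function.Periodic f c) (n : ℕ) :
    Function.Periodic (iteratedDeriv n f) c := fun t => by
  have := iteratedDeriv_comp_add_const n f c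
  rw [show (fun z => f (z + c)) = f from funext hf] at this
  exact (congrFun this t).symm

theorem LoopModel.periodic (ξ : LoopModel E) :
    Function.Periodic (fun t : ℝ => ξ.val (t : S1)) (2 * Real.pi) := fun t => by
  simp only [AddCircle.coe_add_period]

/-- Periodic curves that vanish to infinite order at `0` define elements of the model space. -/
theorem exists_loopModel_of_curve {f : ℝ → E} (hf : ContDiff ℝ ∞ f)
    (hp : Function.Periodic f (2 * Real.pi)) (h0 : ∀ n, iteratedDeriv n f 0 = 0) :
    ∃ ξ : LoopModel E, ∀ t : ℝ, ξ.val (t : S1) = f t := by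
  refine ⟨LoopModel.of (hp.lift : S1 → E) ⟨⟨?_, fun n _ => ?_⟩, ?_⟩, fun t => rfl⟩
  · exact hf.contMDiff
  · simp only [extChartAt_model_space_eq_id, PartialEquiv.refl_coe, id, iteratedDerivWithin_univ]
    exact h0 n
  · have := h0 0
    rw [iteratedDeriv_zero] at this
    exact this

instance frechetSpace_loopModel [CompleteSpace E] : FrechetSpace (LoopModel E) := by
  refine FrechetSpace.of_curves (V := LoopModel E) (E := E)
    { toFun := fun ξ t => ξ.val (t : S1), map_add' := fun _ _ => rfl, map_smul' := fun _ _ => rfl }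
    (fun ξ η h => LoopModel.ext' (funext fun x => ?_)) (fun ξ => ξ.contDiff)
    (fun n ξ => ?_) (fun l η => ?_) (fun ξ f hf h => ?_)
  · obtain ⟨t, rfl⟩ := QuotientAddGroup.mk_surjective x
    exact congrFun h t
  · obtain ⟨C, hC⟩ := (isCompact_Icc (a := 0) (b := 0 + 2 * Real.pi)).exists_bound_of_continuousOn
      (ξ.contDiff.continuous_iteratedDeriv n (by exact_mod_cast le_top)).continuousOn
    refine ⟨C, fun t => ?_⟩
    obtain ⟨s, hs, he⟩ := (iteratedDeriv_periodic ξ.periodic n).exists_mem_Ico Real.two_pi_pos t 0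
    have := hC s ⟨hs.1, hs.2.le⟩
    rwa [← he] at this
  · have := LoopModel.tendsto_iff (l := l) (ξ := id) (η := η)
    rw [Filter.tendsto_id'] at this
    exact this
  · have h0 : ∀ n t, Filter.Tendsto (fun k => iteratedDeriv n (fun t : ℝ => (ξ k).val (t : S1)) t)
        Filter.atTop (𝓝 (iteratedDeriv n f t)) := h
    have h1 : ∀ t : ℝ, Filter.Tendsto (fun k => (ξ k).val (t : S1)) Filter.atTop (𝓝 (f t)) := by
      intro t
      have := h0 0 t
      simp only [iteratedDeriv_zero] at this
      exact this
    have hper : Function.Periodic f (2 * Real.pi) := fun t =>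
      tendsto_nhds_unique (h1 _) ((h1 t).congr fun k => ((ξ k).periodic t).symm)
    have hzero : ∀ n, iteratedDeriv n f 0 = 0 := by
      intro n
      refine tendsto_nhds_unique (h0 n 0) (tendsto_const_nhds.congr fun k => ?_)
      rcases Nat.eq_zero_or_pos n with rfl | hn
      · simpa using (ξ k).val_mem.2.symm
      · have := (ξ k).val_mem.1.flat_zero n hn
        simp only [extChartAt_model_space_eq_id, PartialEquiv.refl_coe, id,
          iteratedDerivWithin_univ] at this
        exact this.symm
    obtain ⟨η, hη⟩ := exists_loopModel_of_curve hf hper hzero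
    exact ⟨η, funext hη⟩

/-! Loops supported in the upper half circle -/

variable (E) in
/-- The space of loops that vanish outside the upper half circle. -/
def halfSubmodule : Submodule ℝ (LoopModel E) where
  carrier := {ξ | ∀ t, t ∉ upperHalf → ξ.val t = 0}
  zero_mem' _ _ := rfl
  add_mem' {ξ η} hξ hη t ht := by
    change ξ.val t + η.val t = 0
    rw [hξ t ht, hη t ht, add_zero]
  smul_mem' c ξ hξ t ht := by
    change c • ξ.val t = 0
    rw [hξ t ht, smul_zero]

theorem LoopModel.continuous_eval (x : S1) : Continuous fun ξ : LoopModel E => ξ.val x := by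
  obtain ⟨t, rfl⟩ := QuotientAddGroup.mk_surjective x
  refine continuous_iff_continuousAt.2 fun η => ?_
  have := (LoopModel.tendsto_iff (l := 𝓝 η) (ξ := id) (η := η)).1 Filter.tendsto_id 0
  simpa [ContinuousAt] using this.tendsto_at t

theorem PathModel.continuous_eval (t : Ipi) : Continuous fun ξ : PathModel E => ξ.val t := by
  refine continuous_iff_continuousAt.2 fun η => ?_
  have := (PathModel.tendsto_iff (l := 𝓝 η) (ξ := id) (η := η)).1 Filter.tendsto_id 0
  have h := this.tendsto_at t.2
  simpa [pathExt_of_mem _ t.2, ContinuousAt] using h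

theorem isClosed_halfSubmodule : IsClosed (halfSubmodule E : Set (LoopModel E)) := by
  have : (halfSubmodule E : Set (LoopModel E)) =
      ⋂ (t : S1) (_ : t ∉ upperHalf), {ξ | ξ.val t = 0} := by
    ext ξ
    simp only [Set.mem_iInter]
    exact Iff.rfl
  rw [this]
  exact isClosed_iInter fun t => isClosed_iInter fun _ =>
    isClosed_singleton.preimage (LoopModel.continuous_eval t)

instance frechetSpace_half [CompleteSpace E] : FrechetSpace (halfSubmodule E) :=
  FrechetSpace.of_isClosedEmbedding (halfSubmodule E).subtype
    isClosed_halfSubmodule.isClosedEmbedding_subtypeVal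

theorem coe_notMem_upperHalf {t : ℝ} (h0 : Real.pi ≤ t) (h1 : t ≤ 2 * Real.pi) :
    (t : S1) ∉ upperHalf := by
  have hπ := Real.pi_pos
  rintro ⟨r, hr, hrt⟩
  rcases h1.lt_or_eq with h1 | h1
  · have := (AddCircle.coe_eq_coe_iff_of_mem_Ico (p := 2 * Real.pi) (a := 0)
      ⟨hr.1.le, by linarith [hr.2]⟩ ⟨by linarith, by linarith⟩).1 hrt
    linarith [hr.2]
  · rw [h1, AddCircle.coe_period, ← AddCircle.coe_zero] at hrt
    have := (AddCircle.coe_eq_coe_iff_of_mem_Ico (p := 2 * Real.pi) (a := 0)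
      ⟨hr.1.le, by linarith [hr.2]⟩ ⟨le_rfl, by linarith⟩).1 hrt
    linarith [hr.1]

theorem half_restrict_mem (ξ : halfSubmodule E) :
    (fun t : Ipi => ξ.1.val ((t : ℝ) : S1)) ∈ pathSubmodule E := by
  have hsm := ξ.1.val_mem.1.smooth
  have hπ := Real.pi_pos
  refine ⟨⟨hsm.contMDiffOn.congr fun t ht => pathExt_of_mem _ ht, ?_, ?_⟩, ?_⟩
  · refine FlatWithinAt.congr (γ := fun t : ℝ => ξ.1.val (t : S1)) zero_mem_Ipi ?_
      fun t ht => pathExt_of_mem _ ht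
    rw [flatWithinAt_iff_univ uniqueDiffOn_Ipi zero_mem_Ipi (hsm 0)]
    exact ξ.1.val_mem.1.flat_zero
  · refine FlatWithinAt.congr (γ := fun t : ℝ => ξ.1.val (t : S1)) pi_mem_Ipi ?_
      fun t ht => pathExt_of_mem _ ht
    have hm : Real.pi ∈ Set.Icc Real.pi (2 * Real.pi) := ⟨le_rfl, by linarith⟩
    rw [flatWithinAt_iff_univ uniqueDiffOn_Ipi pi_mem_Ipi (hsm _),
      -- For a smooth curve flatness at `π` may be tested from either side; on `[π, 2π]` the loop
      -- vanishes.
      ← flatWithinAt_iff_univ (uniqueDiffOn_Icc (by linarith)) hm (hsm _)]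
    exact (flatWithinAt_const (0 : E)).congr hm fun t ht => ξ.2 _ (coe_notMem_upperHalf ht.1 ht.2)
  · simpa using ξ.1.val_mem.2

variable (E) in
/-- Restriction of loops supported in the upper half circle to `[0, π]`. -/
noncomputable def halfRestrict : halfSubmodule E →L[ℝ] PathModel E where
  toFun ξ := PathModel.of _ (half_restrict_mem ξ)
  map_add' _ _ := rfl
  map_smul' _ _ := rfl
  cont := by
    refine continuous_iff_continuousAt.2 fun η => PathModel.tendsto_iff.2 fun n => ?_
    have h := LoopModel.tendsto_iff.1 (continuous_subtype_val.tendsto η) n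
    have e : ∀ ζ : halfSubmodule E, Set.EqOn
        (iteratedDeriv n fun t : ℝ => ζ.1.val (t : S1))
        (iteratedDeriv n (pathExt (PathModel.of _ (half_restrict_mem ζ)).val))
        (Set.Icc 0 Real.pi) := by
      intro ζ t ht
      rw [← PathModel.iteratedDerivWithin_eq _ n ht, ← iteratedDerivWithin_eq_iteratedDeriv
        uniqueDiffOn_Ipi (ζ.1.contDiff.contDiffAt.of_le (by exact_mod_cast le_top)) ht]
      refine iteratedDerivWithin_congr (fun s hs => ?_) ht
      rw [PathModel.val_of, pathExt_of_mem _ hs]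
    exact (h.tendstoUniformlyOn.congr (Filter.Eventually.of_forall e)).congr_right (e η)

end models

/-! ### Superposition operators on spaces of curves -/

section curves

variable {Y : Type w} [NormedAddCommGroup Y] [NormedSpace ℝ Y]

theorem iteratedDeriv_prodMk {X : Type u} [NormedAddCommGroup X] [NormedSpace ℝ X] {f : ℝ → X}
    {g : ℝ → Y} (hf : ContDiff ℝ ∞ f) (hg : ContDiff ℝ ∞ g) (n : ℕ) :
    iteratedDeriv n (fun t => (f t, g t)) = fun t => (iteratedDeriv n f t, iteratedDeriv n g t) := by
  induction n with
  | zero => simp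
  | succ n ih =>
    funext t
    rw [iteratedDeriv_succ, ih, iteratedDeriv_succ, iteratedDeriv_succ]
    have h1 := (hf.differentiable_iteratedDeriv n (by exact_mod_cast WithTop.coe_lt_top _) t).hasDerivAt
    have h2 := (hg.differentiable_iteratedDeriv n (by exact_mod_cast WithTop.coe_lt_top _) t).hasDerivAt
    exact (h1.prodMk h2).deriv

theorem tendstoUniformlyOn_prodMk {X : Type u} [NormedAddCommGroup X] {α : Type*}
    {l : Filter α} {K : Set ℝ} {f : α → ℝ → X} {g : α → ℝ → Y} {f' : ℝ → X} {g' : ℝ → Y}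
    (hf : TendstoUniformlyOn f f' l K) (hg : TendstoUniformlyOn g g' l K) :
    TendstoUniformlyOn (fun a t => (f a t, g a t)) (fun t => (f' t, g' t)) l K := by
  rw [Metric.tendstoUniformlyOn_iff] at *
  intro ε hε
  filter_upwards [hf ε hε, hg ε hε] with a h1 h2 t ht
  exact max_lt (h1 t ht) (h2 t ht)

variable {X : Type u} [NormedAddCommGroup X] [NormedSpace ℝ X] {F : X → Y} {Ω : Set X}

/-- The tangent map `(x, v) ↦ DF(x) v`. -/
noncomputable def tangentFun (F : X → Y) (p : X × X) : Y := fderiv ℝ F p.1 p.2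

theorem contDiffOn_tangentFun (hΩ : IsOpen Ω) (hF : ContDiffOn ℝ ∞ F Ω) :
    ContDiffOn ℝ ∞ (tangentFun F) (Ω ×ˢ Set.univ) :=
  ((hF.fderiv_of_isOpen hΩ (by simp)).comp contDiff_fst.contDiffOn fun _ hp => hp.1).clm_apply
    contDiff_snd.contDiffOn

theorem hasDerivAt_comp_curve (hΩ : IsOpen Ω) (hF : ContDiffOn ℝ ∞ F Ω) {c : ℝ → X}
    (hc : ContDiff ℝ ∞ c) {t : ℝ} (ht : c t ∈ Ω) :
    HasDerivAt (fun s => F (c s)) (tangentFun F (c t, deriv c t)) t :=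
  ((hF.differentiableOn (by simp) _ ht).differentiableAt (hΩ.mem_nhds ht)).hasFDerivAt.comp_hasDerivAt
    t (hc.differentiable (by simp) t).hasDerivAt

theorem eventually_mem_of_continuous (hΩ : IsOpen Ω) {c : ℝ → X} (hc : Continuous c) {t : ℝ}
    (ht : c t ∈ Ω) : ∀ᶠ s in 𝓝 t, c s ∈ Ω :=
  hc.continuousAt.eventually (hΩ.mem_nhds ht)

/-- One time derivative is traded for replacing `F` by its tangent map and `c` by `(c, c')`. This
replaces any formula for higher derivatives of a composite. -/
theorem iteratedDeriv_succ_comp (hΩ : IsOpen Ω) (hF : ContDiffOn ℝ ∞ F Ω) {c : ℝ → X}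
    (hc : ContDiff ℝ ∞ c) {t : ℝ} (ht : c t ∈ Ω) (n : ℕ) :
    iteratedDeriv (n + 1) (fun s => F (c s)) t =
      iteratedDeriv n (fun s => tangentFun F (c s, deriv c s)) t := by
  rw [iteratedDeriv_succ']
  refine Filter.EventuallyEq.iteratedDeriv_eq n ?_
  filter_upwards [eventually_mem_of_continuous hΩ hc.continuous ht] with s hs
  exact (hasDerivAt_comp_curve hΩ hF hc hs).deriv

theorem contDiff_deriv {c : ℝ → X} (hc : ContDiff ℝ ∞ c) : ContDiff ℝ ∞ (deriv c) :=
  (contDiff_infty_iff_deriv.1 hc).2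

theorem eventually_forall_mem {α : Type*} {l : Filter α} {K : Set ℝ} (hΩ : IsOpen Ω) {c : ℝ → X}
    (hc : Continuous c) {cs : α → ℝ → X} (hK : IsCompact K) (hm : ∀ t ∈ K, c t ∈ Ω)
    (h : TendstoUniformlyOn cs c l K) : ∀ᶠ a in l, ∀ t ∈ K, cs a t ∈ Ω := by
  obtain ⟨δ, hδ, hs⟩ := (hK.image hc).exists_thickening_subset_open hΩ (Set.image_subset_iff.2 hm)
  filter_upwards [Metric.tendstoUniformlyOn_iff.1 h δ hδ] with a ha t ht
  refine hs (Metric.mem_thickening_iff.2 ⟨c t, ⟨t, ht, rfl⟩, ?_⟩)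
  rw [dist_comm]
  exact ha t ht

/-- Induction on `n` through `iteratedDeriv_succ_comp`. The hypothesis on all derivatives of `cs` is
inherited by the pairs `(cs, cs')`; the space `X` is quantified inside because it becomes `X × X`.
-/
theorem tendstoUniformlyOn_iteratedDeriv_comp {α : Type*} {l : Filter α} {K : Set ℝ}
    (hK : IsCompact K) (n : ℕ) : ∀ {X : Type u} [NormedAddCommGroup X] [NormedSpace ℝ X]
    {F : X → Y} {Ω : Set X}, IsOpen Ω → ContDiffOn ℝ ∞ F Ω → ∀ {c : ℝ → X}, ContDiff ℝ ∞ c →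
    ∀ {cs : α → ℝ → X}, (∀ a, ContDiff ℝ ∞ (cs a)) → (∀ t ∈ K, c t ∈ Ω) →
    (∀ j, TendstoUniformlyOn (fun a => iteratedDeriv j (cs a)) (iteratedDeriv j c) l K) →
    TendstoUniformlyOn (fun a => iteratedDeriv n (fun t => F (cs a t)))
      (iteratedDeriv n (fun t => F (c t))) l K := by
  induction n with
  | zero =>
    intro X _ _ F Ω hΩ hF c hc cs hcs hm h
    simp only [iteratedDeriv_zero]
    have h0 := h 0
    simp only [iteratedDeriv_zero] at h0
    intro r hr
    -- Only one of the two points compared has to lie in the compact image of `c`; the other is a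
    -- value of `cs a`.
    have h1 := (hK.image hc.continuous).uniformContinuousAt_of_continuousAt F (fun x hx => by
      obtain ⟨t, ht, rfl⟩ := hx
      exact hF.continuousOn.continuousAt (hΩ.mem_nhds (hm t ht))) hr
    filter_upwards [h0 _ h1] with a ha t ht
    exact ha t ht ⟨t, ht, rfl⟩
  | succ n ih =>
    intro X _ _ F Ω hΩ hF c hc cs hcs hm h
    have h0 := h 0
    simp only [iteratedDeriv_zero] at h0
    have h1 := ih (hΩ.prod isOpen_univ) (contDiffOn_tangentFun hΩ hF)
      (c := fun t => (c t, deriv c t)) (hc.prodMk (contDiff_deriv hc))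
      (cs := fun a t => (cs a t, deriv (cs a) t)) (fun a => (hcs a).prodMk (contDiff_deriv (hcs a)))
      (fun t ht => ⟨hm t ht, trivial⟩) (fun j => by
        rw [iteratedDeriv_prodMk hc (contDiff_deriv hc)]
        simp only [fun a => iteratedDeriv_prodMk (hcs a) (contDiff_deriv (hcs a)) j]
        have := h (j + 1)
        simp only [iteratedDeriv_succ'] at this
        exact tendstoUniformlyOn_prodMk (h j) this)
    refine (h1.congr ?_).congr_right fun t ht => (iteratedDeriv_succ_comp hΩ hF hc (hm t ht) n).symm
    filter_upwards [eventually_forall_mem hΩ hc.continuous hK hm h0] with a ha t ht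
    exact (iteratedDeriv_succ_comp hΩ hF (hcs a) (ha t ht) n).symm

theorem tendstoUniformlyOn_add_smul {K : Set ℝ} (hK : IsCompact K) {c v : ℝ → X}
    (hv : Continuous v) :
    TendstoUniformlyOn (fun (s : ℝ) t => c t + s • v t) c (𝓝[≠] 0) K := by
  obtain ⟨C, hC⟩ := hK.exists_bound_of_continuousOn hv.continuousOn
  rw [Metric.tendstoUniformlyOn_iff]
  intro ε hε
  have hpos : 0 < |C| + 1 := by positivity
  have h1 : Metric.ball (0 : ℝ) (ε / (|C| + 1)) ∈ 𝓝[≠] (0 : ℝ) :=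
    mem_nhdsWithin_of_mem_nhds (Metric.ball_mem_nhds _ (by positivity))
  filter_upwards [h1] with s hs t ht
  rw [dist_self_add_right, norm_smul]
  rw [mem_ball_zero_iff, lt_div_iff₀ hpos] at hs
  refine lt_of_le_of_lt ?_ hs
  gcongr
  linarith [hC t ht, le_abs_self C]

/-- The mean value inequality for `F` minus its linear part at `c t`, on a ball whose radius does
not depend on `t ∈ K`: the image of `K` is compact and `DF` is uniformly continuous along it. -/
theorem tendstoUniformlyOn_slope {K : Set ℝ} (hK : IsCompact K) (hΩ : IsOpen Ω)
    (hF : ContDiffOn ℝ ∞ F Ω) {c v : ℝ → X} (hc : Continuous c) (hv : Continuous v)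
    (hm : ∀ t ∈ K, c t ∈ Ω) :
    TendstoUniformlyOn (fun (s : ℝ) t => s⁻¹ • (F (c t + s • v t) - F (c t)))
      (fun t => tangentFun F (c t, v t)) (𝓝[≠] 0) K := by
  obtain ⟨C, hC⟩ := hK.exists_bound_of_continuousOn hv.continuousOn
  rw [Metric.tendstoUniformlyOn_iff]
  intro ε hε
  -- `|C| + 1` is positive and strictly bounds `‖v t‖` on `K`; allowing `DF` an oscillation of `ε /
  -- (|C| + 1)` therefore leaves an error strictly below `ε`.
  have hpos : 0 < |C| + 1 := by positivity
  obtain ⟨δ, hδ, hs⟩ := (hK.image hc).exists_thickening_subset_open hΩ (Set.image_subset_iff.2 hm)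
  have hFc : ContinuousOn (fderiv ℝ F) Ω := (hF.fderiv_of_isOpen hΩ (m := ∞) (by simp)).continuousOn
  obtain ⟨δ', hδ', h1⟩ := Metric.mem_uniformity_dist.1
    ((hK.image hc).uniformContinuousAt_of_continuousAt (fderiv ℝ F) (fun x hx => by
      obtain ⟨t, ht, rfl⟩ := hx
      exact hFc.continuousAt (hΩ.mem_nhds (hm t ht)))
      (Metric.dist_mem_uniformity (show 0 < ε / (|C| + 1) by positivity)))
  have h2 := Metric.tendstoUniformlyOn_iff.1 (tendstoUniformlyOn_add_smul (c := c) hK hv)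
    (min δ δ') (lt_min hδ hδ')
  filter_upwards [h2, self_mem_nhdsWithin] with s hs2 hs0 t ht
  have hs0 : s ≠ 0 := hs0
  have hvt : ‖v t‖ < |C| + 1 := by linarith [hC t ht, le_abs_self C]
  have hball : ∀ x ∈ Metric.ball (c t) (min δ δ'), x ∈ Ω ∧
      ‖fderiv ℝ F x - fderiv ℝ F (c t)‖ ≤ ε / (|C| + 1) := by
    intro x hx
    refine ⟨hs (Metric.mem_thickening_iff.2 ⟨c t, ⟨t, ht, rfl⟩,
      lt_of_lt_of_le hx (min_le_left _ _)⟩), ?_⟩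
    have := @h1 (c t) x (by rw [dist_comm]; exact lt_of_lt_of_le hx (min_le_right _ _)) ⟨t, ht, rfl⟩
    rw [← dist_eq_norm, dist_comm]
    exact this.le
  have h3 := (convex_ball (c t) (min δ δ')).norm_image_sub_le_of_norm_fderiv_le' (f := F)
    (φ := fderiv ℝ F (c t)) (x := c t) (y := c t + s • v t)
    (fun x hx => (hF.differentiableOn (by simp) _ (hball x hx).1).differentiableAt
      (hΩ.mem_nhds (hball x hx).1)) (fun x hx => (hball x hx).2)
    (Metric.mem_ball_self (lt_min hδ hδ')) (by
      rw [Metric.mem_ball, dist_comm]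
      exact hs2 t ht)
  rw [add_sub_cancel_left, map_smul, norm_smul] at h3
  rw [dist_comm, dist_eq_norm]
  have h4 : s⁻¹ • (F (c t + s • v t) - F (c t)) - tangentFun F (c t, v t) =
      s⁻¹ • (F (c t + s • v t) - F (c t) - s • fderiv ℝ F (c t) (v t)) := by
    simp only [smul_sub, smul_smul, inv_mul_cancel₀ hs0, one_smul]
    rfl
  rw [h4, norm_smul, norm_inv, inv_mul_lt_iff₀ (norm_pos_iff.2 hs0)]
  refine lt_of_le_of_lt h3 ?_
  rw [mul_comm, mul_assoc]
  refine mul_lt_mul_of_pos_left ?_ (norm_pos_iff.2 hs0)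
  rw [mul_div_assoc', div_lt_iff₀ hpos, mul_comm]
  exact mul_lt_mul_of_pos_left hvt hε

/-- The explicit second tangent map shows that exchanging `y` and `v` only exchanges the arguments
of the second derivative. -/
theorem hasFDerivAt_tangentFun (hΩ : IsOpen Ω) (hF : ContDiffOn ℝ ∞ F Ω) {x : X} (hx : x ∈ Ω)
    (y v w : X) : tangentFun (tangentFun F) ((x, y), (v, w)) =
      fderiv ℝ (fderiv ℝ F) x v y + fderiv ℝ F x w := by
  have h1 : HasFDerivAt (fderiv ℝ F) (fderiv ℝ (fderiv ℝ F) x) x :=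
    (((hF.fderiv_of_isOpen hΩ (m := ∞) (by simp)).differentiableOn (by simp) _ hx).differentiableAt
      (hΩ.mem_nhds hx)).hasFDerivAt
  have h2 : HasFDerivAt (fun p : X × X => fderiv ℝ F p.1)
      ((fderiv ℝ (fderiv ℝ F) x).comp (ContinuousLinearMap.fst ℝ X X)) (x, y) :=
    HasFDerivAt.comp (x, y) h1 hasFDerivAt_fst
  have h3 := h2.clm_apply (hasFDerivAt_snd (𝕜 := ℝ) (p := (x, y)))
  have h4 : fderiv ℝ (tangentFun F) (x, y) = _ := h3.fderiv
  rw [tangentFun, h4]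
  simp [add_comm]

/-- The chain rule gives `T(TF)((c, v), (c', v'))`; symmetry of the second derivative permits
swapping the middle entries. This says that the time derivative commutes with the derivative in the
direction `v`. -/
theorem hasDerivAt_tangentFun_curve (hΩ : IsOpen Ω) (hF : ContDiffOn ℝ ∞ F Ω) {c v : ℝ → X}
    (hc : ContDiff ℝ ∞ c) (hv : ContDiff ℝ ∞ v) {t : ℝ} (ht : c t ∈ Ω) :
    HasDerivAt (fun s => tangentFun F (c s, v s))
      (tangentFun (tangentFun F) ((c t, deriv c t), (v t, deriv v t))) t := by
  have h1 := hasDerivAt_comp_curve (hΩ.prod isOpen_univ) (contDiffOn_tangentFun hΩ hF)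
    (hc.prodMk hv) (t := t) ⟨ht, trivial⟩
  have hd : deriv (fun s => (c s, v s)) t = (deriv c t, deriv v t) :=
    ((hc.differentiable (by simp) t).hasDerivAt.prodMk
      (hv.differentiable (by simp) t).hasDerivAt).deriv
  rw [hd, hasFDerivAt_tangentFun hΩ hF ht] at h1
  rw [hasFDerivAt_tangentFun hΩ hF ht]
  have hsym : IsSymmSndFDerivAt ℝ F (c t) :=
    (hF.contDiffAt (hΩ.mem_nhds ht)).isSymmSndFDerivAt
      (by rw [minSmoothness_of_isRCLikeNormedField]; exact (fun n => by exact_mod_cast le_top : ∀ n : ℕ, (n : ℕ∞ω) ≤ ∞) 2)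
  rwa [hsym.eq (v t) (deriv c t)]

/-- The time derivative of `F(c + sv)` is `TF((c, c') + s(v, v'))`, so the case `n + 1` for `F` is
the case `n` for `TF`. The resulting limit `T(TF)((c, c'), (v, v'))` is the time derivative of
`TF(c, v)` by the previous lemma. -/
theorem tendstoUniformlyOn_iteratedDeriv_slope {K : Set ℝ} (hK : IsCompact K) (n : ℕ) :
    ∀ {X : Type u} [NormedAddCommGroup X] [NormedSpace ℝ X]
    {F : X → Y} {Ω : Set X}, IsOpen Ω → ContDiffOn ℝ ∞ F Ω → ∀ {c v : ℝ → X}, ContDiff ℝ ∞ c →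
    ContDiff ℝ ∞ v → (∀ t ∈ K, c t ∈ Ω) →
    TendstoUniformlyOn (fun (s : ℝ) t => s⁻¹ • (iteratedDeriv n (fun t => F (c t + s • v t)) t -
      iteratedDeriv n (fun t => F (c t)) t))
      (iteratedDeriv n (fun t => tangentFun F (c t, v t))) (𝓝[≠] 0) K := by
  induction n with
  | zero =>
    intro X _ _ F Ω hΩ hF c v hc hv hm
    simpa only [iteratedDeriv_zero] using
      tendstoUniformlyOn_slope hK hΩ hF hc.continuous hv.continuous hm
  | succ n ih =>
    intro X _ _ F Ω hΩ hF c v hc hv hm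
    have h1 := ih (hΩ.prod isOpen_univ) (contDiffOn_tangentFun hΩ hF)
      (c := fun t => (c t, deriv c t)) (v := fun t => (v t, deriv v t))
      (hc.prodMk (contDiff_deriv hc)) (hv.prodMk (contDiff_deriv hv))
      (fun t ht => ⟨hm t ht, trivial⟩)
    refine (h1.congr ?_).congr_right fun t ht => ?_
    · filter_upwards [eventually_forall_mem hΩ hc.continuous hK hm
        (tendstoUniformlyOn_add_smul hK hv.continuous)] with s hs t ht
      have hcs : ContDiff ℝ ∞ fun t => c t + s • v t := hc.add (hv.const_smul s)
      have hd : ∀ r, deriv (fun t => c t + s • v t) r = deriv c r + s • deriv v r := fun r =>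
        ((hc.differentiable (by simp) r).hasDerivAt.add
          ((hv.differentiable (by simp) r).hasDerivAt.const_smul s)).deriv
      simp only [iteratedDeriv_succ_comp hΩ hF hc (hm t ht) n,
        iteratedDeriv_succ_comp hΩ hF hcs (hs t ht) n, hd]
      rfl
    · rw [iteratedDeriv_succ']
      refine Filter.EventuallyEq.iteratedDeriv_eq n ?_
      filter_upwards [eventually_mem_of_continuous hΩ hc.continuous (hm t ht)] with s hs
      exact (hasDerivAt_tangentFun_curve hΩ hF hc hv hs).deriv.symm

end curves

/-! ### Time dependent superposition operators on the path model. -/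

section superposition

variable {E : Type u} [NormedAddCommGroup E] [NormedSpace ℝ E]

/-- A time dependent map `F(t, x)`, smooth on the open set `Ω`, that depends on `t` only through
the projection to `[0, π]` and satisfies `F(0, 0) = 0`. -/
structure IsPathField {E' : Type u} [NormedAddCommGroup E'] [NormedSpace ℝ E'] (F : ℝ × E' → E)
    (Ω : Set (ℝ × E')) : Prop where
  isOpen : IsOpen Ω
  contDiffOn : ContDiffOn ℝ ∞ F Ω
  mem_proj : ∀ t x, (t, x) ∈ Ω ↔ ((projPi t : ℝ), x) ∈ Ω
  eq_proj : ∀ t x, (t, x) ∈ Ω → F (t, x) = F ((projPi t : ℝ), x)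
  zero : (0, 0) ∈ Ω → F (0, 0) = 0

/-- Paths on which a time dependent map is defined. -/
def pathsIn {E' : Type u} [NormedAddCommGroup E'] [NormedSpace ℝ E'] (Ω : Set (ℝ × E')) :
    Set (PathModel E') := {ξ | ∀ t : Ipi, ((t : ℝ), ξ.val t) ∈ Ω}

variable {E' : Type u} [NormedAddCommGroup E'] [NormedSpace ℝ E'] {F : ℝ × E' → E}
  {Ω : Set (ℝ × E')}

theorem pathExt_projPi {X : Type*} (γ : Ipi → X) (t : ℝ) : pathExt γ (projPi t) = pathExt γ t := by
  simp [pathExt, Set.IccExtend]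

theorem mem_pathsIn_iff {ξ : PathModel E'} : ξ ∈ pathsIn Ω ↔
    ∀ t ∈ Set.Icc 0 Real.pi, (t, pathExt ξ.val t) ∈ Ω := by
  constructor
  · intro h t ht
    rw [pathExt_of_mem _ ht]
    exact h ⟨t, ht⟩
  · intro h t
    have := h t t.2
    rwa [pathExt_of_mem _ t.2] at this

namespace IsPathField

theorem mem (hF : IsPathField F Ω) {ξ : PathModel E'} (hξ : ξ ∈ pathsIn Ω) (t : ℝ) :
    (t, pathExt ξ.val t) ∈ Ω := by
  rw [hF.mem_proj, ← pathExt_projPi]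
  exact mem_pathsIn_iff.1 hξ _ (projPi t).2

theorem apply_eq (hF : IsPathField F Ω) {ξ : PathModel E'} (hξ : ξ ∈ pathsIn Ω) (t : ℝ) :
    F (t, pathExt ξ.val t) = F ((projPi t : ℝ), ξ.val (projPi t)) :=
  hF.eq_proj _ _ (hF.mem hξ t)

theorem contDiff_comp (hF : IsPathField F Ω) {ξ : PathModel E'} (hξ : ξ ∈ pathsIn Ω) :
    ContDiff ℝ ∞ fun t => F (t, pathExt ξ.val t) := by
  rw [contDiff_iff_contDiffAt]
  intro t
  exact (hF.contDiffOn.contDiffAt (hF.isOpen.mem_nhds (hF.mem hξ t))).comp t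
    (contDiff_id.prodMk ξ.contDiff).contDiffAt

/-- Dependence on time through `projPi` makes the composite, which is smooth on all of `ℝ`, constant
on both sides of `[0, π]`; flatness at the end points is then automatic. -/
theorem exists_comp (hF : IsPathField F Ω) {ξ : PathModel E'} (hξ : ξ ∈ pathsIn Ω) :
    ∃ ζ : PathModel E, ∀ t : Ipi, ζ.val t = F (t, ξ.val t) := by
  have h0 : ∀ t ≤ 0, F (t, pathExt ξ.val t) = 0 := by
    intro t ht
    have h0 : ξ.val ⟨0, zero_mem_Ipi⟩ = 0 := ξ.val_mem.2
    have h1 := hF.mem hξ 0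
    rw [ξ.pathExt_of_nonpos le_rfl] at h1
    rw [hF.apply_eq hξ, projPi, Set.projIcc_of_le_left _ ht, h0]
    exact hF.zero h1
  have h1 : ∀ t, Real.pi ≤ t → F (t, pathExt ξ.val t) = F (Real.pi, pathExt ξ.val Real.pi) := by
    intro t ht
    rw [hF.apply_eq hξ, hF.apply_eq hξ, projPi, Set.projIcc_of_right_le _ ht, Set.projIcc_right]
  obtain ⟨ζ, hζ⟩ := exists_pathModel_of_curve (hF.contDiff_comp hξ) h0 h1
  refine ⟨ζ, fun t => ?_⟩
  have := congrFun hζ t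
  rwa [pathExt_of_mem _ t.2, pathExt_of_mem _ t.2] at this

theorem isOpen_pathsIn (hF : IsPathField F Ω) : IsOpen (pathsIn Ω) := by
  refine isOpen_iff_mem_nhds.2 fun ξ hξ => ?_
  have h := (PathModel.tendsto_iff (l := 𝓝 ξ) (ξ := id) (η := ξ)).1 Filter.tendsto_id 0
  simp only [iteratedDeriv_zero] at h
  have hid : TendstoUniformlyOn (fun (_ : PathModel E') (t : ℝ) => t) (fun t => t) (𝓝 ξ)
      (Set.Icc 0 Real.pi) := fun u hu => Filter.Eventually.of_forall fun _ t _ => refl_mem_uniformity hu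
  have := eventually_forall_mem hF.isOpen (c := fun t => (t, pathExt ξ.val t))
    (continuous_id.prodMk ξ.contDiff.continuous) isCompact_Icc (mem_pathsIn_iff.1 hξ)
    (tendstoUniformlyOn_prodMk hid h)
  exact this.mono fun η hη => mem_pathsIn_iff.2 hη

theorem pathExt_eq (hF : IsPathField F Ω) {ξ : PathModel E'} (hξ : ξ ∈ pathsIn Ω)
    {ζ : PathModel E} (h : ∀ t : Ipi, ζ.val t = F (t, ξ.val t)) :
    pathExt ζ.val = fun t => F (t, pathExt ξ.val t) := by
  funext t
  rw [hF.apply_eq hξ, ← h]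
  rfl

theorem continuousOn (hF : IsPathField F Ω) {T : PathModel E' → PathModel E}
    (hT : ∀ ξ ∈ pathsIn Ω, ∀ t : Ipi, (T ξ).val t = F (t, ξ.val t)) :
    ContinuousOn T (pathsIn Ω) := by
  intro ξ hξ
  refine ContinuousAt.continuousWithinAt (PathModel.tendsto_iff.2 fun n => ?_)
  have h := (PathModel.tendsto_iff (l := 𝓝 ξ) (ξ := id) (η := ξ)).1 Filter.tendsto_id
  have h1 := tendstoUniformlyOn_iteratedDeriv_comp isCompact_Icc n hF.isOpen hF.contDiffOn
    (contDiff_id.prodMk ξ.contDiff) (cs := fun (η : PathModel E') t => (t, pathExt η.val t))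
    (l := 𝓝 ξ) (fun η => contDiff_id.prodMk η.contDiff) (mem_pathsIn_iff.1 hξ) (fun j => by
      have e : ∀ η : PathModel E', iteratedDeriv j (fun t => (t, pathExt η.val t)) =
        fun t => (iteratedDeriv j (fun t : ℝ => t) t, iteratedDeriv j (pathExt η.val) t) :=
        fun η => iteratedDeriv_prodMk contDiff_id η.contDiff j
      simp only [id, e]
      exact tendstoUniformlyOn_prodMk
        (fun u hu => Filter.Eventually.of_forall fun _ t _ => refl_mem_uniformity hu) (h j))
  rw [hF.pathExt_eq hξ (hT ξ hξ)]
  refine h1.congr ?_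
  filter_upwards [hF.isOpen_pathsIn.mem_nhds hξ] with η hη t _
  rw [hF.pathExt_eq hη (hT η hη)]

/-- The derivative in the space variable is again a time dependent map. -/
theorem deriv (hF : IsPathField F Ω) :
    IsPathField (fun q : ℝ × (E' × E') => tangentFun F ((q.1, q.2.1), (0, q.2.2)))
      {q : ℝ × (E' × E') | (q.1, q.2.1) ∈ Ω} where
  isOpen := hF.isOpen.preimage (by fun_prop)
  contDiffOn := (contDiffOn_tangentFun hF.isOpen hF.contDiffOn).comp (ContDiff.contDiffOn (by fun_prop))
    fun q hq => ⟨hq, trivial⟩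
  mem_proj t x := hF.mem_proj t x.1
  eq_proj := by
    rintro t ⟨x, v⟩ hx
    have hx : (t, x) ∈ Ω := hx
    -- `projPi` is not differentiable, so the identity `eq_proj` cannot be differentiated jointly.
    -- The derivative is expressed along a line at fixed time, where both sides of `eq_proj` agree
    -- near `s = 0`.
    have hd : ∀ t', (t', x) ∈ Ω → HasDerivAt (fun s : ℝ => F (t', x + s • v))
        (tangentFun F ((t', x), (0, v))) 0 := by
      intro t' h'
      have h1 := ((hF.contDiffOn.differentiableOn (by simp) _ h').differentiableAt
        (hF.isOpen.mem_nhds h')).hasFDerivAt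
      have h2 : HasDerivAt (fun s : ℝ => ((t', x + s • v) : ℝ × E')) ((0 : ℝ), v) 0 := by
        have := (hasDerivAt_const (0 : ℝ) t').prodMk
          (((hasDerivAt_id (0 : ℝ)).smul_const v).const_add x)
        simpa using this
      have h3 : HasFDerivAt F (fderiv ℝ F (t', x)) ((fun s : ℝ => ((t', x + s • v) : ℝ × E')) 0) := by
        simpa using h1
      exact h3.comp_hasDerivAt (0 : ℝ) h2
    refine (hd t hx).unique ((hd _ ((hF.mem_proj t x).1 hx)).congr_of_eventuallyEq ?_)
    have hc : ContinuousAt (fun s : ℝ => ((t, x + s • v) : ℝ × E')) 0 := by fun_prop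
    filter_upwards [hc.eventually (hF.isOpen.mem_nhds (by simpa using hx))] with s hs
    exact hF.eq_proj _ _ hs
  zero _ := map_zero (fderiv ℝ F (0, 0))

end IsPathField

/-- Pairing of paths. -/
noncomputable def pathPair : PathModel E × PathModel E' →L[ℝ] PathModel (E × E') where
  toFun p := PathModel.of (fun t => (p.1.val t, p.2.val t)) ⟨(p.1.val_mem.1.prodMk p.2.val_mem.1).comp (f := fun q : E × E' => q)
    fun t => (contMDiff_fst.prodMk_space contMDiff_snd) _, by
    simp [p.1.val_mem.2, p.2.val_mem.2]⟩
  map_add' _ _ := rfl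
  map_smul' _ _ := rfl
  cont := by
    refine continuous_iff_continuousAt.2 fun η => PathModel.tendsto_iff.2 fun n => ?_
    have h1 := PathModel.tendsto_iff.1 (continuous_fst.tendsto η) n
    have h2 := PathModel.tendsto_iff.1 (continuous_snd.tendsto η) n
    have e : ∀ p : PathModel E × PathModel E',
        iteratedDeriv n (fun t => (pathExt p.1.val t, pathExt p.2.val t)) =
        fun t => (iteratedDeriv n (pathExt p.1.val) t, iteratedDeriv n (pathExt p.2.val) t) :=
      fun p => iteratedDeriv_prodMk p.1.contDiff p.2.contDiff n
    have h3 := tendstoUniformlyOn_prodMk h1 h2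
    rw [← e] at h3
    exact h3.congr (Filter.Eventually.of_forall fun p t _ => (congrFun (e p) t).symm)

@[simp] theorem pathPair_val (p : PathModel E × PathModel E') (t : Ipi) :
    (pathPair p).val t = (p.1.val t, p.2.val t) := rfl

/-- Superposition operators are smooth. -/
theorem IsPathField.isCk (k : ℕ) : ∀ {E' : Type u} [NormedAddCommGroup E'] [NormedSpace ℝ E']
    [CompleteSpace E'] {F : ℝ × E' → E} {Ω : Set (ℝ × E')}, IsPathField F Ω → ∀ {T : PathModel E' → PathModel E},
    (∀ ξ ∈ pathsIn Ω, ∀ t : Ipi, (T ξ).val t = F (t, ξ.val t)) →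
    IsCk (PathModel E) k (PathModel E') T (pathsIn Ω) := by
  induction k with
  | zero => exact fun hF _ hT => hF.continuousOn hT
  | succ k ih =>
    intro E' _ _ _ F Ω hF T hT
    -- The derivative operator is itself a superposition operator, with field the space derivative
    -- of `F`, applied to the path of pairs. Off its domain it takes the irrelevant value `0`.
    have hex : ∀ q : PathModel (E' × E'), ∃ ζ : PathModel E,
        q ∈ pathsIn {q : ℝ × (E' × E') | (q.1, q.2.1) ∈ Ω} →
        ∀ t : Ipi, ζ.val t = tangentFun F ((t, (q.val t).1), (0, (q.val t).2)) := by
      intro q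
      by_cases hq : q ∈ pathsIn {q : ℝ × (E' × E') | (q.1, q.2.1) ∈ Ω}
      · obtain ⟨ζ, hζ⟩ := hF.deriv.exists_comp hq
        exact ⟨ζ, fun _ => hζ⟩
      · exact ⟨0, fun h => absurd h hq⟩
    choose T' hT' using hex
    refine ⟨hF.continuousOn hT, fun p => T' (pathPair p), fun ξ hξ v => ?_, ?_⟩
    · refine PathModel.tendsto_iff.2 fun n => ?_
      -- Time is carried as a component of the curve; the variation `(0, v)` leaves it unchanged.
      have h1 := tendstoUniformlyOn_iteratedDeriv_slope (K := Set.Icc 0 Real.pi) isCompact_Icc n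
        hF.isOpen hF.contDiffOn (c := fun t => (t, pathExt ξ.val t))
        (v := fun t => ((0 : ℝ), pathExt v.val t))
        (contDiff_id.prodMk ξ.contDiff) (contDiff_const.prodMk v.contDiff) (mem_pathsIn_iff.1 hξ)
      have hq : pathPair (ξ, v) ∈ pathsIn {q : ℝ × (E' × E') | (q.1, q.2.1) ∈ Ω} := hξ
      have hlim : pathExt (T' (pathPair (ξ, v))).val =
          fun t => tangentFun F ((t, pathExt ξ.val t), (0, pathExt v.val t)) :=
        hF.deriv.pathExt_eq hq (hT' _ hq)
      rw [hlim]
      refine h1.congr ?_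
      have hev := tendsto_add_smul ξ v (hF.isOpen_pathsIn.mem_nhds hξ)
      filter_upwards [hev] with s hs t _
      have hs : ξ + s • v ∈ pathsIn Ω := hs
      have e1 := hF.pathExt_eq hs (hT _ hs)
      have e2 := hF.pathExt_eq hξ (hT _ hξ)
      have hdiff : ∀ ζ : PathModel E, ContDiffAt ℝ n (pathExt ζ.val) t := fun ζ =>
        ζ.contDiff.contDiffAt.of_le (by exact_mod_cast le_top)
      have e3 : pathExt (s⁻¹ • (T (ξ + s • v) - T ξ)).val =
          s⁻¹ • (pathExt (T (ξ + s • v)).val - pathExt (T ξ).val) := rfl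
      have e4 : (fun t => F ((t, pathExt ξ.val t) + s • ((0 : ℝ), pathExt v.val t))) =
          pathExt (T (ξ + s • v)).val := by
        rw [e1]
        funext t
        simp only [Prod.smul_mk, Prod.mk_add_mk, smul_zero, add_zero]
        rfl
      simp only [e3, e4, ← e2]
      rw [iteratedDeriv_const_smul_field, iteratedDeriv_sub (hdiff _) (hdiff _)]
      
    · exact ((ih hF.deriv hT').comp_clm pathPair).mono fun p hp => hp.1

theorem IsPathField.isSmoothOn [CompleteSpace E'] (hF : IsPathField F Ω) {T : PathModel E' → PathModel E}
    (hT : ∀ ξ ∈ pathsIn Ω, ∀ t : Ipi, (T ξ).val t = F (t, ξ.val t)) :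
    IsSmoothOn T (pathsIn Ω) :=
  ⟨hF.isOpen_pathsIn, fun k => hF.isCk k hT⟩

end superposition

/-! ### The path group is a Fréchet Lie group -/

section pathGroup

variable {E : Type u} [NormedAddCommGroup E] [NormedSpace ℝ E] {G : Type u} [Group G]
  [TopologicalSpace G] [ChartedSpace E G] [LieGroup 𝓘(ℝ, E) ∞ G]

theorem isOpen_baseChart_source : IsOpen (baseChart E G).source := by
  simp [baseChart, (chartAt E (1 : G)).open_source]

theorem isOpen_baseChart_target : IsOpen (baseChart E G).target := by
  have : (baseChart E G).target =
      (fun x => x + extChartAt 𝓘(ℝ, E) (1 : G) 1) ⁻¹' (extChartAt 𝓘(ℝ, E) (1 : G)).target := by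
    ext x
    simp [baseChart]
  rw [this]
  exact (isOpen_extChartAt_target (1 : G)).preimage (by fun_prop)

theorem contMDiff_pathExt (η : pathGroup E G) : ContMDiff 𝓘(ℝ, ℝ) 𝓘(ℝ, E) ∞ (pathExt η.1) := by
  have : IsManifold 𝓘(ℝ, E) ∞ G := LieGroup.toContMDiffMul.toIsManifold
  exact η.2.1.contMDiff

/-- A time dependent map with values in `G`, smooth on the open set `Ω`, that depends on `t` only
through the projection to `[0, π]` and sends `(0, 0)` to `1`. -/
structure IsGroupPathField {E' : Type u} [NormedAddCommGroup E'] [NormedSpace ℝ E']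
    (κ : ℝ × E' → G) (Ω : Set (ℝ × E')) : Prop where
  isOpen : IsOpen Ω
  contMDiffOn : ContMDiffOn 𝓘(ℝ, ℝ × E') 𝓘(ℝ, E) ∞ κ Ω
  mem_proj : ∀ t x, (t, x) ∈ Ω ↔ ((projPi t : ℝ), x) ∈ Ω
  eq_proj : ∀ t x, κ (t, x) = κ ((projPi t : ℝ), x)
  one : κ (0, 0) = 1

variable {E' : Type u} [NormedAddCommGroup E'] [NormedSpace ℝ E'] {κ : ℝ × E' → G}
  {Ω : Set (ℝ × E')}

/-- Reading a `G`-valued field in the chart around `η` reduces it to a vector-valued field on a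
smaller open set; `κ(0, 0) = 1` and `η(0) = 1` give the normalization at `(0, 0)`. -/
theorem IsGroupPathField.chart (hκ : IsGroupPathField (E := E) κ Ω) (η : pathGroup E G) :
    IsPathField (fun q => baseChart E G ((pathExt η.1 q.1)⁻¹ * κ q))
      (Ω ∩ (fun q => (pathExt η.1 q.1)⁻¹ * κ q) ⁻¹' (baseChart E G).source) := by
  have h1 : ContMDiffOn 𝓘(ℝ, ℝ × E') 𝓘(ℝ, E) ∞ (fun q : ℝ × E' => (pathExt η.1 q.1)⁻¹ * κ q) Ω :=
    ContMDiffOn.mul ((contMDiff_pathExt η).inv.comp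
      (contDiff_fst (E := ℝ) (F := E')).contMDiff).contMDiffOn hκ.contMDiffOn
  have h0 : η.1 ⟨0, zero_mem_Ipi⟩ = 1 := η.2.2
  refine ⟨h1.continuousOn.isOpen_inter_preimage hκ.isOpen isOpen_baseChart_source, ?_, ?_, ?_, ?_⟩
  · rw [← contMDiffOn_iff_contDiffOn]
    intro q hq
    exact (contMDiffAt_baseChart hq.2).comp_contMDiffWithinAt q ((h1 q hq.1).mono Set.inter_subset_left)
  · intro t x
    simp only [Set.mem_inter_iff, Set.mem_preimage, hκ.eq_proj t x, pathExt_projPi]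
    rw [hκ.mem_proj]
  · intro t x _
    simp only [hκ.eq_proj t x, pathExt_projPi]
  · intro _
    simp only [hκ.one, pathExt_of_le η.1 le_rfl, h0, inv_one, mul_one, baseChart_one]

theorem pathChart_val {η γ : pathGroup E G} (h : γ ∈ (pathChart η).source) (t : Ipi) :
    (pathChart η γ).val t = baseChart E G ((η.1 t)⁻¹ * γ.1 t) := by
  classical
  have h : ∀ t, (η.1 t)⁻¹ * γ.1 t ∈ (baseChart E G).source := h
  change (dite _ _ _ : PathModel E).val t = _
  rw [dif_pos h]
  rfl

theorem pathChart_symm_val {η : pathGroup E G} {ξ : PathModel E} (h : ξ ∈ (pathChart η).target)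
    (t : Ipi) : ((pathChart η).symm ξ).1 t = η.1 t * (baseChart E G).symm (ξ.val t) := by
  classical
  have h : ∀ t, ξ.val t ∈ (baseChart E G).target := h
  change (dite _ _ _ : pathGroup E G).1 t = _
  rw [dif_pos h]

theorem covers_pathAtlas : (pathAtlas E G).Covers := fun η =>
  ⟨pathChart η, ⟨η, rfl⟩, fun t => by simpa using one_mem_baseChart_source⟩

/-- A map into the path group given by a smooth time dependent map is smooth. -/
theorem IsGroupPathField.smoothMapOn [CompleteSpace E'] (hκ : IsGroupPathField (E := E) κ Ω)
    {V : Type v} [AddCommGroup V] [Module ℝ V] [TopologicalSpace V] [FrechetSpace V]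
    (L : V →L[ℝ] PathModel E') {f : V → pathGroup E G}
    (hf : ∀ v, L v ∈ pathsIn Ω → ∀ t : Ipi, (f v).1 t = κ (t, (L v).val t)) :
    Atlas.SmoothMapOn (Atlas.ofModel V) (pathAtlas E G) f (L ⁻¹' pathsIn Ω) := by
  rw [Atlas.smoothMapOn_ofModel_left]
  rintro _ ⟨η, rfl⟩
  have hF := hκ.chart η
  have hex : ∀ ξ : PathModel E', ∃ ζ : PathModel E, ξ ∈ pathsIn (Ω ∩ (fun q =>
      (pathExt η.1 q.1)⁻¹ * κ q) ⁻¹' (baseChart E G).source) → ∀ t : Ipi,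
        ζ.val t = baseChart E G ((pathExt η.1 t)⁻¹ * κ (t, ξ.val t)) := by
    intro ξ
    by_cases h : ξ ∈ pathsIn (Ω ∩ (fun q =>
      (pathExt η.1 q.1)⁻¹ * κ q) ⁻¹' (baseChart E G).source)
    · obtain ⟨ζ, hζ⟩ := hF.exists_comp h
      exact ⟨ζ, fun _ => hζ⟩
    · exact ⟨0, fun h' => absurd h' h⟩
  choose T hT using hex
  have hη : ∀ t : Ipi, pathExt η.1 t = η.1 t := fun t => pathExt_of_mem _ t.2
  have hset : ∀ v, v ∈ L ⁻¹' pathsIn (Ω ∩ (fun q =>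
      (pathExt η.1 q.1)⁻¹ * κ q) ⁻¹' (baseChart E G).source) ↔
      v ∈ {y | y ∈ L ⁻¹' pathsIn Ω ∧ f y ∈ (pathChart η).source} := by
    intro v
    constructor
    · intro h
      have h1 : L v ∈ pathsIn Ω := fun t => (h t).1
      refine ⟨h1, fun t => ?_⟩
      rw [hf v h1, ← hη]
      exact (h t).2
    · rintro ⟨h1, h2⟩ t
      refine ⟨h1 t, ?_⟩
      have := h2 t
      rw [hf v h1, ← hη] at this
      exact this
  refine (((hF.isSmoothOn hT).comp_clm L).congr fun v hv => ?_).of_iff hset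
  have hv' := (hset v).1 hv
  refine PathModel.ext' (funext fun t => ?_)
  rw [pathChart_val hv'.2, hT _ hv, hη, hf v hv'.1]

/-- Inverse charts are pointwise operations. Products and inverses of such fields are again fields,
so chart changes, multiplication and inversion are all handled by `IsGroupPathField.smoothMapOn`. -/
theorem isGroupPathField_chart_symm (η : pathGroup E G) :
    IsGroupPathField (E := E) (fun q : ℝ × E => pathExt η.1 q.1 * (baseChart E G).symm q.2)
      (Prod.snd ⁻¹' (baseChart E G).target) where
  isOpen := isOpen_baseChart_target.preimage continuous_snd
  contMDiffOn := by
    have h1 : ContMDiff 𝓘(ℝ, ℝ × E) 𝓘(ℝ, E) ∞ (fun q : ℝ × E => pathExt η.1 q.1) :=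
      (contMDiff_pathExt η).comp (contDiff_fst (E := ℝ) (F := E)).contMDiff
    have h2 : ContMDiffOn 𝓘(ℝ, ℝ × E) 𝓘(ℝ, E) ∞ (fun q : ℝ × E => (baseChart E G).symm q.2)
        (Prod.snd ⁻¹' (baseChart E G).target) := fun q hq =>
      (ContMDiffAt.comp (g := (baseChart E G).symm) (f := Prod.snd) q
        (contMDiffAt_baseChart_symm hq)
        (contDiff_snd (E := ℝ) (F := E)).contMDiff.contMDiffAt).contMDiffWithinAt
    exact h1.contMDiffOn.mul h2
  mem_proj _ _ := Iff.rfl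
  eq_proj t x := by simp only [pathExt_projPi]
  one := by
    have h0 : η.1 ⟨0, zero_mem_Ipi⟩ = 1 := η.2.2
    simp only [pathExt_of_le η.1 le_rfl, h0, baseChart_symm_zero, mul_one]

theorem IsGroupPathField.inv (hκ : IsGroupPathField (E := E) κ Ω) :
    IsGroupPathField (E := E) (fun q => (κ q)⁻¹) Ω where
  isOpen := hκ.isOpen
  contMDiffOn := hκ.contMDiffOn.inv
  mem_proj := hκ.mem_proj
  eq_proj t x := by simp only [hκ.eq_proj t x]
  one := by rw [hκ.one, inv_one]

theorem IsGroupPathField.mul {E'' : Type u} [NormedAddCommGroup E''] [NormedSpace ℝ E'']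
    {κ' : ℝ × E'' → G} {Ω' : Set (ℝ × E'')} (hκ : IsGroupPathField (E := E) κ Ω)
    (hκ' : IsGroupPathField (E := E) κ' Ω') :
    IsGroupPathField (E := E) (fun q : ℝ × (E' × E'') => κ (q.1, q.2.1) * κ' (q.1, q.2.2))
      {q | (q.1, q.2.1) ∈ Ω ∧ (q.1, q.2.2) ∈ Ω'} where
  isOpen := (hκ.isOpen.preimage (by fun_prop)).inter (hκ'.isOpen.preimage (by fun_prop))
  contMDiffOn := by
    have h1 : ContMDiff 𝓘(ℝ, ℝ × (E' × E'')) 𝓘(ℝ, ℝ × E') ∞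
      (fun q : ℝ × (E' × E'') => (q.1, q.2.1)) := ContDiff.contMDiff (by fun_prop)
    have h2 : ContMDiff 𝓘(ℝ, ℝ × (E' × E'')) 𝓘(ℝ, ℝ × E'') ∞
      (fun q : ℝ × (E' × E'') => (q.1, q.2.2)) := ContDiff.contMDiff (by fun_prop)
    exact (hκ.contMDiffOn.comp h1.contMDiffOn fun q hq => hq.1).mul
      (hκ'.contMDiffOn.comp h2.contMDiffOn fun q hq => hq.2)
  mem_proj t x := and_congr (hκ.mem_proj t x.1) (hκ'.mem_proj t x.2)
  eq_proj t x := by simp only [hκ.eq_proj t x.1, hκ'.eq_proj t x.2]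
  one := by
    have := hκ.one
    have := hκ'.one
    simp_all

variable [CompleteSpace E]

theorem smoothMapOn_pathChart_symm (η : pathGroup E G) :
    Atlas.SmoothMapOn (Atlas.ofModel (PathModel E)) (pathAtlas E G) (pathChart η).symm
      (pathChart η).target := by
  refine (isGroupPathField_chart_symm η).smoothMapOn (ContinuousLinearMap.id ℝ _) fun ξ hξ t => ?_
  have hξ : ξ ∈ (pathChart η).target := hξ
  rw [pathChart_symm_val hξ, pathExt_of_mem _ t.2]
  rfl

instance instFrechetPathAtlas : FrechetSpace (pathAtlas E G).model := frechetSpace_pathModel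

theorem smooth_id_pathAtlas : Atlas.SmoothMap (pathAtlas E G) (pathAtlas E G) (fun γ => γ) := by
  rintro _ ⟨η, rfl⟩ ψ hψ
  exact (Atlas.smoothMapOn_ofModel_left.1 (smoothMapOn_pathChart_symm η) ψ hψ).of_iff
    fun ξ => ⟨fun h => ⟨h.1, trivial, h.2⟩, fun h => ⟨h.1, h.2.2⟩⟩

theorem continuous_eval_pathGroup (t : Ipi) :
    @Continuous _ _ (pathAtlas E G).manifoldTopology _ fun γ : pathGroup E G => γ.1 t := by
  refine Atlas.continuous_of_charts ?_
  rintro _ ⟨η, rfl⟩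
  have : IsTopologicalGroup G := topologicalGroup_of_lieGroup 𝓘(ℝ, E) ∞
  have h1 : ContinuousOn (baseChart E G).symm (baseChart E G).target := fun x hx =>
    (contMDiffAt_baseChart_symm hx).continuousAt.continuousWithinAt
  have h2 : ContinuousOn (fun ξ : PathModel E => η.1 t * (baseChart E G).symm (ξ.val t))
      (pathChart η).target := continuousOn_const.mul
    (h1.comp (PathModel.continuous_eval t).continuousOn fun ξ hξ => hξ t)
  exact h2.congr fun ξ hξ => pathChart_symm_val hξ t

theorem isFrechetManifold_pathAtlas [T2Space G] : (pathAtlas E G).IsFrechetManifold := by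
  refine .of_smooth_id inferInstance covers_pathAtlas smooth_id_pathAtlas
    (Atlas.smooth_id_isOpen_target smooth_id_pathAtlas covers_pathAtlas) ?_
  let := (pathAtlas E G).manifoldTopology
  -- Evaluations are continuous for the manifold topology and separate paths, so the Hausdorff
  -- property is inherited from `G`.
  refine ⟨fun γ γ' h => ?_⟩
  obtain ⟨t, ht⟩ : ∃ t, γ.1 t ≠ γ'.1 t := by
    by_contra! h'
    exact h (Subtype.ext (funext h'))
  exact separated_by_continuous (continuous_eval_pathGroup t) ht

theorem isFrechetLieGroup_pathAtlas [T2Space G] : (pathAtlas E G).IsFrechetLieGroup := by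
  refine ⟨isFrechetManifold_pathAtlas, ?_, ?_⟩
  · rintro _ ⟨_, ⟨η, rfl⟩, _, ⟨η', rfl⟩, rfl⟩ ψ hψ
    have h := ((isGroupPathField_chart_symm η).mul (isGroupPathField_chart_symm η')).smoothMapOn
      pathPair (f := fun p : PathModel E × PathModel E =>
        (pathChart η).symm p.1 * (pathChart η').symm p.2) fun p hp t => by
          have h1 : p.1 ∈ (pathChart η).target := fun t => (hp t).1
          have h2 : p.2 ∈ (pathChart η').target := fun t => (hp t).2
          simp only [Subgroup.coe_mul, Pi.mul_apply, pathChart_symm_val h1, pathChart_symm_val h2,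
            pathExt_of_mem _ t.2, pathPair_val]
    exact (Atlas.smoothMapOn_ofModel_left.1 h ψ hψ).of_iff
      fun p => ⟨fun h => ⟨⟨fun t => (h.1 t).1, fun t => (h.1 t).2⟩, trivial, h.2⟩,
        fun h => ⟨fun t => ⟨h.1.1 t, h.1.2 t⟩, h.2.2⟩⟩
  · rintro _ ⟨η, rfl⟩ ψ hψ
    have h := (isGroupPathField_chart_symm η).inv.smoothMapOn (ContinuousLinearMap.id ℝ _)
      (f := fun ξ => ((pathChart η).symm ξ)⁻¹) fun ξ hξ t => by
        have hξ : ξ ∈ (pathChart η).target := hξ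
        simp only [Subgroup.coe_inv, Pi.inv_apply, pathChart_symm_val hξ, pathExt_of_mem _ t.2]
        rfl
    exact (Atlas.smoothMapOn_ofModel_left.1 h ψ hψ).of_iff
      fun ξ => ⟨fun h => ⟨h.1, trivial, h.2⟩, fun h => ⟨h.1, h.2.2⟩⟩

end pathGroup

/-! ### The manifold structure of the restriction to the upper half circle -/

namespace Atlas

universe a b a' b'

variable {M : Type a} {N : Type b} {A : Atlas.{a, a'} M} {B : Atlas.{b, b'} N}

/-- Smoothness of a map can be checked on the inverses of the charts of the domain. -/
theorem smoothMap_of_charts {f : M → N} (h : ∀ φ ∈ A.charts,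
    SmoothMapOn (ofModel A.model) B (fun y => f (φ.symm y)) φ.target) : SmoothMap A B f := by
  intro φ hφ ψ hψ
  exact (smoothMapOn_ofModel_left.1 (h φ hφ) ψ hψ).of_iff
    fun ξ => ⟨fun h => ⟨h.1, trivial, h.2⟩, fun h => ⟨h.1, h.2.2⟩⟩

theorem SmoothMapOn.mono_ofModel {V : Type v} [AddCommGroup V] [Module ℝ V] [TopologicalSpace V]
    {f : V → N} {S S' : Set V} (h : SmoothMapOn (ofModel V) B f S) (hS' : IsOpen S')
    (hs : S' ⊆ S) : SmoothMapOn (ofModel V) B f S' := by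
  rw [smoothMapOn_ofModel_left] at h ⊢
  intro ψ hψ
  have e : S' ∩ {y | y ∈ S ∧ f y ∈ ψ.source} = {y | y ∈ S' ∧ f y ∈ ψ.source} := by
    ext y
    exact ⟨fun h => ⟨h.1, h.2.2⟩, fun h => ⟨h.1, hs h.1, h.2⟩⟩
  exact (h ψ hψ).mono (e ▸ hS'.inter (h ψ hψ).1) fun y hy => ⟨hs hy.1, hy.2⟩

theorem SmoothMapOn.comp_clm {V : Type v} [AddCommGroup V] [Module ℝ V] [TopologicalSpace V]
    {W : Type w} [AddCommGroup W] [Module ℝ W] [TopologicalSpace W]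
    {f : V → N} {S : Set V} (h : SmoothMapOn (ofModel V) B f S) (L : W →L[ℝ] V) :
    SmoothMapOn (ofModel W) B (fun w => f (L w)) (L ⁻¹' S) := by
  rw [smoothMapOn_ofModel_left] at h ⊢
  exact fun ψ hψ => (h ψ hψ).comp_clm L

/-- A smooth map read in the inverse of a chart of the domain. -/
theorem SmoothMapOn.comp_chart_symm {f : M → N} {S : Set M} (h : SmoothMapOn A B f S)
    {φ : PartialEquiv M A.model} (hφ : φ ∈ A.charts) :
    SmoothMapOn (ofModel A.model) B (fun y => f (φ.symm y)) {y | y ∈ φ.target ∧ φ.symm y ∈ S} :=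
  smoothMapOn_ofModel_left.2 fun ψ hψ => (h φ hφ ψ hψ).of_iff fun _ => and_assoc.symm

theorem IsFrechetLieGroup.mulOn {K : Type u} {M : Type v} [Group K] {A : Atlas.{u, w} K}
    {B : Atlas.{v, w'} M} (hA : A.IsFrechetLieGroup) [FrechetSpace B.model] {f g : M → K}
    {S S' : Set M} (hf : SmoothMapOn B A f S) (hg : SmoothMapOn B A g S') :
    SmoothMapOn B A (fun x => f x * g x) (S ∩ S') := by
  have := hA.isFrechetManifold.frechet
  have := SmoothMapOn.comp (hA.isFrechetManifold.prod hA.isFrechetManifold).covers hA.smooth_mul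
    (hf.prodMk hg)
  rwa [Set.preimage_univ, Set.inter_univ] at this

end Atlas

instance instFrechetCircleAtlas : FrechetSpace circleAtlas.model :=
  frechetSpace_of_normed (EuclideanSpace ℝ (Fin 1))

theorem covers_circleAtlas : circleAtlas.Covers := fun z =>
  ⟨(chartAt (EuclideanSpace ℝ (Fin 1)) z).toPartialEquiv,
    ⟨chartAt (EuclideanSpace ℝ (Fin 1)) z, chart_mem_atlas _ _, rfl⟩,
    mem_chart_source (EuclideanSpace ℝ (Fin 1)) z⟩

/-! ### Charts and universal property of the restriction to the upper half circle. -/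

section half

variable {E : Type u} [NormedAddCommGroup E] [NormedSpace ℝ E] {G : Type u} [Group G]
  [TopologicalSpace G] [ChartedSpace E G] [LieGroup 𝓘(ℝ, E) ∞ G]

instance instFrechetLoopAtlas [CompleteSpace E] : FrechetSpace (loopAtlas E G).model :=
  frechetSpace_loopModel

theorem mem_loopChart_self (η : loopGroup E G) : η ∈ (loopChart η).source := fun t => by
  simpa using one_mem_baseChart_source

/-- The charts are pointwise and send `1` to `0`, so around a supported loop the subgroup becomes
the linear subspace of supported loops. Off its source the chart is `0`, which lies in the subspace
as well. -/
theorem loopChart_mem_half {η γ : loopGroup E G} (hη : η ∈ loopsIn E G upperHalf)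
    (hγ : γ ∈ loopsIn E G upperHalf) : loopChart η γ ∈ halfSubmodule E := by
  classical
  intro t ht
  change (dite _ _ _ : LoopModel E).val t = 0
  split_ifs with h
  · change baseChart E G ((η.1 t)⁻¹ * γ.1 t) = 0
    rw [hη t ht, hγ t ht, inv_one, mul_one, baseChart_one]
  · rfl

theorem loopChart_symm_val {η : loopGroup E G} {ξ : LoopModel E} (h : ξ ∈ (loopChart η).target)
    (t : S1) : ((loopChart η).symm ξ).1 t = η.1 t * (baseChart E G).symm (ξ.val t) := by
  classical
  have h : ∀ t, ξ.val t ∈ (baseChart E G).target := h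
  change (dite _ _ _ : loopGroup E G).1 t = _
  rw [dif_pos h]

theorem loopChart_symm_mem_half {η : loopGroup E G} (hη : η ∈ loopsIn E G upperHalf)
    {ξ : LoopModel E} (hξ : ξ ∈ halfSubmodule E) (h : ξ ∈ (loopChart η).target) :
    (loopChart η).symm ξ ∈ loopsIn E G upperHalf := by
  intro t ht
  rw [loopChart_symm_val h, hη t ht, hξ t ht, baseChart_symm_zero, one_mul]

variable (E) in
/-- The model space of the restriction of the extension to the upper half circle. -/
abbrev HalfModel : Type u := halfSubmodule E × ULift.{u} (EuclideanSpace ℝ (Fin 1))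

variable (E) in
/-- The inclusion of the model space into the model space of the extension. -/
noncomputable def halfModelIncl :
    HalfModel E →L[ℝ] LoopModel E × EuclideanSpace ℝ (Fin 1) :=
  (halfSubmodule E).subtypeL.prodMap
    (ContinuousLinearEquiv.ulift (R₁ := ℝ) (M₁ := EuclideanSpace ℝ (Fin 1))).toContinuousLinearMap

theorem isClosedEmbedding_halfModelIncl : Topology.IsClosedEmbedding (halfModelIncl E) :=
  isClosed_halfSubmodule.isClosedEmbedding_subtypeVal.prodMap
    (ContinuousLinearEquiv.ulift (R₁ := ℝ)
      (M₁ := EuclideanSpace ℝ (Fin 1))).toHomeomorph.isClosedEmbedding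

namespace CentralExtension

variable (X : CentralExtension E G)

/-- A local trivialization of the extension. -/
structure Trivialization where
  S : Set (loopGroup E G)
  σ : loopGroup E G → X.carrier
  u : X.carrier → Circle
  smooth_σ : Atlas.SmoothMapOn (loopAtlas E G) X.atlas σ S
  smooth_u : Atlas.SmoothMapOn X.atlas circleAtlas u (X.π ⁻¹' S)
  π_σ : ∀ η ∈ S, X.π (σ η) = η
  eq : ∀ Φ, X.π Φ ∈ S → Φ = σ (X.π Φ) * X.ι (u Φ)

variable {X}

theorem π_ι (z : Circle) : X.π (X.ι z) = 1 := by
  have : X.ι z ∈ X.π.ker := X.exact ▸ ⟨z, rfl⟩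
  exact this

namespace Trivialization

variable (T : X.Trivialization)

theorem π_mul {η : loopGroup E G} (hη : η ∈ T.S) (z : Circle) : X.π (T.σ η * X.ι z) = η := by
  rw [map_mul, T.π_σ η hη, π_ι, mul_one]

/-- The other half of the trivialization being a bijection is forced by injectivity of `ι`. -/
theorem u_mul {η : loopGroup E G} (hη : η ∈ T.S) (z : Circle) : T.u (T.σ η * X.ι z) = z := by
  have h := T.eq (T.σ η * X.ι z) (by rwa [T.π_mul hη])
  rw [T.π_mul hη] at h
  exact (X.injective_ι (mul_left_cancel h)).symm

open Classical in
/-- The chart of the restriction of the extension to the upper half circle defined by a local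
trivialization and charts of the loop group and of the circle. -/
noncomputable def halfChart (η : loopsIn E G upperHalf)
    (c : PartialEquiv Circle (EuclideanSpace ℝ (Fin 1))) :
    PartialEquiv X.overHalf (HalfModel E) where
  toFun Φ := (⟨loopChart η.1 (X.π Φ), loopChart_mem_half η.2 Φ.2⟩, ⟨c (T.u Φ)⟩)
  invFun v := if h : v.1.1 ∈ (loopChart η.1).target ∧ (loopChart η.1).symm v.1.1 ∈ T.S then
    ⟨T.σ ((loopChart η.1).symm v.1.1) * X.ι (c.symm v.2.down), by
      change X.π (T.σ ((loopChart η.1).symm v.1.1) * X.ι (c.symm v.2.down)) ∈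
        loopsIn E G upperHalf
      rw [T.π_mul h.2]
      exact loopChart_symm_mem_half η.2 v.1.2 h.1⟩ else 1
  source := {Φ | X.π Φ ∈ T.S ∧ X.π Φ ∈ (loopChart η.1).source ∧ T.u Φ ∈ c.source}
  target := {v | (v.1.1 ∈ (loopChart η.1).target ∧ (loopChart η.1).symm v.1.1 ∈ T.S) ∧
    v.2.down ∈ c.target}
  map_source' Φ h := by
    refine ⟨⟨(loopChart η.1).map_source h.2.1, ?_⟩, c.map_source h.2.2⟩
    rw [(loopChart η.1).left_inv h.2.1]
    exact h.1
  map_target' v h := by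
    rw [dif_pos h.1]
    simp only [Set.mem_ofPred_eq, T.π_mul h.1.2, T.u_mul h.1.2]
    exact ⟨h.1.2, (loopChart η.1).map_target h.1.1, c.map_target h.2⟩
  left_inv' Φ h := by
    have h1 : loopChart η.1 (X.π Φ) ∈ (loopChart η.1).target ∧
        (loopChart η.1).symm (loopChart η.1 (X.π Φ)) ∈ T.S :=
      ⟨(loopChart η.1).map_source h.2.1, by
        rw [(loopChart η.1).left_inv h.2.1]
        exact h.1⟩
    rw [dif_pos h1]
    refine Subtype.ext ?_
    simp only [(loopChart η.1).left_inv h.2.1, c.left_inv h.2.2]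
    exact (T.eq _ h.1).symm
  right_inv' v h := by
    rw [dif_pos h.1]
    refine Prod.ext (Subtype.ext ?_) (ULift.ext _ _ ?_)
    · simp only [T.π_mul h.1.2, (loopChart η.1).right_inv h.1.1]
    · simp only [T.u_mul h.1.2, c.right_inv h.2]

theorem halfChart_symm_val {η : loopsIn E G upperHalf}
    {c : PartialEquiv Circle (EuclideanSpace ℝ (Fin 1))} {v : HalfModel E}
    (h : v ∈ (T.halfChart η c).target) : ((T.halfChart η c).symm v : X.carrier) =
      T.σ ((loopChart η.1).symm v.1.1) * X.ι (c.symm v.2.down) := by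
  classical
  change ((dite _ _ _ : X.overHalf) : X.carrier) = _
  rw [dif_pos h.1]

end Trivialization

variable (X)

/-- The manifold structure of the restriction of the extension to the upper half circle. -/
noncomputable def halfAtlas : Atlas.{u, u} X.overHalf where
  model := HalfModel E
  charts := {χ | ∃ (T : X.Trivialization) (η : loopsIn E G upperHalf),
    ∃ c ∈ circleAtlas.charts, χ = T.halfChart η c}

theorem covers_halfAtlas : X.halfAtlas.Covers := by
  intro Φ
  obtain ⟨S, σ, u, hS, h1, h2, h3, h4⟩ := X.locally_trivial (X.π Φ)
  let T : X.Trivialization := ⟨S, σ, u, h1, h2, h3, h4⟩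
  obtain ⟨c, hc, hu⟩ := covers_circleAtlas (u Φ)
  exact ⟨_, ⟨T, ⟨X.π Φ, Φ.2⟩, c, hc, rfl⟩, hS, mem_loopChart_self _, hu⟩

variable [CompleteSpace E]

instance instFrechetHalfAtlas : FrechetSpace X.halfAtlas.model :=
  inferInstanceAs (FrechetSpace (HalfModel E))

/-- Inverses of charts are smooth as maps to the extension. -/
theorem smoothMapOn_halfChart_symm {χ : PartialEquiv X.overHalf (HalfModel E)}
    (hχ : χ ∈ X.halfAtlas.charts) :
    Atlas.SmoothMapOn (Atlas.ofModel (HalfModel E)) X.atlas (fun v => (χ.symm v : X.carrier))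
      χ.target := by
  obtain ⟨T, η, c, hc, rfl⟩ := hχ
  have hX := X.isFrechetLieGroup
  have := hX.isFrechetManifold.frechet
  have h1 := (T.smooth_σ.comp_chart_symm (φ := loopChart η.1) ⟨_, rfl⟩).comp_clm
    ((ContinuousLinearMap.fst ℝ (LoopModel E) (EuclideanSpace ℝ (Fin 1))).comp (halfModelIncl E))
  have h2 := (Atlas.SmoothMapOn.comp_chart_symm X.smooth_ι hc).comp_clm
    ((ContinuousLinearMap.snd ℝ (LoopModel E) (EuclideanSpace ℝ (Fin 1))).comp (halfModelIncl E))
  have h3 := hX.mulOn h1 h2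
  refine Atlas.SmoothMapOn.congr (f := fun v : HalfModel E =>
    T.σ ((loopChart η.1).symm v.1.1) * X.ι (c.symm v.2.down)) ?_ fun v hv =>
      T.halfChart_symm_val hv
  refine (congrArg (Atlas.SmoothMapOn _ _ _) (Set.ext fun v => ?_)).mp h3
  exact ⟨fun h => ⟨h.1, h.2.1⟩, fun h => ⟨h.1, h.2, trivial⟩⟩

/-- A map to the restriction is smooth if it is smooth as a map to the extension. -/
theorem smoothMapOn_halfAtlas {W : Type w} {C : Atlas.{w, w'} W} [FrechetSpace C.model]
    {h : W → X.overHalf} {S : Set W}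
    (hh : Atlas.SmoothMapOn C X.atlas (fun x => (h x : X.carrier)) S) :
    Atlas.SmoothMapOn C X.halfAtlas h S := by
  rintro φ hφ _ ⟨T, η, c, hc, rfl⟩
  have hX := X.isFrechetLieGroup
  have := hX.isFrechetManifold.frechet
  have h1 := Atlas.SmoothMapOn.comp hX.isFrechetManifold.covers X.smooth_π hh φ hφ
    (loopChart η.1) ⟨_, rfl⟩
  have h2 := Atlas.SmoothMapOn.comp hX.isFrechetManifold.covers T.smooth_u hh φ hφ c hc
  -- After inclusion into the larger model the map has components `loopChart ∘ π ∘ h` and `c ∘ u ∘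
  -- h`, known to be smooth; smoothness descends to the closed subspace.
  refine IsSmoothOn.of_isClosedEmbedding (halfModelIncl E) isClosedEmbedding_halfModelIncl ?_
  exact IsSmoothOn.of_iff (h1.prodMk h2) fun y =>
    ⟨fun h => ⟨h.1.1, h.1.2.1.1, h.2.2.1.2, h.1.2.2, h.2.2.2⟩,
      fun h => ⟨⟨h.1, ⟨h.2.1, trivial⟩, h.2.2.2.1⟩, h.1, ⟨h.2.1, h.2.2.1⟩, h.2.2.2.2⟩⟩

theorem isHalfStructure_halfAtlas : X.IsHalfStructure X.halfAtlas := by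
  have hX := X.isFrechetLieGroup.isFrechetManifold
  have hid : Atlas.SmoothMap X.halfAtlas X.halfAtlas (fun Φ => Φ) :=
    Atlas.smoothMap_of_charts fun χ hχ => X.smoothMapOn_halfAtlas (X.smoothMapOn_halfChart_symm hχ)
  have hj : Atlas.SmoothMap X.halfAtlas X.atlas Subtype.val :=
    Atlas.smoothMap_of_charts fun χ hχ => X.smoothMapOn_halfChart_symm hχ
  refine ⟨.of_smooth_id inferInstance X.covers_halfAtlas hid
    (Atlas.smooth_id_isOpen_target hid X.covers_halfAtlas)
    (hj.t2 Subtype.val_injective hX), hj, fun W C hC h hh => ?_⟩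
  have := hC.frechet
  exact X.smoothMapOn_halfAtlas hh

/-- In the charts around `η` and around its restriction, restricting to `[0, π]` is the continuous
linear map `halfRestrict`, the circle coordinate being forgotten. -/
theorem smooth_halfTarget_halfAtlas :
    Atlas.SmoothMap X.halfAtlas (pathAtlas E G) X.halfTarget := by
  have hhalf := X.isHalfStructure_halfAtlas.isFrechetManifold
  refine Atlas.smoothMap_of_charts fun χ hχ => ?_
  have hopen := hhalf.isOpen_target χ hχ
  obtain ⟨T, η, c, hc, rfl⟩ := hχ
  have h1 := (smoothMapOn_pathChart_symm (restrictHalf E G η)).comp_clm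
    ((halfRestrict E).comp (ContinuousLinearMap.fst ℝ (halfSubmodule E)
      (ULift.{u} (EuclideanSpace ℝ (Fin 1)))))
  have hsub : (T.halfChart η c).target ⊆ ((halfRestrict E).comp (ContinuousLinearMap.fst ℝ
      (halfSubmodule E) (ULift.{u} (EuclideanSpace ℝ (Fin 1))))) ⁻¹'
        (pathChart (restrictHalf E G η)).target := fun v hv t => hv.1.1 ((t : ℝ) : S1)
  refine (h1.mono_ofModel hopen hsub).congr fun v hv => ?_
  refine Subtype.ext (funext fun t => ?_)
  have h2 : (X.halfTarget ((T.halfChart η c).symm v)).1 t =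
    (X.π ((T.halfChart η c).symm v : X.carrier)).1 ((t : ℝ) : S1) := rfl
  refine h2.trans ?_
  have h3 : X.π ((T.halfChart η c).symm v : X.carrier) = (loopChart η.1).symm v.1.1 := by
    rw [T.halfChart_symm_val hv, T.π_mul hv.1.2]
  rw [h3, loopChart_symm_val hv.1.1, pathChart_symm_val (hsub hv)]
  rfl

/-- The universal property of `halfAtlas` makes the identity smooth from any other such structure
`C`, so the explicit atlas suffices. -/
theorem smooth_halfTarget {C : Atlas.{u, u} X.overHalf} (hC : X.IsHalfStructure C) :
    Atlas.SmoothMap C (pathAtlas E G) X.halfTarget := by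
  have := hC.isFrechetManifold.frechet
  exact Atlas.SmoothMap.comp X.covers_halfAtlas X.smooth_halfTarget_halfAtlas
    (X.isHalfStructure_halfAtlas.universal _ _ hC.isFrechetManifold _ hC.smooth)

end CentralExtension

end half

/-! ### The two strict Lie 2-groups of a fusion factorization -/

section fusion

variable {E : Type u} [NormedAddCommGroup E] [NormedSpace ℝ E] {G : Type u} [Group G]
  [TopologicalSpace G] [ChartedSpace E G] [LieGroup 𝓘(ℝ, E) ∞ G]

/-- Off the open upper half circle only the second path is seen. At the two boundary points both
paths agree: at `0` they start at the identity, at `π` they have the same end point. -/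
theorem exists_cup_of_notMem_upperHalf {x : S1} (hx : x ∉ upperHalf) :
    ∃ t : Ipi, ∀ p : pathPairs E G, (cup E G p).1 x = p.1.2.1 t := by
  have hπ := Real.pi_pos
  obtain ⟨t, h0, h1, rfl⟩ := exists_coe_Ico x
  rcases h0.eq_or_lt with rfl | h0'
  · refine ⟨⟨0, zero_mem_Ipi⟩, fun p => (cupFun_coe _ _ le_rfl h1).trans ?_⟩
    rw [if_pos hπ.le, pathExt_of_le _ le_rfl, p.1.1.2.2, p.1.2.2.2]
  have ht : Real.pi ≤ t := not_lt.1 fun h => hx ⟨t, ⟨h0', h⟩, rfl⟩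
  refine ⟨⟨2 * Real.pi - t, by linarith, by linarith⟩, fun p => (cupFun_coe _ _ h0 h1).trans ?_⟩
  split_ifs with h
  · obtain rfl : t = Real.pi := le_antisymm h ht
    rw [pathExt_of_ge _ le_rfl]
    refine Eq.trans p.2 (congrArg p.1.2.1 (Subtype.ext ?_))
    change Real.pi = 2 * Real.pi - Real.pi
    ring
  · exact pathExt_of_mem _ _

theorem cup_coe_Ipi (p : pathPairs E G) (t : Ipi) :
    (cup E G p).1 ((t : ℝ) : S1) = p.1.1.1 t := by
  refine (cupFun_coe _ _ t.2.1 (by linarith [t.2.2, Real.pi_pos])).trans ?_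
  rw [if_pos t.2.2, pathExt_of_mem _ t.2]

theorem cup_mem_upperHalf {p : pathPairs E G} (hp : p.1.2 = 1) :
    cup E G p ∈ loopsIn E G upperHalf := fun x hx => by
  obtain ⟨t, ht⟩ := exists_cup_of_notMem_upperHalf (E := E) (G := G) hx
  rw [ht, hp]
  rfl

theorem cup_mem_compl_upperHalf {p : pathPairs E G} (hp : p.1.1 = 1) :
    cup E G p ∈ loopsIn E G upperHalfᶜ := fun x hx => by
  obtain ⟨t, ht, rfl⟩ := Set.notMem_compl_iff.1 hx
  rw [cup_coe_Ipi p ⟨t, ht.1.le, ht.2.le⟩, hp]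
  rfl

theorem restrictHalf_pair_mem (η : loopsIn E G upperHalf) :
    (restrictHalf E G η, (1 : pathGroup E G)) ∈ pathPairs E G :=
  η.2 _ (coe_notMem_upperHalf le_rfl (by linarith [Real.pi_pos]))

theorem cup_restrictHalf (η : loopsIn E G upperHalf) :
    cup E G ⟨(restrictHalf E G η, 1), restrictHalf_pair_mem η⟩ = η := by
  refine Subtype.ext (funext fun x => ?_)
  by_cases hx : x ∈ upperHalf
  · obtain ⟨t, ht, rfl⟩ := hx
    exact cup_coe_Ipi _ ⟨t, ht.1.le, ht.2.le⟩
  · rw [η.2 x hx]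
    exact cup_mem_upperHalf rfl x hx

namespace CentralExtension

variable {X : CentralExtension E G}

theorem π_toExtension (Φ : X.overPairs) : X.π (X.toExtension Φ) = cup E G Φ.1.1 := Φ.2.symm

theorem overPairs_ext {Φ Ψ : X.overPairs} (ht : X.target Φ = X.target Ψ)
    (hs : X.source Φ = X.source Ψ) (he : X.toExtension Φ = X.toExtension Ψ) : Φ = Ψ :=
  Subtype.ext (Prod.ext (Subtype.ext (Prod.ext ht hs)) he)

/-- Disjoint commutativity makes the kernels of source and target commute. -/
theorem DisjointCommutative.mul_comm (hX : X.DisjointCommutative) {Φ Ψ : X.overPairs}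
    (hΦ : X.source Φ = 1) (hΨ : X.target Ψ = 1) : Φ * Ψ = Ψ * Φ := by
  refine overPairs_ext ?_ ?_ ?_
  · simp [hΨ]
  · simp [hΦ]
  · rw [map_mul, map_mul]
    refine hX upperHalf upperHalfᶜ disjoint_compl_right _ _ ?_ ?_
    · rw [π_toExtension]
      exact cup_mem_upperHalf hΦ
    · rw [π_toExtension]
      exact cup_mem_compl_upperHalf hΨ

theorem toExtension_mem_overHalf {Φ : X.overPairs} (h : X.source Φ = 1) :
    X.toExtension Φ ∈ X.overHalf := by
  change X.π (X.toExtension Φ) ∈ loopsIn E G upperHalf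
  rw [π_toExtension]
  exact cup_mem_upperHalf h

variable (X) in
/-- The restriction to the upper half circle as the kernel of the source map. -/
noncomputable def halfIncl : X.overHalf →* X.overPairs where
  toFun Φ := ⟨(⟨(X.halfTarget Φ, 1), restrictHalf_pair_mem ⟨X.π Φ, Φ.2⟩⟩, Φ),
    cup_restrictHalf ⟨X.π Φ, Φ.2⟩⟩
  map_one' := overPairs_ext (map_one X.halfTarget) rfl rfl
  map_mul' Φ Ψ := overPairs_ext (map_mul X.halfTarget Φ Ψ) (mul_one 1).symm rfl

theorem source_halfIncl (Φ : X.overHalf) : X.source (X.halfIncl Φ) = 1 := rfl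

theorem target_halfIncl (Φ : X.overHalf) : X.target (X.halfIncl Φ) = X.halfTarget Φ := rfl

theorem toExtension_halfIncl (Φ : X.overHalf) : X.toExtension (X.halfIncl Φ) = Φ := rfl

theorem halfTarget_toExtension {Φ : X.overPairs} (h : X.source Φ = 1) :
    X.halfTarget ⟨X.toExtension Φ, toExtension_mem_overHalf h⟩ = X.target Φ := by
  refine Subtype.ext (funext fun t => ?_)
  have h1 : (X.halfTarget ⟨X.toExtension Φ, toExtension_mem_overHalf h⟩).1 t =
    (X.π (X.toExtension Φ)).1 ((t : ℝ) : S1) := rfl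
  rw [h1, π_toExtension]
  exact cup_coe_Ipi _ t

theorem halfIncl_toExtension {Φ : X.overPairs} (h : X.source Φ = 1) :
    X.halfIncl ⟨X.toExtension Φ, toExtension_mem_overHalf h⟩ = Φ :=
  overPairs_ext (halfTarget_toExtension h) h.symm rfl

/-! ### The splitting of the source map by a fusion factorization. -/

namespace FusionFactorization

variable (i : X.FusionFactorization)

theorem source_toHom (γ : pathGroup E G) : X.source (i.toHom γ) = γ := by
  change (i.toHom γ).1.1.1.2 = γ
  rw [i.lifts]
  rfl

theorem target_toHom (γ : pathGroup E G) : X.target (i.toHom γ) = γ := by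
  change (i.toHom γ).1.1.1.1 = γ
  rw [i.lifts]
  rfl

theorem canonicalAction_apply (γ : pathGroup E G) (Φ : X.overHalf) :
    (X.canonicalAction γ Φ : X.carrier) =
      X.toExtension (i.toHom γ) * Φ * (X.toExtension (i.toHom γ))⁻¹ :=
  X.canonicalAction_apply (by rw [π_toExtension, i.lifts]) Φ

theorem source_mul_inv (Φ : X.overPairs) : X.source (Φ * (i.toHom (X.source Φ))⁻¹) = 1 := by
  rw [map_mul, map_inv, i.source_toHom, mul_inv_cancel]

/-- The morphism `Φ i(s(Φ))⁻¹`, as an element of the restriction to the upper half circle. -/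
noncomputable def toHalf (Φ : X.overPairs) : X.overHalf :=
  ⟨X.toExtension (Φ * (i.toHom (X.source Φ))⁻¹), toExtension_mem_overHalf (i.source_mul_inv Φ)⟩

theorem coe_toHalf (Φ : X.overPairs) : (i.toHalf Φ : X.carrier) =
    X.toExtension Φ * (X.toExtension (i.toHom (X.source Φ)))⁻¹ := by
  rw [← map_inv, ← map_mul]
  rfl

theorem halfTarget_toHalf (Φ : X.overPairs) :
    X.halfTarget (i.toHalf Φ) = X.target Φ * (X.source Φ)⁻¹ := by
  rw [toHalf, halfTarget_toExtension (i.source_mul_inv Φ), map_mul, map_inv, i.target_toHom]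

/-- Insert `i(s(Φ))⁻¹ i(s(Φ))` between `Φ` and `Ψ i(s(Ψ))⁻¹`: what follows the first factor is a
conjugate by `i(s(Φ))`, a lift of `s(Φ) ∪ s(Φ)`. This is the semidirect product law. -/
theorem toHalf_mul (Φ Ψ : X.overPairs) :
    i.toHalf (Φ * Ψ) = i.toHalf Φ * X.canonicalAction (X.source Φ) (i.toHalf Ψ) := by
  refine Subtype.ext ?_
  rw [Subgroup.coe_mul, i.canonicalAction_apply, coe_toHalf, coe_toHalf, coe_toHalf]
  simp [mul_assoc]

theorem toHalf_toHom (γ : pathGroup E G) : i.toHalf (i.toHom γ) = 1 := by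
  refine Subtype.ext ?_
  rw [coe_toHalf, i.source_toHom, mul_inv_cancel]
  rfl

/-- Morphisms are in bijection with `Ω̃_{(0, π)}G × P_e G`. -/
noncomputable def pairsEquiv : X.overPairs ≃ X.overHalf × pathGroup E G where
  toFun Φ := (i.toHalf Φ, X.source Φ)
  invFun y := X.halfIncl y.1 * i.toHom y.2
  left_inv Φ := by
    change X.halfIncl (i.toHalf Φ) * _ = Φ
    rw [toHalf, halfIncl_toExtension (i.source_mul_inv Φ), inv_mul_cancel_right]
  right_inv y := by
    have hs : X.source (X.halfIncl y.1 * i.toHom y.2) = y.2 := by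
      rw [map_mul, source_halfIncl, i.source_toHom, one_mul]
    refine Prod.ext (Subtype.ext ?_) hs
    rw [coe_toHalf, hs, map_mul, toExtension_halfIncl, mul_inv_cancel_right]

theorem pairsEquiv_symm_components (y : X.overHalf × pathGroup E G) :
    (((i.pairsEquiv.symm y).1.1.1, (i.pairsEquiv.symm y).1.2) :
      (pathGroup E G × pathGroup E G) × X.carrier) =
      ((X.halfTarget y.1 * y.2, y.2), (y.1 : X.carrier) * X.toExtension (i.toHom y.2)) := by
  have hs : X.source (X.halfIncl y.1 * i.toHom y.2) = y.2 := by
    rw [map_mul, source_halfIncl, i.source_toHom, one_mul]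
  have ht : X.target (X.halfIncl y.1 * i.toHom y.2) = X.halfTarget y.1 * y.2 := by
    rw [map_mul, target_halfIncl, i.target_toHom]
  exact Prod.ext (Prod.ext ht hs) rfl

variable [CompleteSpace E] [T2Space G] {C : Atlas.{u, u} X.overHalf}

theorem smooth_pairsEquiv_symm_components (hC : X.IsHalfStructure C) :
    Atlas.SmoothMap (C.prod (pathAtlas E G)) (((pathAtlas E G).prod (pathAtlas E G)).prod X.atlas)
      (fun y => ((i.pairsEquiv.symm y).1.1.1, (i.pairsEquiv.symm y).1.2)) := by
  have hP := isFrechetLieGroup_pathAtlas (E := E) (G := G)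
  have hPm := hP.isFrechetManifold
  have hX := X.isFrechetLieGroup
  have hCm := hC.isFrechetManifold
  have := hCm.frechet
  have := hX.isFrechetManifold.frechet
  rw [funext i.pairsEquiv_symm_components]
  have f1 := hCm.smooth_fst hPm
  have f2 := hCm.smooth_snd hPm
  exact ((hP.mul inferInstance ((X.smooth_halfTarget hC).comp hCm.covers f1) f2).prodMk f2).prodMk
    (hX.mul inferInstance (hC.smooth.comp hCm.covers f1) (i.smooth.comp hPm.covers f2))

/-- Source and component in the extension determine the value, through the formula `Φ i(s(Φ))⁻¹`;
the universal property of `C` allows smoothness to be checked in the extension. -/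
theorem smooth_toHalf {W : Type u} {D : Atlas.{u, u} W} (hD : D.IsFrechetManifold)
    (hC : X.IsHalfStructure C) {h : W → X.overPairs}
    (hs : Atlas.SmoothMap D (pathAtlas E G) fun x => X.source (h x))
    (he : Atlas.SmoothMap D X.atlas fun x => X.toExtension (h x)) :
    Atlas.SmoothMap D C fun x => i.toHalf (h x) := by
  have hX := X.isFrechetLieGroup
  have := hX.isFrechetManifold.frechet
  have := hD.frechet
  refine hC.universal W D hD _ ?_
  simp only [coe_toHalf]
  exact hX.mul inferInstance he (hX.inv inferInstance
    (i.smooth.comp isFrechetManifold_pathAtlas.covers hs))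

end FusionFactorization

/-! ### Manifold structures, smoothness of structure maps and the isomorphism. -/

section structures

variable [CompleteSpace E] [T2Space G] {B : Atlas.{u, u} X.overPairs} {C : Atlas.{u, u} X.overHalf}

theorem isFrechetManifold_ambient :
    (((pathAtlas E G).prod (pathAtlas E G)).prod X.atlas).IsFrechetManifold :=
  (isFrechetManifold_pathAtlas.prod isFrechetManifold_pathAtlas).prod
    X.isFrechetLieGroup.isFrechetManifold

variable {W : Type u} {D : Atlas.{u, u} W} {h : W → X.overPairs}

theorem smooth_source_of_components (hD : D.IsFrechetManifold)
    (hh : Atlas.SmoothMap D (((pathAtlas E G).prod (pathAtlas E G)).prod X.atlas)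
      (fun x => ((h x).1.1.1, (h x).1.2))) :
    Atlas.SmoothMap D (pathAtlas E G) fun x => X.source (h x) := by
  have := hD.frechet
  have := X.isFrechetLieGroup.isFrechetManifold.frechet
  have hP := isFrechetManifold_pathAtlas (E := E) (G := G)
  exact (hP.smooth_snd hP).comp (hP.prod hP).covers
    (((hP.prod hP).smooth_fst X.isFrechetLieGroup.isFrechetManifold).comp
      isFrechetManifold_ambient.covers hh)

theorem smooth_target_of_components (hD : D.IsFrechetManifold)
    (hh : Atlas.SmoothMap D (((pathAtlas E G).prod (pathAtlas E G)).prod X.atlas)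
      (fun x => ((h x).1.1.1, (h x).1.2))) :
    Atlas.SmoothMap D (pathAtlas E G) fun x => X.target (h x) := by
  have := hD.frechet
  have := X.isFrechetLieGroup.isFrechetManifold.frechet
  have hP := isFrechetManifold_pathAtlas (E := E) (G := G)
  exact (hP.smooth_fst hP).comp (hP.prod hP).covers
    (((hP.prod hP).smooth_fst X.isFrechetLieGroup.isFrechetManifold).comp
      isFrechetManifold_ambient.covers hh)

theorem smooth_toExtension_of_components (hD : D.IsFrechetManifold)
    (hh : Atlas.SmoothMap D (((pathAtlas E G).prod (pathAtlas E G)).prod X.atlas)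
      (fun x => ((h x).1.1.1, (h x).1.2))) :
    Atlas.SmoothMap D X.atlas fun x => X.toExtension (h x) := by
  have := hD.frechet
  have := X.isFrechetLieGroup.isFrechetManifold.frechet
  have hP := isFrechetManifold_pathAtlas (E := E) (G := G)
  exact ((hP.prod hP).smooth_snd X.isFrechetLieGroup.isFrechetManifold).comp
    isFrechetManifold_ambient.covers hh

/-- Existence of the fibre product. The product structure has a smooth inclusion, with components
`t(Ψ)γ`, `γ` and `Ψ i(γ)`, and a map into it is smooth as soon as its source and extension
components are. -/
theorem isPairsStructure_comapEquiv (i : X.FusionFactorization) (hC : X.IsHalfStructure C) :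
    X.IsPairsStructure ((C.prod (pathAtlas E G)).comapEquiv i.pairsEquiv) := by
  refine ⟨(hC.isFrechetManifold.prod isFrechetManifold_pathAtlas).comapEquiv _,
    (Atlas.smoothMap_comapEquiv_left _).2 (i.smooth_pairsEquiv_symm_components hC),
    fun W D hD h hh => (Atlas.smoothMap_comapEquiv_right _).2 ?_⟩
  have hs := smooth_source_of_components hD hh
  exact (i.smooth_toHalf hD hC hs (smooth_toExtension_of_components hD hh)).prodMk hs

theorem isLieCrossedModule (hX : X.DisjointCommutative) (i : X.FusionFactorization)
    (hC : X.IsHalfStructure C) : (X.crossedModule C).IsLieCrossedModule where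
  lie_H := Atlas.IsInduced.isFrechetLieGroup hC X.isFrechetLieGroup (fun _ _ => rfl) fun _ => rfl
  lie_K := isFrechetLieGroup_pathAtlas
  smooth_t := X.smooth_halfTarget hC
  smooth_act := by
    have hP := isFrechetManifold_pathAtlas (E := E) (G := G)
    have hCm := hC.isFrechetManifold
    have hE := X.isFrechetLieGroup
    have := hCm.frechet
    have := hE.isFrechetManifold.frechet
    refine hC.universal _ _ (hP.prod hCm) (fun p => X.canonicalAction p.1 p.2) ?_
    -- The fusion factorization provides a global smooth choice of lifts of `γ ∪ γ`, so the action
    -- is a smooth expression in the extension.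
    simp only [i.canonicalAction_apply]
    have h1 := i.smooth.comp hP.covers (hP.smooth_fst hCm)
    exact hE.mul inferInstance (hE.mul inferInstance h1
      (hC.smooth.comp hCm.covers (hP.smooth_snd hCm))) (hE.inv inferInstance h1)
  peiffer (Φ Ψ : X.overHalf) := by
    refine Subtype.ext ((i.canonicalAction_apply (X.halfTarget Φ) Ψ).trans ?_)
    -- `Φ⁻¹ i(t(Φ))` has trivial target and so commutes with `Ψ`; hence conjugation by `i(t(Φ))` and
    -- by `Φ` agree on `Ψ`.
    have h := hX.mul_comm (Φ := X.halfIncl Ψ)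
      (Ψ := (X.halfIncl Φ)⁻¹ * i.toHom (X.halfTarget Φ)) rfl (by
        rw [map_mul, map_inv, target_halfIncl, i.target_toHom, inv_mul_cancel])
    have h := congrArg X.toExtension h
    simp only [map_mul, map_inv, toExtension_halfIncl] at h
    rw [mul_inv_eq_iff_eq_mul]
    change _ = (Φ : X.carrier) * Ψ * (Φ : X.carrier)⁻¹ * _
    rw [mul_assoc (Φ * Ψ : X.carrier), mul_assoc (Φ : X.carrier), h]
    simp [mul_assoc]

theorem isFrechetLieGroup_overPairs (hB : X.IsPairsStructure B) : B.IsFrechetLieGroup :=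
  Atlas.IsInduced.isFrechetLieGroup hB
    ((isFrechetLieGroup_pathAtlas.prod isFrechetLieGroup_pathAtlas).prod X.isFrechetLieGroup)
    (fun _ _ => rfl) fun _ => rfl

theorem smooth_pairsEquiv (i : X.FusionFactorization) (hB : X.IsPairsStructure B)
    (hC : X.IsHalfStructure C) : Atlas.SmoothMap B (C.prod (pathAtlas E G)) i.pairsEquiv := by
  have hBm := hB.isFrechetManifold
  have hs := smooth_source_of_components hBm hB.smooth
  exact (i.smooth_toHalf hBm hC hs (smooth_toExtension_of_components hBm hB.smooth)).prodMk hs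

theorem smooth_pairsEquiv_symm (i : X.FusionFactorization) (hB : X.IsPairsStructure B)
    (hC : X.IsHalfStructure C) :
    Atlas.SmoothMap (C.prod (pathAtlas E G)) B i.pairsEquiv.symm :=
  hB.universal _ _ (hC.isFrechetManifold.prod isFrechetManifold_pathAtlas) _
    (i.smooth_pairsEquiv_symm_components hC)

theorem smooth_toHom (i : X.FusionFactorization) (hB : X.IsPairsStructure B) :
    Atlas.SmoothMap (pathAtlas E G) B i.toHom := by
  have hP := isFrechetManifold_pathAtlas (E := E) (G := G)
  refine hB.universal _ _ hP _ ?_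
  have h (γ : pathGroup E G) : ((i.toHom γ).1.1.1, (i.toHom γ).1.2) =
      ((γ, γ), X.toExtension (i.toHom γ)) :=
    Prod.ext (Prod.ext (i.target_toHom γ) (i.source_toHom γ)) rfl
  rw [funext h]
  exact (hP.smooth_id.prodMk hP.smooth_id).prodMk i.smooth

theorem isStrictLieTwoGroup_fusionTwoGroup (hX : X.DisjointCommutative)
    (i : X.FusionFactorization) (hB : X.IsPairsStructure B) (hC : X.IsHalfStructure C) :
    (X.fusionTwoGroup i B).IsStrictLieTwoGroup := by
  have hBm := hB.isFrechetManifold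
  have hs := smooth_source_of_components hBm hB.smooth
  exact isStrictLieTwoGroup_ofMinimalData (p := i.toHalf) (m := i.pairsEquiv.symm)
    isFrechetLieGroup_pathAtlas (isFrechetLieGroup_overPairs hB) hC.isFrechetManifold hs
    (smooth_target_of_components hBm hB.smooth) (smooth_toHom i hB) i.source_toHom i.target_toHom
    (fun _ _ => hX.mul_comm) (fun y => congrArg Prod.fst (i.pairsEquiv.apply_symm_apply y))
    (fun y => congrArg Prod.snd (i.pairsEquiv.apply_symm_apply y)) i.pairsEquiv.symm_apply_apply
    (i.smooth_toHalf hBm hC hs (smooth_toExtension_of_components hBm hB.smooth))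
    (smooth_pairsEquiv_symm i hB hC)

/-- The isomorphism on morphisms, `Φ ↦ (Φ i(s(Φ))⁻¹, s(Φ))`. -/
noncomputable def pairsMulEquiv (i : X.FusionFactorization) :
    X.overPairs ≃* X.overHalf ⋊[X.canonicalAction] pathGroup E G where
  toEquiv := i.pairsEquiv.trans SemidirectProduct.equivProd.symm
  map_mul' Φ Ψ := SemidirectProduct.ext (i.toHalf_mul Φ Ψ) (map_mul X.source Φ Ψ)

theorem pairsMulEquiv_toHom (i : X.FusionFactorization) (γ : pathGroup E G) :
    pairsMulEquiv i (i.toHom γ) = SemidirectProduct.inr γ :=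
  SemidirectProduct.ext (i.toHalf_toHom γ) (i.source_toHom γ)

theorem pairsMulEquiv_comp (i : X.FusionFactorization) (Φ Ψ : X.overPairs) :
    pairsMulEquiv i (Φ * (i.toHom (X.source Φ))⁻¹ * Ψ) = pairsMulEquiv i Φ *
      (SemidirectProduct.inr (X.source Φ))⁻¹ * pairsMulEquiv i Ψ := by
  rw [map_mul, map_mul, map_inv, pairsMulEquiv_toHom]

theorem pairsMulEquiv_inv (i : X.FusionFactorization) (Φ : X.overPairs) :
    pairsMulEquiv i (i.toHom (X.source Φ) * Φ⁻¹ * i.toHom (X.target Φ)) =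
      SemidirectProduct.inr (X.source Φ) * (pairsMulEquiv i Φ)⁻¹ *
        SemidirectProduct.inr (X.halfTarget (i.toHalf Φ) * X.source Φ) := by
  rw [i.halfTarget_toHalf, inv_mul_cancel_right, map_mul, map_mul, map_inv, pairsMulEquiv_toHom,
    pairsMulEquiv_toHom]

/-- The canonical isomorphism of strict Lie 2-groups. -/
noncomputable def fusionIso (i : X.FusionFactorization) (hB : X.IsPairsStructure B)
    (hC : X.IsHalfStructure C) : (X.fusionTwoGroup i B).Iso (X.crossedModule C).toTwoGroup where
  ob := MulEquiv.refl _
  mor := pairsMulEquiv i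
  smooth_ob := (isFrechetManifold_pathAtlas (E := E) (G := G)).smooth_id
  smooth_ob_symm := (isFrechetManifold_pathAtlas (E := E) (G := G)).smooth_id
  smooth_mor := (Atlas.smoothMap_comapEquiv_right _).2 (smooth_pairsEquiv i hB hC)
  smooth_mor_symm := (Atlas.smoothMap_comapEquiv_left _).2 (smooth_pairsEquiv_symm i hB hC)
  map_s := fun _ => rfl
  map_t := fun (Φ : X.overPairs) => by
    change X.halfTarget (i.toHalf Φ) * X.source Φ = X.target Φ
    rw [i.halfTarget_toHalf, inv_mul_cancel_right]
  map_i := fun γ => (pairsMulEquiv_toHom i γ).symm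
  map_comp := fun Φ Ψ _ => pairsMulEquiv_comp i Φ Ψ
  map_invMor := fun Φ => pairsMulEquiv_inv i Φ

end structures

end CentralExtension

end fusion

end LoopTwoGroup

/-! ### The theorem. -/

open LoopTwoGroup

theorem mainTheorem12 {E : Type u} [NormedAddCommGroup E] [NormedSpace ℝ E]
    [FiniteDimensional ℝ E] {G : Type u} [Group G] [TopologicalSpace G] [T2Space G]
    [ConnectedSpace G] [ChartedSpace E G] [LieGroup 𝓘(ℝ, E) ∞ G]
    (X : CentralExtension E G) (hX : X.DisjointCommutative) (i : X.FusionFactorization) :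
    (∃ B : Atlas.{u, u} X.overPairs, X.IsPairsStructure B) ∧
    (∃ C : Atlas.{u, u} X.overHalf, X.IsHalfStructure C) ∧
    ∀ (B : Atlas.{u, u} X.overPairs) (C : Atlas.{u, u} X.overHalf),
      X.IsPairsStructure B → X.IsHalfStructure C →
      (X.fusionTwoGroup i B).IsStrictLieTwoGroup ∧
      (X.crossedModule C).IsLieCrossedModule ∧
      (X.crossedModule C).toTwoGroup.IsStrictLieTwoGroup ∧
      ∃ Θ : (X.fusionTwoGroup i B).Iso (X.crossedModule C).toTwoGroup,
        (∀ γ : pathGroup E G, Θ.ob γ = γ) ∧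
        ∀ Φ : X.overPairs,
          (Θ.mor Φ).right = X.source Φ ∧
          X.overHalf.subtype (Θ.mor Φ).left =
            X.toExtension Φ * (X.toExtension (i.toHom (X.source Φ)))⁻¹ := by
  -- Finite dimensionality is used only through completeness, which makes the path and loop models
  -- Fréchet spaces.
  have : CompleteSpace E := FiniteDimensional.complete ℝ E
  refine ⟨⟨_, CentralExtension.isPairsStructure_comapEquiv i X.isHalfStructure_halfAtlas⟩,
    ⟨_, X.isHalfStructure_halfAtlas⟩, fun B C hB hC => ?_⟩
  have hcm := CentralExtension.isLieCrossedModule hX i hC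
  exact ⟨CentralExtension.isStrictLieTwoGroup_fusionTwoGroup hX i hB hC, hcm,
    hcm.isStrictLieTwoGroup, CentralExtension.fusionIso i hB hC, fun _ => rfl,
    fun Φ => ⟨rfl, i.coe_toHalf Φ⟩⟩
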